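/- **Theorem.** Let $R$ be a commutative ring. All cooperads below are in arities $\geq 1$ and are described by partial cocompositions: such a dg-cooperad $C$ consists of a chain complex $C(A)$ of $R$-modules for each nonempty finite set $A$, functorial in bijections, partial cocompositions $\Delta_v\colon C(A\sqcup_v B)\to C(A)\otimes C(B)$ for $v\in A$, where $A\sqcup_v B=(A\setminus\{v\})\sqcup B$, and a counit $C(\{*\})\to R$, subject to equivariance, counitality, sequential and parallel coassociativity (with Koszul signs) and compatibility with the differential. For a nonempty finite set $A$ and an integer $d$ let $\mathrm{Surj}_R(A)_d$ be the free $R$-module on the sequences $\mathbf u=(u_1,\dots,u_p)$ in $A$ with $p=|A|+d$ that are nondegenerate: every element of $A$ occurs and $u_\alpha\neq u_{\alpha+1}$ for all $\alpha$. Degenerate sequences are read as $0$. Bijections act by renaming entries. A *caesura* of $\mathbf u$ is an entry that is not the last occurrence of that element in $\mathbf u$. Define * the differential $\partial\mathbf u=\sum_{\alpha}\epsilon_\alpha\,(u_1,\dots,\widehat{u_\alpha},\dots,u_p)$, where the caesuras carry alternating signs $\epsilon_\alpha$ starting with $+$, and the last occurrence of an element carries the sign opposite to that of its previous occurrence ($0$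 if there is none); * for $\mathbf u$ in $A\sqcup_v B$ with subsequence $(u_{\alpha(1)},\dots,u_{\alpha(k)})$ of entries in $B$, the cocomposition $\Delta_v(\mathbf u)=\sum_{i=1}^k\pm_i\,\mathbf v_i\otimes\mathbf w_i$, where $\mathbf w_i=(u_{\alpha(i)},\dots,u_{\alpha(k)})$ and $\mathbf v_i$ is obtained from $\mathbf u$ by replacing $u_{\alpha(1)},\dots,u_{\alpha(i)}$ by $v$ and deleting $u_{\alpha(i+1)},\dots,u_{\alpha(k)}$. The sign $\pm_i$ is $-1$ to the number of pairs of caesuras of $\mathbf u$ that pass along each other, i.e. pairs $\beta<\gamma$ of positions of caesuras with $\beta\geq\alpha(i)$, $u_\beta\in B$ and $u_\gamma\notin B$; * the counit $\mathrm{Surj}_R(\{*\})_0\to R$, $(*)\mapsto 1$. Then $\mathrm{Surj}_R$ is a dg-cooperad, it is concentrated in non-negative degrees, and it is $\Sigma$-cofibrant: each $\mathrm{Surj}_R(A)$ is cofibrant in the projective model structure on chain complexes of $R[\mathrm{Aut}(A)]$-modules, that is, $0\to \mathrm{Surj}_R(A)$ has the left lifting property against all surjective quasi-isomorphisms. Moreover,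 the maps sending every nondegenerate sequence of degree $0$ to $1$ and all sequences of positive degree to $0$ form a quasi-isomorphism of dg-cooperads $\mathrm{Surj}_R\to\mathrm{coCom}^{\mathrm{nu}}_R$ to the cooperad of nonunital cocommutative coalgebras, which is $R$ in degree $0$ in every arity $\geq1$, with trivial action, identity counit and $\Delta_v(1)=1\otimes 1$. -/

import Mathlib

open CategoryTheory
open scoped TensorProduct

universe u

/-! ### Partial composition of finite sets -/

/-- The set `A ⊔_v B` obtained from `A` by removing `v` and adding the elements of `B`. -/
abbrev Graft (A : Type) (v : A) (B : Type) : Type := {a : A // a ≠ v} ⊕ B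

namespace Graft

/-- The bijection `A ⊔_v B ≃ A' ⊔_{e v} B'` induced by bijections `e : A ≃ A'` and `f : B ≃ B'`. -/
def congr {A A' B B' : Type} (e : A ≃ A') (f : B ≃ B') (v : A) :
    Graft A v B ≃ Graft A' (e v) B' :=
  Equiv.sumCongr (e.subtypeEquiv (fun _ => by simp)) f

/-- `A ⊔_v {*} ≃ A`, sending `*` to `v`. -/
noncomputable def rightUnit {A : Type} (v : A) : Graft A v Unit ≃ A :=
  Equiv.ofBijective (Sum.elim Subtype.val (fun _ => v)) <| by
    constructor
    · rintro (⟨a, ha⟩ | a) (⟨b, hb⟩ | b) h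
      · simpa using h
      · exact absurd h ha
      · exact absurd h.symm hb
      · rfl
    · intro a
      by_cases h : a = v
      · exact ⟨Sum.inr (), h.symm⟩
      · exact ⟨Sum.inl ⟨a, h⟩, rfl⟩

/-- `{*} ⊔_* B ≃ B`. -/
def leftUnit (B : Type) : Graft Unit () B ≃ B where
  toFun := Sum.elim (fun a => absurd rfl a.2) id
  invFun := Sum.inr
  left_inv := by
    rintro (⟨a, ha⟩ | b)
    · exact absurd rfl ha
    · rfl
  right_inv _ := rfl

/-- `(A ⊔_v B) ⊔_w C ≃ A ⊔_v (B ⊔_w C)` for `v ∈ A` and `w ∈ B`. -/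
def assoc {A B : Type} (v : A) (w : B) (C : Type) :
    Graft (Graft A v B) (Sum.inr w) C ≃ Graft A v (Graft B w C) where
  toFun
    | Sum.inl ⟨Sum.inl a, _⟩ => Sum.inl a
    | Sum.inl ⟨Sum.inr b, h⟩ => Sum.inr (Sum.inl ⟨b, fun e => h (congrArg Sum.inr e)⟩)
    | Sum.inr c => Sum.inr (Sum.inr c)
  invFun
    | Sum.inl a => Sum.inl ⟨Sum.inl a, Sum.inl_ne_inr⟩
    | Sum.inr (Sum.inl ⟨b, h⟩) => Sum.inl ⟨Sum.inr b, fun e => h (Sum.inr_injective e)⟩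
    | Sum.inr (Sum.inr c) => Sum.inr c
  left_inv := by rintro (⟨a | b, h⟩ | c) <;> rfl
  right_inv := by rintro (a | ⟨b, h⟩ | c) <;> rfl

/-- `(A ⊔_v B) ⊔_w C ≃ (A ⊔_w C) ⊔_v B` for `v ≠ w` in `A`. -/
def swap {A : Type} {v w : A} (h : v ≠ w) (B C : Type) :
    Graft (Graft A v B) (Sum.inl ⟨w, h.symm⟩) C ≃ Graft (Graft A w C) (Sum.inl ⟨v, h⟩) B where
  toFun
    | Sum.inl ⟨Sum.inl a, k⟩ =>
        Sum.inl ⟨Sum.inl ⟨a.1, fun e => k (congrArg Sum.inl (Subtype.ext e))⟩,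
          fun e => a.2 (congrArg Subtype.val (Sum.inl_injective e))⟩
    | Sum.inl ⟨Sum.inr b, _⟩ => Sum.inr b
    | Sum.inr c => Sum.inl ⟨Sum.inr c, Sum.inr_ne_inl⟩
  invFun
    | Sum.inl ⟨Sum.inl a, k⟩ =>
        Sum.inl ⟨Sum.inl ⟨a.1, fun e => k (congrArg Sum.inl (Subtype.ext e))⟩,
          fun e => a.2 (congrArg Subtype.val (Sum.inl_injective e))⟩
    | Sum.inl ⟨Sum.inr c, _⟩ => Sum.inr c
    | Sum.inr b => Sum.inl ⟨Sum.inr b, Sum.inr_ne_inl⟩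
  left_inv := by rintro (⟨a | b, k⟩ | c) <;> rfl
  right_inv := by rintro (⟨a | b, k⟩ | c) <;> rfl

end Graft

/-! ### Differential graded cooperads -/

/-- The data underlying a dg-cooperad over `R` (with no cooperations of arity zero), in the
coordinate-free description by partial cocompositions: a graded module `X A` for every nonempty
finite set `A`, with a degree `-1` differential, the action of bijections, the counit on
`X {*}`, and for `v ∈ A` the components `X (A ⊔_v B)_n → X(A)_p ⊗ X(B)_q` of the partial
cocomposition `Δ_v : X (A ⊔_v B) → X(A) ⊗ X(B)`. -/
structure CooperadData (R : Type u) [CommRing R] where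
  X : (A : Type) → [Finite A] → [Nonempty A] → ℤ → Type u
  [addCommGroup : ∀ (A : Type) [Finite A] [Nonempty A] (n : ℤ), AddCommGroup (X A n)]
  [module : ∀ (A : Type) [Finite A] [Nonempty A] (n : ℤ), Module R (X A n)]
  d : ∀ (A : Type) [Finite A] [Nonempty A] (n m : ℤ), X A n →ₗ[R] X A m
  map : ∀ {A B : Type} [Finite A] [Nonempty A] [Finite B] [Nonempty B] (_ : A ≃ B) (n : ℤ),
    X A n →ₗ[R] X B n
  counit : X Unit 0 →ₗ[R] R
  cocomp : ∀ {A : Type} [Finite A] [Nonempty A] (v : A) (B : Type) [Finite B] [Nonempty B]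
    (n p q : ℤ), X (Graft A v B) n →ₗ[R] X A p ⊗[R] X B q

attribute [instance] CooperadData.addCommGroup CooperadData.module

/-- The axioms of a dg-cooperad. -/
structure CooperadData.IsDGCooperad {R : Type u} [CommRing R] (C : CooperadData R) : Prop where
  /-- the differential has degree `-1` -/
  d_shape : ∀ (A : Type) [Finite A] [Nonempty A] (n m : ℤ), m + 1 ≠ n → C.d A n m = 0
  d_comp_d : ∀ (A : Type) [Finite A] [Nonempty A] (n m k : ℤ), C.d A m k ∘ₗ C.d A n m = 0
  map_refl : ∀ (A : Type) [Finite A] [Nonempty A] (n : ℤ),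
    C.map (Equiv.refl A) n = LinearMap.id
  map_trans : ∀ {A B D : Type} [Finite A] [Nonempty A] [Finite B] [Nonempty B] [Finite D]
    [Nonempty D] (e : A ≃ B) (f : B ≃ D) (n : ℤ),
    C.map (e.trans f) n = C.map f n ∘ₗ C.map e n
  map_d : ∀ {A B : Type} [Finite A] [Nonempty A] [Finite B] [Nonempty B] (e : A ≃ B) (n m : ℤ),
    C.map e m ∘ₗ C.d A n m = C.d B n m ∘ₗ C.map e n
  /-- the counit is a chain map to `R` placed in degree zero -/
  counit_d : C.counit ∘ₗ C.d Unit 1 0 = 0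
  /-- the partial cocompositions preserve degrees -/
  cocomp_degree : ∀ {A : Type} [Finite A] [Nonempty A] (v : A) (B : Type) [Finite B] [Nonempty B]
    (n p q : ℤ), p + q ≠ n → C.cocomp v B n p q = 0
  /-- the partial cocompositions take values in the direct sum -/
  cocomp_finite : ∀ {A : Type} [Finite A] [Nonempty A] (v : A) (B : Type) [Finite B] [Nonempty B]
    (n : ℤ) (x : C.X (Graft A v B) n), {pq : ℤ × ℤ | C.cocomp v B n pq.1 pq.2 x ≠ 0}.Finite
  /-- the partial cocompositions are chain maps -/
  cocomp_d : ∀ {A : Type} [Finite A] [Nonempty A] (v : A) (B : Type) [Finite B] [Nonempty B]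
    (n p q : ℤ), C.cocomp v B n p q ∘ₗ C.d (Graft A v B) (n + 1) n =
      (C.d A (p + 1) p).rTensor (C.X B q) ∘ₗ C.cocomp v B (n + 1) (p + 1) q +
      p.negOnePow • ((C.d B (q + 1) q).lTensor (C.X A p) ∘ₗ C.cocomp v B (n + 1) p (q + 1))
  /-- the partial cocompositions are equivariant -/
  cocomp_map : ∀ {A A' B B' : Type} [Finite A] [Nonempty A] [Finite A'] [Nonempty A']
    [Finite B] [Nonempty B] [Finite B'] [Nonempty B'] (e : A ≃ A') (f : B ≃ B') (v : A)
    (n p q : ℤ), C.cocomp (e v) B' n p q ∘ₗ C.map (Graft.congr e f v) n =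
      TensorProduct.map (C.map e p) (C.map f q) ∘ₗ C.cocomp v B n p q
  counit_right : ∀ {A : Type} [Finite A] [Nonempty A] (v : A) (n : ℤ),
    (TensorProduct.rid R (C.X A n)).toLinearMap ∘ₗ C.counit.lTensor (C.X A n) ∘ₗ
      C.cocomp v Unit n n 0 = C.map (Graft.rightUnit v) n
  counit_left : ∀ (B : Type) [Finite B] [Nonempty B] (n : ℤ),
    (TensorProduct.lid R (C.X B n)).toLinearMap ∘ₗ C.counit.rTensor (C.X B n) ∘ₗ
      C.cocomp () B n 0 n = C.map (Graft.leftUnit B) n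
  /-- sequential coassociativity, in `X(A)_p ⊗ X(B)_q ⊗ X(D)_t` -/
  coassoc_seq : ∀ {A B : Type} [Finite A] [Nonempty A] [Finite B] [Nonempty B] (v : A) (w : B)
    (D : Type) [Finite D] [Nonempty D] (n p q t : ℤ),
    (TensorProduct.assoc R (C.X A p) (C.X B q) (C.X D t)).toLinearMap ∘ₗ
      (C.cocomp v B (p + q) p q).rTensor (C.X D t) ∘ₗ
      C.cocomp (A := Graft A v B) (Sum.inr w) D n (p + q) t =
    (C.cocomp w D (q + t) q t).lTensor (C.X A p) ∘ₗ
      C.cocomp v (Graft B w D) n p (q + t) ∘ₗ C.map (Graft.assoc v w D) n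
  /-- parallel coassociativity, in `X(A)_p ⊗ X(D)_t ⊗ X(B)_q`, with the Koszul sign of the
  exchange of the factors `X(B)_q` and `X(D)_t` -/
  coassoc_par : ∀ {A : Type} [Finite A] [Nonempty A] {v w : A} (h : v ≠ w) (B D : Type)
    [Finite B] [Nonempty B] [Finite D] [Nonempty D] (n p q t : ℤ),
    (q * t).negOnePow • ((TensorProduct.rightComm R (C.X A p) (C.X B q) (C.X D t)).toLinearMap ∘ₗ
      (C.cocomp v B (p + q) p q).rTensor (C.X D t) ∘ₗ
      C.cocomp (A := Graft A v B) (Sum.inl ⟨w, h.symm⟩) D n (p + q) t) =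
    (C.cocomp w D (p + t) p t).rTensor (C.X B q) ∘ₗ
      C.cocomp (A := Graft A w D) (Sum.inl ⟨v, h⟩) B n (p + t) q ∘ₗ C.map (Graft.swap h B D) n

/-- A dg-cooperad over `R`. -/
structure DGCooperad (R : Type u) [CommRing R] extends CooperadData R where
  isDGCooperad : toCooperadData.IsDGCooperad

namespace DGCooperad

variable {R : Type u} [CommRing R]

/-- The chain complex of `R`-modules of a dg-cooperad in arity `A`. -/
noncomputable def complex (C : DGCooperad R) (A : Type) [Finite A] [Nonempty A] :
    ChainComplex (ModuleCat.{u} R) ℤ where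
  X n := ModuleCat.of R (C.X A n)
  d n m := ModuleCat.ofHom (C.d A n m)
  shape n m h := by
    rw [C.isDGCooperad.d_shape A n m h]
    rfl
  d_comp_d' n m k _ _ := by
    rw [← ModuleCat.ofHom_comp, C.isDGCooperad.d_comp_d A n m k]
    rfl

/-- The action of the group of permutations of `A` on the degree `n` part in arity `A`. -/
def rep (C : DGCooperad R) (A : Type) [Finite A] [Nonempty A] (n : ℤ) :
    Representation R (Equiv.Perm A) (C.X A n) where
  toFun σ := C.map σ n
  map_one' := C.isDGCooperad.map_refl A n
  map_mul' σ τ := C.isDGCooperad.map_trans τ σ n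

/-- The chain complex of `R`-linear representations of the group of permutations of `A` of a
dg-cooperad in arity `A`. -/
noncomputable def repComplex (C : DGCooperad R) (A : Type) [Finite A] [Nonempty A] :
    ChainComplex (Rep.{u} R (Equiv.Perm A)) ℤ where
  X n := Rep.of (C.rep A n)
  d n m := Rep.ofHom
    { toLinearMap := C.d A n m
      isIntertwining' := fun σ => (C.isDGCooperad.map_d σ n m).symm }
  shape n m h := by
    ext x
    exact LinearMap.congr_fun (C.isDGCooperad.d_shape A n m h) x
  d_comp_d' n m k _ _ := by
    ext x
    exact LinearMap.congr_fun (C.isDGCooperad.d_comp_d A n m k) x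

/-- `C` is concentrated in non-negative degrees. -/
def IsNonneg (C : DGCooperad R) : Prop :=
  ∀ (A : Type) [Finite A] [Nonempty A] (n : ℤ), n < 0 → Subsingleton (C.X A n)

/-- `C` is `Σ`-cofibrant: for every `A` the complex `C(A)` is cofibrant in the projective model
structure on (unbounded) chain complexes of `R[Aut(A)]`-modules, i.e. `0 ⟶ C(A)` has the left
lifting property against all surjective quasi-isomorphisms. -/
def IsSigmaCofibrant (C : DGCooperad R) : Prop :=
  ∀ (A : Type) [Finite A] [Nonempty A] (Y Z : ChainComplex (Rep.{u} R (Equiv.Perm A)) ℤ)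
    (p : Y ⟶ Z), QuasiIso p → (∀ n, Function.Surjective (p.f n).hom) →
    ∀ f : C.repComplex A ⟶ Z, ∃ g : C.repComplex A ⟶ Y, g ≫ p = f

/-- Morphisms of dg-cooperads. -/
structure Hom (C D : DGCooperad R) where
  app : ∀ (A : Type) [Finite A] [Nonempty A] (n : ℤ), C.X A n →ₗ[R] D.X A n
  comm_d : ∀ (A : Type) [Finite A] [Nonempty A] (n m : ℤ),
    app A m ∘ₗ C.d A n m = D.d A n m ∘ₗ app A n
  comm_map : ∀ {A B : Type} [Finite A] [Nonempty A] [Finite B] [Nonempty B] (e : A ≃ B) (n : ℤ),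
    app B n ∘ₗ C.map e n = D.map e n ∘ₗ app A n
  comm_counit : D.counit ∘ₗ app Unit 0 = C.counit
  comm_cocomp : ∀ {A : Type} [Finite A] [Nonempty A] (v : A) (B : Type) [Finite B] [Nonempty B]
    (n p q : ℤ), TensorProduct.map (app A p) (app B q) ∘ₗ C.cocomp v B n p q =
      D.cocomp v B n p q ∘ₗ app (Graft A v B) n

/-- The map of chain complexes in arity `A` underlying a morphism of dg-cooperads. -/
noncomputable def Hom.chainMap {C D : DGCooperad R} (f : C.Hom D) (A : Type) [Finite A]
    [Nonempty A] : C.complex A ⟶ D.complex A where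
  f n := ModuleCat.ofHom (f.app A n)
  comm' n m _ := by
    ext x
    exact (LinearMap.congr_fun (f.comm_d A n m) x).symm

/-- A quasi-isomorphism of dg-cooperads: a morphism that is a quasi-isomorphism in every arity. -/
def Hom.IsQuasiIso {C D : DGCooperad R} (f : C.Hom D) : Prop :=
  ∀ (A : Type) [Finite A] [Nonempty A], QuasiIso (f.chainMap A)

end DGCooperad

/-! ### The nonunital cocommutative cooperad -/

namespace CoCom

variable (R : Type u) [CommRing R]

/-- `R` in degree zero and `0` in the other degrees: the free module on one generator if `n = 0`
and on none otherwise. -/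
abbrev Obj (n : ℤ) : Type u := PLift (n = 0) →₀ R

/-- The generator in degree zero; by convention `0` in the other degrees. -/
noncomputable def gen (n : ℤ) : Obj R n :=
  if h : n = 0 then Finsupp.single ⟨h⟩ 1 else 0

/-- The counit, the identification of the degree zero part with `R`. -/
noncomputable def counit : Obj R 0 →ₗ[R] R :=
  Finsupp.linearCombination R (fun _ => 1)

/-- The cocomposition `1 ↦ 1 ⊗ 1`. -/
noncomputable def cocomp (n p q : ℤ) : Obj R n →ₗ[R] Obj R p ⊗[R] Obj R q :=
  Finsupp.linearCombination R (fun _ => gen R p ⊗ₜ[R] gen R q)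

/-- The data of the cooperad `coCom^nu`: it is `R` in degree zero in every arity, with the trivial
action, the identity as counit and `Δ_v(1) = 1 ⊗ 1`. -/
noncomputable def data : CooperadData R where
  X _ _ _ n := Obj R n
  d _ _ _ _ _ := 0
  map _ _ := LinearMap.id
  counit := counit R
  cocomp _ _ _ _ n p q := cocomp R n p q

variable {R}

theorem hom_ext {n : ℤ} {M : Type u} [AddCommMonoid M] [Module R M]
    {f g : Obj R n →ₗ[R] M}
    (h : n = 0 → f (gen R n) = g (gen R n)) : f = g := by
  refine Finsupp.lhom_ext' fun hn => LinearMap.ext_ring ?_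
  have := h hn.down
  simpa [gen, hn.down] using this

theorem gen_ne {n : ℤ} (h : n ≠ 0) : gen R n = 0 := by simp [gen, h]

theorem counit_gen : counit R (gen R 0) = 1 := by simp [counit, gen]

theorem cocomp_gen {n : ℤ} (h : n = 0) (p q : ℤ) :
    cocomp R n p q (gen R n) = gen R p ⊗ₜ[R] gen R q := by simp [cocomp, gen, h]

theorem gen_tmul_gen {p q : ℤ} (h : ¬ (p = 0 ∧ q = 0)) :
    gen R p ⊗ₜ[R] gen R q = 0 := by
  by_cases hp : p = 0
  · rw [gen_ne fun hq => h ⟨hp, hq⟩, TensorProduct.tmul_zero]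
  · rw [gen_ne hp, TensorProduct.zero_tmul]

theorem cocomp_eq_zero (n : ℤ) {p q : ℤ} (h : ¬ (p = 0 ∧ q = 0)) : cocomp R n p q = 0 := by
  apply hom_ext
  intro hn
  rw [cocomp_gen hn, gen_tmul_gen h, LinearMap.zero_apply]

theorem seq (n p q t : ℤ) :
    (TensorProduct.assoc R (Obj R p) (Obj R q) (Obj R t)).toLinearMap ∘ₗ
      (cocomp R (p + q) p q).rTensor (Obj R t) ∘ₗ cocomp R n (p + q) t =
    (cocomp R (q + t) q t).lTensor (Obj R p) ∘ₗ cocomp R n p (q + t) ∘ₗ LinearMap.id := by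
  apply hom_ext
  intro hn
  by_cases h : p = 0 ∧ q = 0 ∧ t = 0
  · obtain ⟨rfl, rfl, rfl⟩ := h
    simp [cocomp_gen hn, cocomp_gen (R := R) (n := 0) rfl]
  · by_cases h1 : p = 0 ∧ q = 0
    · have h2 : ¬ (q = 0 ∧ t = 0) := fun k => h ⟨h1.1, k⟩
      have h3 : ¬ (p + q = 0 ∧ t = 0) := fun k => h ⟨h1.1, h1.2, k.2⟩
      simp [cocomp_eq_zero _ h2, cocomp_eq_zero _ h3]
    · rw [cocomp_eq_zero (p + q) h1]
      by_cases h2 : q = 0 ∧ t = 0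
      · have h3 : ¬ (p = 0 ∧ q + t = 0) := fun k => h ⟨k.1, h2⟩
        simp [cocomp_eq_zero _ h3]
      · simp [cocomp_eq_zero _ h2]

theorem par (n p q t : ℤ) :
    (q * t).negOnePow • ((TensorProduct.rightComm R (Obj R p) (Obj R q) (Obj R t)).toLinearMap ∘ₗ
      (cocomp R (p + q) p q).rTensor (Obj R t) ∘ₗ cocomp R n (p + q) t) =
    (cocomp R (p + t) p t).rTensor (Obj R q) ∘ₗ cocomp R n (p + t) q ∘ₗ LinearMap.id := by
  apply hom_ext
  intro hn
  by_cases h : p = 0 ∧ q = 0 ∧ t = 0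
  · obtain ⟨rfl, rfl, rfl⟩ := h
    simp [cocomp_gen hn, cocomp_gen (R := R) (n := 0) rfl]
  · by_cases h1 : p = 0 ∧ q = 0
    · have h2 : ¬ (p = 0 ∧ t = 0) := fun k => h ⟨h1.1, h1.2, k.2⟩
      have h3 : ¬ (p + q = 0 ∧ t = 0) := fun k => h ⟨h1.1, h1.2, k.2⟩
      simp [cocomp_eq_zero _ h2, cocomp_eq_zero _ h3]
    · rw [cocomp_eq_zero (p + q) h1]
      by_cases h2 : p = 0 ∧ t = 0
      · have h3 : ¬ (p + t = 0 ∧ q = 0) := fun k => h1 ⟨h2.1, k.2⟩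
        simp [cocomp_eq_zero _ h3]
      · simp [cocomp_eq_zero _ h2]

theorem right (n : ℤ) : (TensorProduct.rid R (Obj R n)).toLinearMap ∘ₗ
    (counit R).lTensor (Obj R n) ∘ₗ cocomp R n n 0 = LinearMap.id :=
  hom_ext fun hn => by simp [cocomp_gen hn, counit_gen]

theorem left (n : ℤ) : (TensorProduct.lid R (Obj R n)).toLinearMap ∘ₗ
    (counit R).rTensor (Obj R n) ∘ₗ cocomp R n 0 n = LinearMap.id :=
  hom_ext fun hn => by simp [cocomp_gen hn, counit_gen]

end CoCom

/-- The cooperad `coCom^nu` of nonunital cocommutative coalgebras over `R`. -/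
noncomputable def coComNu (R : Type u) [CommRing R] : DGCooperad R where
  toCooperadData := CoCom.data R
  isDGCooperad :=
    { d_shape := fun _ _ _ _ _ _ => rfl
      d_comp_d := fun _ _ _ _ _ _ => LinearMap.comp_zero _
      map_refl := fun _ _ _ _ => rfl
      map_trans := fun _ _ _ => rfl
      map_d := fun _ _ _ => rfl
      counit_d := LinearMap.comp_zero _
      cocomp_degree := fun _ _ _ _ n p q h => by
        by_cases hn : n = 0
        · exact CoCom.cocomp_eq_zero n (by omega)
        · exact CoCom.hom_ext fun k => absurd k hn
      cocomp_finite := fun _ _ _ _ n x => by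
        refine (Set.finite_singleton ((0, 0) : ℤ × ℤ)).subset ?_
        rintro ⟨p, q⟩ h
        by_contra hpq
        have hpq : ¬ (p = 0 ∧ q = 0) := fun k => hpq (by simp [k.1, k.2])
        exact h (LinearMap.congr_fun (CoCom.cocomp_eq_zero (R := R) n hpq) x)
      cocomp_d := fun _ _ _ _ n p q => by
        change CoCom.cocomp R n p q ∘ₗ 0 =
          (0 : CoCom.Obj R (p + 1) →ₗ[R] CoCom.Obj R p).rTensor (CoCom.Obj R q) ∘ₗ
            CoCom.cocomp R (n + 1) (p + 1) q +
          p.negOnePow • ((0 : CoCom.Obj R (q + 1) →ₗ[R] CoCom.Obj R q).lTensor (CoCom.Obj R p) ∘ₗ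
            CoCom.cocomp R (n + 1) p (q + 1))
        simp
      cocomp_map := fun _ _ _ n p q => by
        change CoCom.cocomp R n p q ∘ₗ LinearMap.id =
          TensorProduct.map LinearMap.id LinearMap.id ∘ₗ CoCom.cocomp R n p q
        simp
      counit_right := fun _ n => CoCom.right n
      counit_left := fun _ _ _ n => CoCom.left n
      coassoc_seq := fun _ _ _ _ _ n p q t => CoCom.seq n p q t
      coassoc_par := fun _ _ _ _ _ _ _ n p q t => CoCom.par n p q t }

/-! ### Sequences and caesuras -/

namespace Sequence

variable {A : Type}

/-- A sequence in `A` is nondegenerate if every element of `A` occurs in it and consecutive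
entries are distinct. -/
def Nondegenerate (l : List A) : Prop := (∀ a, a ∈ l) ∧ l.IsChain (· ≠ ·)

/-- The entry at position `i` (counted from `0`) is a caesura if it is not the last occurrence of
that element in the sequence. -/
def IsCaesura (l : List A) (i : ℕ) : Prop := ∃ j, i < j ∧ j < l.length ∧ l[i]? = l[j]?

open Classical in
/-- The alternating sign, starting with `+`, of a caesura at position `i`. -/
noncomputable def caesuraSign (l : List A) (i : ℕ) : ℤ :=
  (-1) ^ ((Finset.range i).filter (fun j => IsCaesura l j)).card

open Classical in
/-- The sign attached to the entry at position `i`: the caesuras carry alternating signs starting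
with `+`; a last occurrence carries the sign opposite to that of the previous occurrence of the
same element, and `0` if there is none. -/
noncomputable def sign (l : List A) (i : ℕ) : ℤ :=
  if IsCaesura l i then caesuraSign l i
  else if ∃ j < i, l[j]? = l[i]? then
    - caesuraSign l (Nat.findGreatest (fun j => j < i ∧ l[j]? = l[i]?) i)
  else 0

variable {v : A} {B : Type}

/-- The entry at position `i` of a sequence in `A ⊔_v B` lies in `B`. -/
def IsRightAt (l : List (Graft A v B)) (i : ℕ) : Prop := ∃ b, l[i]? = some (Sum.inr b)

/-- The first factor obtained by cutting a sequence in `A ⊔_v B` at position `c`: the elements of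
`B` at positions `≤ c` are replaced by `v` and those at positions `> c` are removed. -/
def cutLeft (l : List (Graft A v B)) (c : ℕ) : List A :=
  (l.take (c + 1)).map (Sum.elim Subtype.val (fun _ => v)) ++
    (l.drop (c + 1)).filterMap (Sum.elim (fun a => some a.1) (fun _ => none))

/-- The second factor obtained by cutting a sequence in `A ⊔_v B` at position `c`: the subsequence
of the elements of `B` at positions `≥ c`. -/
def cutRight (l : List (Graft A v B)) (c : ℕ) : List B :=
  (l.drop c).filterMap (Sum.elim (fun _ => none) some)

open Classical in
/-- The sign of the cut at `c`, one factor `-1` for each pair of caesuras that pass along each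
other. The caesuras of `l` that go to the second factor are those in `B` at positions `≥ c`, all
others go to the first factor, and the order within each factor is kept; the inverted pairs
`(i, j)` thus consist of a caesura at `i ≥ c` in `B` and a later caesura at `j` not in `B`. -/
noncomputable def cutSign (l : List (Graft A v B)) (c : ℕ) : ℤ :=
  (-1) ^ ((Finset.range l.length ×ˢ Finset.range l.length).filter (fun ij =>
    c ≤ ij.1 ∧ ij.1 < ij.2 ∧ IsCaesura l ij.1 ∧ IsCaesura l ij.2 ∧
      IsRightAt l ij.1 ∧ ¬ IsRightAt l ij.2)).card

end Sequence

/-! ### The surjections cooperad -/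

namespace Surj

open Sequence

/-- The nondegenerate sequences in `A` of degree `n`, i.e. with `|A| + n` entries. -/
abbrev Basis (A : Type) (n : ℤ) : Type :=
  {l : List A // Nondegenerate l ∧ (l.length : ℤ) = Nat.card A + n}

variable (R : Type u) [CommRing R]

/-- The degree `n` part of `Surj_R(A)`: the free module on the nondegenerate sequences. -/
abbrev Obj (A : Type) (n : ℤ) : Type u := Basis A n →₀ R

open Classical in
/-- The element of `Surj_R(A)` in degree `n` given by a sequence; it is zero if the sequence is
degenerate (or not of degree `n`). -/
noncomputable def ofList {A : Type} (n : ℤ) (l : List A) : Obj R A n :=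
  if h : Nondegenerate l ∧ (l.length : ℤ) = Nat.card A + n then Finsupp.single ⟨l, h⟩ 1 else 0

/-- The differential, deleting one entry in all possible ways. -/
noncomputable def d (A : Type) (n m : ℤ) : Obj R A n →ₗ[R] Obj R A m :=
  Finsupp.linearCombination R (fun u =>
    ∑ i ∈ Finset.range u.1.length, sign u.1 i • ofList R m (u.1.eraseIdx i))

/-- A bijection acts by renaming the entries. -/
noncomputable def map {A B : Type} (e : A ≃ B) (n : ℤ) : Obj R A n →ₗ[R] Obj R B n :=
  Finsupp.linearCombination R (fun u => ofList R n (u.1.map e))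

/-- The counit sends the one-term sequence to `1`. -/
noncomputable def counit : Obj R Unit 0 →ₗ[R] R :=
  Finsupp.linearCombination R (fun _ => 1)

open Classical in
/-- The partial cocomposition, cutting a sequence in `A ⊔_v B` at each of its entries in `B`. -/
noncomputable def cocomp {A : Type} (v : A) (B : Type) (n p q : ℤ) :
    Obj R (Graft A v B) n →ₗ[R] Obj R A p ⊗[R] Obj R B q :=
  Finsupp.linearCombination R (fun u =>
    ∑ c ∈ (Finset.range u.1.length).filter (fun c => IsRightAt u.1 c),
      cutSign u.1 c • (ofList R p (cutLeft u.1 c) ⊗ₜ[R] ofList R q (cutRight u.1 c)))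

/-- The data of the surjections cooperad. -/
noncomputable def data : CooperadData R where
  X A _ _ n := Obj R A n
  d A _ _ n m := d R A n m
  map e n := map R e n
  counit := counit R
  cocomp v B _ _ n p q := cocomp R v B n p q

/-- The map to the trivial module sending each sequence of degree zero to the generator (and, as
it has to, everything in the other degrees to zero). -/
noncomputable def augmentation (A : Type) (n : ℤ) : Obj R A n →ₗ[R] CoCom.Obj R n :=
  Finsupp.linearCombination R (fun _ => CoCom.gen R n)

end Surj

/-! Deleting the entries of a sequence with plain alternating signs (`altSum`) squares to zero and
respects degenerate sequences for simple reasons. The caesura signs are this differential in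
disguise. Read a sequence as a product of odd symbols and reorder it so that the caesuras come first
and the last occurrences follow in a fixed order of the elements; `orient` is the sign of this
reordering. Deleting a last occurrence lets the previous occurrence take its slot, a transposition,
whence the opposite sign (`sign_mul_orient`, `delSum_eq_altSum`).

The same reorientation turns the cocomposition into `altCut`, in which every entry counts as odd
(`cutSum_eq_altCut`). There the defect of the Leibniz rule telescopes: deleting the `v` at a cut
cancels against deleting the first entry of the right factor at the previous cut. The two extreme
terms miss an element and vanish (`altSum_altCut`, `delSum_cutSum`).

Coassociativity needs no reorientation. Cuts are enumerated by recursion on the head of the list,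
and the signs count inversions when the caesuras are sorted into three groups (`cutSum_assoc`,
`cutSum_swap`). In the parallel case two groups are exchanged, which gives the Koszul sign because
the number of caesuras is the degree (`caesuras_add_natCard`).

For the homology, putting a letter in front contracts the complex of all words. It does not preserve
degenerate words, but used one letter at a time, by induction along an enumeration `w` of `A`, it
shows that every cycle is a boundary up to a multiple of `w` (`exists_altD_sub_mem`). The
augmentation detects this multiple.

Permutations act freely on sequences in which every element occurs, so the modules are projective
over the group (`projective_repComplex`), and bounded below complexes of projectives lift against
epimorphic quasi-isomorphisms (`exists_lift_of_projective`). -/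

namespace Sequence

/-! ### Caesuras, their signs and their number, by recursion on the list -/

section Caesuras

variable {A : Type}

theorem isCaesura_cons_succ {a : A} {l : List A} {i : ℕ} :
    IsCaesura (a :: l) (i + 1) ↔ IsCaesura l i := by
  constructor
  · rintro ⟨j, h1, h2, h3⟩
    obtain ⟨k, rfl⟩ : ∃ k, j = k + 1 := ⟨j - 1, by omega⟩
    exact ⟨k, by omega, by simpa using h2, by simpa using h3⟩
  · rintro ⟨j, h1, h2, h3⟩
    exact ⟨j + 1, by omega, by simpa using h2, by simpa using h3⟩

theorem isCaesura_cons_zero {a : A} {l : List A} : IsCaesura (a :: l) 0 ↔ a ∈ l := by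
  constructor
  · rintro ⟨j, h1, h2, h3⟩
    obtain ⟨k, rfl⟩ : ∃ k, j = k + 1 := ⟨j - 1, by omega⟩
    exact List.mem_of_getElem? (by simpa using h3.symm)
  · intro h
    obtain ⟨k, hk, e⟩ := List.mem_iff_getElem.1 h
    exact ⟨k + 1, by omega, by simpa using hk, by simp [← e, hk]⟩

theorem caesuraSign_zero (l : List A) : caesuraSign l 0 = 1 := by simp [caesuraSign]

open Classical in
theorem caesuraSign_cons_succ (a : A) (l : List A) (i : ℕ) :
    caesuraSign (a :: l) (i + 1) = (if a ∈ l then -1 else 1) * caesuraSign l i := by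
  unfold caesuraSign
  rw [Finset.card_filter, Finset.card_filter, Finset.sum_range_succ', pow_add, mul_comm]
  simp only [isCaesura_cons_succ, isCaesura_cons_zero]
  split_ifs <;> simp

/-- `hP` excludes the default value `0` of `Nat.findGreatest`, which would not be shifted. -/
theorem findGreatest_succ_shift {P Q : ℕ → Prop} [DecidablePred P] [DecidablePred Q]
    (h : ∀ j, Q (j + 1) ↔ P j) {i : ℕ} (hP : ∃ j ≤ i, P j) :
    Nat.findGreatest Q (i + 1) = Nat.findGreatest P i + 1 := by
  obtain ⟨j, hj, hPj⟩ := hP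
  rw [Nat.findGreatest_eq_iff]
  refine ⟨by have := Nat.findGreatest_le (P := P) i; omega, fun _ => ?_, ?_⟩
  · exact (h _).2 (Nat.findGreatest_spec hj hPj)
  · intro n h1 h2 hQ
    obtain ⟨k, rfl⟩ : ∃ k, n = k + 1 := ⟨n - 1, by omega⟩
    exact Nat.findGreatest_is_greatest (P := P) (n := i) (k := k) (by omega) (by omega) ((h _).1 hQ)

open Classical in
theorem sign_cons_zero (a : A) (l : List A) : sign (a :: l) 0 = if a ∈ l then 1 else 0 := by
  simp [sign, isCaesura_cons_zero, caesuraSign_zero]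

/-- The entry at position `i` has a previous occurrence. -/
def HasPrevious (l : List A) (i : ℕ) : Prop := ∃ j < i, l[j]? = l[i]?

theorem hasPrevious_cons_succ {a : A} {l : List A} {i : ℕ} :
    HasPrevious (a :: l) (i + 1) ↔ l[i]? = some a ∨ HasPrevious l i := by
  constructor
  · rintro ⟨j, h1, h2⟩
    rcases j with - | j
    · left; simpa using h2.symm
    · right; exact ⟨j, by omega, by simpa using h2⟩
  · rintro (h | ⟨j, h1, h2⟩)
    · exact ⟨0, by omega, by simpa using h.symm⟩
    · exact ⟨j + 1, by omega, by simpa using h2⟩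

open Classical in
theorem sign_eq (l : List A) (i : ℕ) : sign l i =
    if IsCaesura l i then caesuraSign l i
    else if HasPrevious l i then
      - caesuraSign l (Nat.findGreatest (fun j => j < i ∧ l[j]? = l[i]?) i)
    else 0 := by
  unfold sign HasPrevious
  congr

open Classical in
-- An entry that has another occurrence in `l` refers to the same caesura as before, and a new head
-- only flips the sign if it is itself a caesura. An entry occurring once in `l` gets a sign only if
-- the head is its previous occurrence; the head is then the first caesura, with sign `+`.
theorem sign_cons_succ (a : A) (l : List A) (i : ℕ) :
    sign (a :: l) (i + 1) = if IsCaesura l i ∨ HasPrevious l i then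
      (if a ∈ l then -1 else 1) * sign l i else if l[i]? = some a then -1 else 0 := by
  by_cases hc : IsCaesura l i
  · simp [sign, isCaesura_cons_succ, hc, caesuraSign_cons_succ]
  · by_cases hp : HasPrevious l i
    · rw [if_pos (Or.inr hp), sign_eq, if_neg (isCaesura_cons_succ.not.2 hc),
        if_pos (hasPrevious_cons_succ.2 (Or.inr hp)), sign_eq, if_neg hc, if_pos hp,
        findGreatest_succ_shift (P := fun j => j < i ∧ l[j]? = l[i]?), caesuraSign_cons_succ]
      · ring
      · simp
      · obtain ⟨j, h1, h2⟩ := hp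
        exact ⟨j, h1.le, h1, h2⟩
    · rw [if_neg (by tauto), sign_eq, if_neg (isCaesura_cons_succ.not.2 hc)]
      by_cases ha : l[i]? = some a
      · rw [if_pos (hasPrevious_cons_succ.2 (Or.inl ha)), if_pos ha]
        -- The value `0` is not a default here: by `ha` the head, at position `0`, is the previous
        -- occurrence.
        have : Nat.findGreatest
            (fun j => j < i + 1 ∧ (a :: l)[j]? = (a :: l)[i + 1]?) (i + 1) = 0 := by
          rw [Nat.findGreatest_eq_zero_iff]
          rintro (- | k) h1 h2 ⟨h3, h4⟩
          · omega
          · exact hp ⟨k, by omega, by simpa using h4⟩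
        rw [this, caesuraSign_zero]
      · rw [if_neg, if_neg ha]
        intro h
        exact (hasPrevious_cons_succ.1 h).elim ha hp

open Classical in
/-- The number of caesuras of a sequence. -/
noncomputable def caesuras : List A → ℕ
  | [] => 0
  | a :: l => caesuras l + if a ∈ l then 1 else 0

theorem caesuras_nil : caesuras ([] : List A) = 0 := rfl

open Classical in
theorem caesuras_cons (a : A) (l : List A) :
    caesuras (a :: l) = caesuras l + if a ∈ l then 1 else 0 := rfl

open Classical in
-- Each element that occurs has exactly one last occurrence, and all other entries are caesuras. So
-- for sequences containing all elements the number of caesuras is the degree.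
theorem caesuras_add_card (l : List A) : caesuras l + l.toFinset.card = l.length := by
  induction l with
  | nil => simp [caesuras_nil]
  | cons a l ih =>
    rw [caesuras_cons, List.toFinset_cons, List.length_cons]
    by_cases h : a ∈ l
    · rw [if_pos h, Finset.insert_eq_of_mem (by simpa using h)]; omega
    · rw [if_neg h, Finset.card_insert_of_notMem (by simpa using h)]; omega

theorem caesuras_add_natCard [Finite A] {l : List A} (h : ∀ a, a ∈ l) :
    caesuras l + Nat.card A = l.length := by
  classical
  have := Fintype.ofFinite A
  rw [← caesuras_add_card l, Nat.card_eq_fintype_card, ← Finset.card_univ]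
  congr 2
  ext a
  simp [h a]

end Caesuras

/-! ### Cuts and their signs, by recursion on the list -/

section Cuts

variable {A : Type} {v : A} {B : Type}

/-- The subsequence of the entries in `A`. -/
def leftPart (l : List (Graft A v B)) : List A :=
  l.filterMap (Sum.elim (fun a => some a.1) (fun _ => none))

/-- The subsequence of the entries in `B`. -/
def rightPart (l : List (Graft A v B)) : List B :=
  l.filterMap (Sum.elim (fun _ => none) some)

/-- The entries in `B` are replaced by `v`. -/
def collapse (l : List (Graft A v B)) : List A := l.map (Sum.elim Subtype.val (fun _ => v))

@[simp] theorem leftPart_nil : leftPart ([] : List (Graft A v B)) = [] := rfl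
@[simp] theorem leftPart_inl (a : {a : A // a ≠ v}) (l : List (Graft A v B)) :
    leftPart (Sum.inl a :: l) = a.1 :: leftPart l := rfl
@[simp] theorem leftPart_inr (b : B) (l : List (Graft A v B)) :
    leftPart (Sum.inr b :: l) = leftPart l := rfl
@[simp] theorem rightPart_nil : rightPart ([] : List (Graft A v B)) = [] := rfl
@[simp] theorem rightPart_inl (a : {a : A // a ≠ v}) (l : List (Graft A v B)) :
    rightPart (Sum.inl a :: l) = rightPart l := rfl
@[simp] theorem rightPart_inr (b : B) (l : List (Graft A v B)) :
    rightPart (Sum.inr b :: l) = b :: rightPart l := rfl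

theorem mem_leftPart {l : List (Graft A v B)} {a : A} :
    a ∈ leftPart l ↔ ∃ h : a ≠ v, Sum.inl ⟨a, h⟩ ∈ l := by
  induction l with
  | nil => simp
  | cons x l ih => rcases x with x | x <;> simp [ih, Subtype.ext_iff, or_iff_not_imp_left]; grind

theorem mem_rightPart {l : List (Graft A v B)} {b : B} :
    b ∈ rightPart l ↔ Sum.inr b ∈ l := by
  induction l with
  | nil => simp
  | cons x l ih => rcases x with x | x <;> simp [ih]

theorem notMem_leftPart (l : List (Graft A v B)) : v ∉ leftPart l := by simp [mem_leftPart]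

theorem isRightAt_cons_succ {x : Graft A v B} {l : List (Graft A v B)} {i : ℕ} :
    IsRightAt (x :: l) (i + 1) ↔ IsRightAt l i := by simp [IsRightAt]
theorem isRightAt_inl {a : {a : A // a ≠ v}} {l : List (Graft A v B)} :
    ¬ IsRightAt (Sum.inl a :: l) 0 := by simp [IsRightAt]
theorem isRightAt_inr {b : B} {l : List (Graft A v B)} :
    IsRightAt (Sum.inr b :: l) 0 := by simp [IsRightAt]

open Classical in
-- All occurrences of an element outside `B` survive in `leftPart l`, so being a caesura is not
-- affected by dropping the entries in `B`.
theorem card_isCaesura_not_isRightAt (l : List (Graft A v B)) :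
    ((Finset.range l.length).filter (fun j => IsCaesura l j ∧ ¬ IsRightAt l j)).card =
      caesuras (leftPart l) := by
  induction l with
  | nil => simp [caesuras_nil]
  | cons x l ih =>
    rw [Finset.card_filter, List.length_cons, Finset.sum_range_succ']
    simp only [isCaesura_cons_succ, isRightAt_cons_succ, isCaesura_cons_zero]
    rw [← Finset.card_filter, ih]
    rcases x with a | b
    · simp [isRightAt_inl, caesuras_cons, mem_leftPart, a.2]
    · simp [isRightAt_inr]

open Classical in
-- The head stands before the cut and before all other entries, so it is neither the first nor the
-- second member of an inverted pair.
theorem cutSign_cons_succ (x : Graft A v B) (l : List (Graft A v B)) (c : ℕ) :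
    cutSign (x :: l) (c + 1) = cutSign l c := by
  unfold cutSign
  simp only [Finset.card_filter, Finset.sum_product, List.length_cons, Finset.sum_range_succ',
    isCaesura_cons_succ, isRightAt_cons_succ]
  simp

open Classical in
-- A caesura in `B` at the head has to pass all later caesuras outside `B`, which are those of
-- `leftPart l`.
theorem cutSign_cons_zero (x : Graft A v B) (l : List (Graft A v B)) :
    cutSign (x :: l) 0 = (if x ∈ l ∧ IsRightAt (x :: l) 0 then (-1) ^ caesuras (leftPart l) else 1)
      * cutSign l 0 := by
  unfold cutSign
  simp only [Finset.card_filter, Finset.sum_product, List.length_cons, Finset.sum_range_succ',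
    isCaesura_cons_succ, isRightAt_cons_succ, isCaesura_cons_zero]
  rw [← card_isCaesura_not_isRightAt, Finset.card_filter]
  by_cases h : x ∈ l ∧ IsRightAt (x :: l) 0
  · simp [h, pow_add, mul_comm]
  · rw [if_neg h, one_mul]
    congr 1
    simp only [Nat.zero_le, true_and, add_lt_add_iff_right, lt_self_iff_false, false_and,
      if_false, add_zero, not_lt_zero, Nat.zero_lt_succ]
    rw [add_eq_left]
    apply Finset.sum_eq_zero
    intro j hj
    rw [if_neg]
    tauto

theorem cutSign_inl_zero (a : {a : A // a ≠ v}) (l : List (Graft A v B)) :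
    cutSign (Sum.inl a :: l) 0 = cutSign l 0 := by
  simp [cutSign_cons_zero, isRightAt_inl]

open Classical in
theorem cutSign_inr_zero (b : B) (l : List (Graft A v B)) :
    cutSign (Sum.inr b :: l) 0 =
      (if b ∈ rightPart l then (-1) ^ caesuras (leftPart l) else 1) * cutSign l 0 := by
  simp [cutSign_cons_zero, isRightAt_inr, mem_rightPart]

theorem cutSign_nil_zero : cutSign ([] : List (Graft A v B)) 0 = 1 := by
  simp [cutSign]

theorem cutLeft_inl_succ (a : {a : A // a ≠ v}) (l : List (Graft A v B)) (c : ℕ) :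
    cutLeft (Sum.inl a :: l) (c + 1) = a.1 :: cutLeft l c := rfl
theorem cutLeft_inr_succ (b : B) (l : List (Graft A v B)) (c : ℕ) :
    cutLeft (Sum.inr b :: l) (c + 1) = v :: cutLeft l c := rfl
theorem cutLeft_inr_zero (b : B) (l : List (Graft A v B)) :
    cutLeft (Sum.inr b :: l) 0 = v :: leftPart l := rfl
theorem cutRight_cons_succ (x : Graft A v B) (l : List (Graft A v B)) (c : ℕ) :
    cutRight (x :: l) (c + 1) = cutRight l c := rfl
theorem cutRight_zero (l : List (Graft A v B)) : cutRight l 0 = rightPart l := rfl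

end Cuts

/-! ### Differential and cocomposition with values in an abelian group -/

section Sums

variable {A : Type} {M : Type*} [AddCommGroup M]

/-- The differential of a sequence, with values under a function on sequences. -/
noncomputable def delSum (l : List A) (F : List A → M) : M :=
  ∑ i ∈ Finset.range l.length, sign l i • F (l.eraseIdx i)

theorem map_delSum {N G : Type*} [AddCommGroup N] [FunLike G M N] [AddMonoidHomClass G M N]
    (f : G) (l : List A) (F : List A → M) : f (delSum l F) = delSum l (fun x => f (F x)) := by
  simp [delSum, map_sum, map_zsmul]

variable {v : A} {B : Type}

open Classical in
/-- The cocomposition of a sequence, with values under a function on pairs of sequences. -/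
noncomputable def cutSum (l : List (Graft A v B)) (F : List A → List B → M) : M :=
  ∑ c ∈ (Finset.range l.length).filter (fun c => IsRightAt l c),
    cutSign l c • F (cutLeft l c) (cutRight l c)

@[simp] theorem cutSum_nil (F : List A → List B → M) :
    cutSum ([] : List (Graft A v B)) F = 0 := by simp [cutSum]

open Classical in
@[simp] theorem cutSum_inl (a : {a : A // a ≠ v}) (l : List (Graft A v B))
    (F : List A → List B → M) :
    cutSum (Sum.inl a :: l) F = cutSum l (fun x y => F (a.1 :: x) y) := by
  unfold cutSum
  rw [Finset.sum_filter, List.length_cons, Finset.sum_range_succ', if_neg isRightAt_inl, add_zero,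
    Finset.sum_filter]
  refine Finset.sum_congr rfl fun i _ => if_congr isRightAt_cons_succ ?_ rfl
  simp only [cutSign_cons_succ, cutLeft_inl_succ, cutRight_cons_succ]

open Classical in
-- This recursion drives the proofs about cocompositions: either the cut comes later and the head
-- turns into `v`, or the head is the cut and the rest is sorted into its two subsequences.
@[simp] theorem cutSum_inr (b : B) (l : List (Graft A v B)) (F : List A → List B → M) :
    cutSum (Sum.inr b :: l) F = cutSum l (fun x y => F (v :: x) y) +
      cutSign (Sum.inr b :: l) 0 • F (v :: leftPart l) (b :: rightPart l) := by
  unfold cutSum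
  rw [Finset.sum_filter, List.length_cons, Finset.sum_range_succ', if_pos isRightAt_inr,
    Finset.sum_filter]
  congr 1
  refine Finset.sum_congr rfl fun i _ => if_congr isRightAt_cons_succ ?_ rfl
  simp only [cutSign_cons_succ, cutLeft_inr_succ, cutRight_cons_succ]

end Sums

end Sequence

namespace Sequence

/-! ### The sign that turns the caesura differential into an alternating sum -/

section Orientation

variable {A : Type}

/-- Of two distinct elements exactly one is below the other. -/
def IsTournament (lt : A → A → Prop) : Prop := ∀ a b, a ≠ b → (lt a b ↔ ¬ lt b a)

open Classical in
/-- The number of elements occurring in a sequence that are above `a`. -/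
noncomputable def above (lt : A → A → Prop) (a : A) (l : List A) : ℕ :=
  (l.toFinset.filter (fun x => lt a x)).card

open Classical in
/-- The sign of the reordering of the entries of a sequence in which the caesuras come first,
followed by the last occurrences in the order given by `lt`. -/
noncomputable def orient (lt : A → A → Prop) : List A → ℤ
  | [] => 1
  | a :: l => if a ∈ l then orient lt l else (-1) ^ (l.length + above lt a l) * orient lt l

variable {lt : A → A → Prop}

@[simp] theorem orient_nil : orient lt [] = 1 := rfl

theorem orient_cons_of_mem {a : A} {l : List A} (h : a ∈ l) :
    orient lt (a :: l) = orient lt l := by rw [orient, if_pos h]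

theorem orient_cons_of_notMem {a : A} {l : List A} (h : a ∉ l) :
    orient lt (a :: l) = (-1) ^ (l.length + above lt a l) * orient lt l := by
  rw [orient, if_neg h]

theorem orient_mul_self (l : List A) : orient lt l * orient lt l = 1 := by
  induction l with
  | nil => rfl
  | cons a l ih =>
    by_cases h : a ∈ l
    · rw [orient_cons_of_mem h, ih]
    · rw [orient_cons_of_notMem h, mul_mul_mul_comm, ih, ← pow_add, ← two_mul]
      simp

theorem above_congr {a : A} {l m : List A} (h : ∀ x, x ∈ l ↔ x ∈ m) :
    above lt a l = above lt a m := by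
  unfold above
  congr 2
  ext x
  simp [h x]

theorem above_cons_of_mem {a x : A} {l : List A} (h : x ∈ l) :
    above lt a (x :: l) = above lt a l := above_congr (by grind)

open Classical in
theorem above_cons_of_notMem {a x : A} {l : List A} (h : x ∉ l) :
    above lt a (x :: l) = above lt a l + if lt a x then 1 else 0 := by
  unfold above
  rw [List.toFinset_cons, Finset.filter_insert]
  split_ifs
  · rw [Finset.card_insert_of_notMem (by simp [h])]
  · rfl

theorem mem_eraseIdx_of_ne {l : List A} {i : ℕ} {a x : A} (h : l[i]? = some a) (hx : x ≠ a) :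
    x ∈ l.eraseIdx i ↔ x ∈ l := by
  rw [List.mem_eraseIdx_iff_getElem?, List.mem_iff_getElem?]
  constructor
  · rintro ⟨j, -, e⟩; exact ⟨j, e⟩
  · rintro ⟨j, e⟩
    exact ⟨j, fun k => hx (by simpa [k, h] using e.symm), e⟩

/-- Deletion of an element that occurs once. -/
theorem orient_eq_of_unique (hlt : IsTournament lt) {l : List A} {j : ℕ} {a : A}
    (h : l[j]? = some a) (ha : a ∉ l.eraseIdx j) : orient lt l =
      (-1) ^ (j + (l.eraseIdx j).length + above lt a (l.eraseIdx j)) *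
        orient lt (l.eraseIdx j) := by
  classical
  induction l generalizing j with
  | nil => simp at h
  | cons x l ih =>
    rcases j with - | j
    · obtain rfl : x = a := by simpa using h
      rw [List.eraseIdx_cons_zero] at ha ⊢
      rw [orient_cons_of_notMem ha, zero_add]
    · rw [List.eraseIdx_cons_succ] at ha ⊢
      rw [List.getElem?_cons_succ] at h
      have hax : a ≠ x ∧ a ∉ l.eraseIdx j := by simpa using ha
      specialize ih h hax.2
      have hm := mem_eraseIdx_of_ne h hax.1.symm
      by_cases hx : x ∈ l
      · rw [orient_cons_of_mem hx, orient_cons_of_mem (hm.2 hx), above_cons_of_mem (hm.2 hx), ih,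
          List.length_cons]
        ring
      · have hx' := hm.not.2 hx
        have hj : j < l.length := by
          by_contra hj
          rw [List.getElem?_eq_none (by omega)] at h
          simp at h
        have hl : l.length = (l.eraseIdx j).length + 1 := by
          rw [List.length_eraseIdx_of_lt hj]; omega
        have hab : above lt x l = above lt x (l.eraseIdx j) + if lt x a then 1 else 0 := by
          rw [← above_cons_of_notMem hax.2]
          refine above_congr fun y => ?_
          by_cases hy : y = a
          · subst hy; simpa using List.mem_of_getElem? h
          · simp [hy, mem_eraseIdx_of_ne h hy]
        rw [orient_cons_of_notMem hx, orient_cons_of_notMem hx', ih, hab, above_cons_of_notMem hx',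
          List.length_cons, hl]
        -- Both `x` and `a` are last occurrences. Exactly one of them is above the other, and this
        -- makes up for the shift of the position `j` by one.
        have := hlt a x hax.1
        by_cases hxa : lt x a
        · rw [if_pos hxa, if_neg (by tauto)]; ring
        · rw [if_neg hxa, if_pos (by tauto)]; ring

theorem isCaesura_or_hasPrevious_iff {l : List A} {i : ℕ} {a : A} (h : l[i]? = some a) :
    IsCaesura l i ∨ HasPrevious l i ↔ a ∈ l.eraseIdx i := by
  rw [List.mem_eraseIdx_iff_getElem?]
  constructor
  · rintro (⟨j, h1, h2, h3⟩ | ⟨j, h1, h2⟩)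
    · exact ⟨j, by omega, by rw [← h3, h]⟩
    · exact ⟨j, by omega, by rw [h2, h]⟩
  · rintro ⟨j, h1, h2⟩
    rcases lt_or_gt_of_ne h1 with h1 | h1
    · exact Or.inr ⟨j, h1, by rw [h, h2]⟩
    · exact Or.inl ⟨j, h1, (List.getElem?_eq_some_iff.1 h2).1, by rw [h, h2]⟩

/-- For symbols that are all odd, deletion at position `i` costs `(-1) ^ i`. With the caesuras moved
to the front, deleting a caesura costs its alternating sign. Deleting a last occurrence differs from
deleting the previous occurrence by the transposition of the two, hence by `-1`. The hypothesis `h`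
ensures that no element is lost, so that the last occurrences fill the same slots before and after.
-/
theorem sign_mul_orient (hlt : IsTournament lt) {l : List A} {i : ℕ} (hi : i < l.length)
    (h : ∀ x ∈ l, x ∈ l.eraseIdx i) :
    sign l i * orient lt (l.eraseIdx i) = (-1) ^ i * orient lt l := by
  classical
  induction l generalizing i with
  | nil => simp at hi
  | cons a l ih =>
    rcases i with - | i
    · have ha : a ∈ l := by simpa using h a (by simp)
      simp [sign_cons_zero, ha, orient_cons_of_mem ha]
    · rw [List.eraseIdx_cons_succ] at h ⊢
      rw [List.length_cons, add_lt_add_iff_right] at hi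
      have hl : l.length = (l.eraseIdx i).length + 1 := by
        rw [List.length_eraseIdx_of_lt hi]; omega
      have he : l[i]? = some l[i] := List.getElem?_eq_getElem hi
      have hsub : ∀ x ∈ l.eraseIdx i, x ∈ l := fun x hx => List.mem_of_mem_eraseIdx hx
      by_cases ha : a ∈ l.eraseIdx i
      · have h' : ∀ x ∈ l, x ∈ l.eraseIdx i := fun x hx => by
          rcases List.mem_cons.1 (h x (by simp [hx])) with rfl | k
          · exact ha
          · exact k
        rw [sign_cons_succ, if_pos ((isCaesura_or_hasPrevious_iff he).2 (h' _ (by simp))),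
          if_pos (hsub _ ha), orient_cons_of_mem ha, orient_cons_of_mem (hsub _ ha), mul_assoc,
          ih hi h']
        ring
      · by_cases hal : a ∈ l
        · have hia : l[i] = a := by
            by_contra k
            exact ha ((mem_eraseIdx_of_ne he (Ne.symm k)).2 hal)
          rw [hia] at he
          rw [sign_cons_succ, if_neg ((isCaesura_or_hasPrevious_iff he).not.2 ha), if_pos he,
            orient_cons_of_mem hal, orient_cons_of_notMem ha, orient_eq_of_unique hlt he ha]
          have hs : ((-1 : ℤ) ^ i) * (-1) ^ i = 1 := by rw [← mul_pow]; simp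
          rw [pow_succ, pow_add, pow_add, pow_add]
          linear_combination ((-1 : ℤ) ^ (l.eraseIdx i).length *
            (-1) ^ above lt a (l.eraseIdx i) * orient lt (l.eraseIdx i)) * hs
        · have h' : ∀ x ∈ l, x ∈ l.eraseIdx i := fun x hx => by
            rcases List.mem_cons.1 (h x (by simp [hx])) with rfl | k
            · exact absurd hx hal
            · exact k
          rw [sign_cons_succ, if_pos ((isCaesura_or_hasPrevious_iff he).2 (h' _ (by simp))),
            if_neg hal, orient_cons_of_notMem ha, orient_cons_of_notMem hal, one_mul,
            above_congr (l := l) (m := l.eraseIdx i) (fun x => ⟨h' x, hsub x⟩), hl]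
          have := ih hi h'
          linear_combination (-1) ^ ((l.eraseIdx i).length + above lt a (l.eraseIdx i)) * this

end Orientation

/-! ### The alternating sum over deletions -/

section Simplicial

variable {A : Type} {M : Type*} [AddCommGroup M]

/-- The alternating sum over all deletions of an entry. -/
def altSum : List A → (List A → M) → M
  | [], _ => 0
  | a :: l, F => F l - altSum l (fun x => F (a :: x))

@[simp] theorem altSum_nil (F : List A → M) : altSum [] F = 0 := rfl
@[simp] theorem altSum_cons (a : A) (l : List A) (F : List A → M) :
    altSum (a :: l) F = F l - altSum l (fun x => F (a :: x)) := rfl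

theorem altSum_eq_sum (l : List A) (F : List A → M) :
    altSum l F = ∑ i ∈ Finset.range l.length, (-1 : ℤ) ^ i • F (l.eraseIdx i) := by
  induction l generalizing F with
  | nil => simp
  | cons a l ih =>
    rw [altSum_cons, ih, List.length_cons, Finset.sum_range_succ']
    simp [pow_succ, add_comm, sub_eq_add_neg]

theorem altSum_congr {l : List A} {F G : List A → M}
    (h : ∀ i < l.length, F (l.eraseIdx i) = G (l.eraseIdx i)) : altSum l F = altSum l G := by
  rw [altSum_eq_sum, altSum_eq_sum]
  exact Finset.sum_congr rfl fun i hi => by rw [h i (by simpa using hi)]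

theorem altSum_zero (l : List A) : altSum l (fun _ => (0 : M)) = 0 := by simp [altSum_eq_sum]

theorem altSum_sub (l : List A) (F G : List A → M) :
    altSum l (fun x => F x - G x) = altSum l F - altSum l G := by
  simp [altSum_eq_sum, smul_sub]

theorem altSum_add (l : List A) (F G : List A → M) :
    altSum l (fun x => F x + G x) = altSum l F + altSum l G := by
  simp [altSum_eq_sum, Finset.sum_add_distrib]

theorem altSum_smul (l : List A) (n : ℤ) (F : List A → M) :
    altSum l (fun x => n • F x) = n • altSum l F := by
  simp [altSum_eq_sum, Finset.smul_sum, smul_comm n]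

theorem map_altSum {N G : Type*} [AddCommGroup N] [FunLike G M N] [AddMonoidHomClass G M N]
    (f : G) (l : List A) (F : List A → M) :
    f (altSum l F) = altSum l (fun x => f (F x)) := by
  simp [altSum_eq_sum, map_sum, map_zsmul]

/-- From `∂(a x) = x - a ∂x` one gets `∂∂(a x) = ∂x - (∂x - a ∂∂x)`, which vanishes by induction. -/
theorem altSum_altSum (l : List A) (F : List A → M) :
    altSum l (fun x => altSum x F) = 0 := by
  induction l generalizing F with
  | nil => simp
  | cons a l ih =>
    simp only [altSum_cons]
    rw [altSum_sub, ih]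
    simp

/-- Deleting either of two equal neighbours gives the same sequence with opposite signs; every other
deletion keeps the pair. -/
theorem altSum_eq_zero_of_not_isChain {l : List A} (hl : ¬ l.IsChain (· ≠ ·)) {F : List A → M}
    (hF : ∀ x, ¬ x.IsChain (· ≠ ·) → F x = 0) : altSum l F = 0 := by
  induction l generalizing F with
  | nil => simp
  | cons a l ih =>
    by_cases h : l.IsChain (· ≠ ·)
    · rcases l with - | ⟨b, l⟩
      · simp at hl
      · obtain rfl : a = b := by
          by_contra k
          exact hl (List.isChain_cons_cons.2 ⟨k, h⟩)
        rw [altSum_cons, altSum_cons, altSum_congr (G := fun _ => 0), altSum_zero]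
        · simp
        · intro i _
          exact hF _ (by simp)
    · rw [altSum_cons, hF _ h, ih h, sub_zero]
      intro x hx
      exact hF _ fun k => hx (List.IsChain.tail k)

theorem altSum_eq_zero_of_notMem {l : List A} {a : A} (hl : a ∉ l) {F : List A → M}
    (hF : ∀ x, a ∉ x → F x = 0) : altSum l F = 0 := by
  rw [altSum_congr (G := fun _ => 0), altSum_zero]
  exact fun i _ => hF _ fun k => hl (List.mem_of_mem_eraseIdx k)

variable {lt : A → A → Prop}

theorem delSum_eq_zero_of_notMem {l : List A} {a : A} (hl : a ∉ l) {F : List A → M}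
    (hF : ∀ x, a ∉ x → F x = 0) : delSum l F = 0 :=
  Finset.sum_eq_zero fun i _ => by
    rw [hF _ fun k => hl (List.mem_of_mem_eraseIdx k), smul_zero]

/-- Deletions that lose an element have unrelated signs on the two sides, but there `F` vanishes;
the others are compared by `sign_mul_orient`. -/
theorem delSum_eq_altSum (hlt : IsTournament lt) {l : List A} {F : List A → M}
    (hF : ∀ x a, a ∉ x → F x = 0) :
    delSum l F = orient lt l • altSum l (fun x => orient lt x • F x) := by
  rw [altSum_eq_sum, delSum, Finset.smul_sum]
  refine Finset.sum_congr rfl fun i hi => ?_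
  by_cases h : ∀ a, a ∈ l.eraseIdx i
  · rw [smul_smul, smul_smul, mul_comm (orient lt l),
      ← sign_mul_orient hlt (by simpa using hi) (fun x _ => h x), mul_assoc, orient_mul_self,
      mul_one]
  · push Not at h
    obtain ⟨a, ha⟩ := h
    simp [hF _ a ha]

/-- The element `v` is put on top because it takes the place of `B`, whose elements are above those
of `A` in `graftLT`. Transitivity is not asked for; the signs only need to know which of two
elements comes first. -/
theorem exists_isTournament (v : A) : ∃ lt : A → A → Prop, IsTournament lt ∧ ¬ lt v v ∧
    (∀ a, a ≠ v → lt a v) ∧ ∀ a, a ≠ v → ¬ lt v a := by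
  classical
  let r : A → A → Prop := WellOrderingRel
  refine ⟨fun a b => a ≠ v ∧ (b = v ∨ r a b), ?_, by simp, by simp, by simp⟩
  intro a b hab
  have h1 : r a b ∨ a = b ∨ r b a := trichotomous_of r a b
  have h2 : r a b → ¬ r b a := asymm_of r
  by_cases ha : a = v <;> by_cases hb : b = v <;> grind

/-- This is what makes the differential descend to the quotient by degenerate sequences, so that its
formula may be applied to arbitrary lists. -/
theorem delSum_eq_zero_of_not_nondegenerate {l : List A} (hl : ¬ Nondegenerate l)
    {F : List A → M} (hF : ∀ x, ¬ Nondegenerate x → F x = 0) : delSum l F = 0 := by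
  have hs : ∀ x a, a ∉ x → F x = 0 := fun x a h => hF x fun k => h (k.1 a)
  by_cases h : ∀ a, a ∈ l
  · rcases isEmpty_or_nonempty A with hA | ⟨⟨v⟩⟩
    · rcases l with - | ⟨a, l⟩
      · simp [delSum]
      · exact hA.elim a
    obtain ⟨lt, hlt, -⟩ := exists_isTournament v
    rw [delSum_eq_altSum hlt hs, altSum_eq_zero_of_not_isChain (fun k => hl ⟨h, k⟩), smul_zero]
    intro x hx
    rw [hF x fun k => hx k.2, smul_zero]
  · push Not at h
    obtain ⟨a, ha⟩ := h
    exact delSum_eq_zero_of_notMem ha (fun x => hs x a)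

end Simplicial

end Sequence

namespace Sequence

/-! ### Lengths, elements and degeneracies of the two factors of a cut -/

section CutFacts

variable {A : Type} {v : A} {B : Type}

theorem isRightAt_cons_zero_iff {x : Graft A v B} {l : List (Graft A v B)} :
    IsRightAt (x :: l) 0 ↔ ∃ b, x = Sum.inr b := by simp [IsRightAt]

theorem length_leftPart_add (l : List (Graft A v B)) :
    (leftPart l).length + (rightPart l).length = l.length := by
  induction l with
  | nil => rfl
  | cons x l ih => rcases x with a | b <;> simp <;> omega

/-- The entry at the cut is used twice, as `v` on the left and as the first entry on the right.
Together with `natCard_graft` this makes the degrees add up. -/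
theorem length_cut {l : List (Graft A v B)} {c : ℕ} (h : IsRightAt l c) :
    (cutLeft l c).length + (cutRight l c).length = l.length + 1 := by
  induction l generalizing c with
  | nil => simp [IsRightAt] at h
  | cons x l ih =>
    rcases c with - | c
    · obtain ⟨b, rfl⟩ := isRightAt_cons_zero_iff.1 h
      have := length_leftPart_add l
      simp [cutLeft_inr_zero, cutRight_zero]
      omega
    · have := ih (isRightAt_cons_succ.1 h)
      rcases x with a | b
      · simp [cutLeft_inl_succ, cutRight_cons_succ]; omega
      · simp [cutLeft_inr_succ, cutRight_cons_succ]; omega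

theorem mem_cutLeft {l : List (Graft A v B)} {c : ℕ} (h : IsRightAt l c) {x : A} :
    x ∈ cutLeft l c ↔ x = v ∨ x ∈ leftPart l := by
  induction l generalizing c with
  | nil => simp [IsRightAt] at h
  | cons y l ih =>
    rcases c with - | c
    · obtain ⟨b, rfl⟩ := isRightAt_cons_zero_iff.1 h
      simp [cutLeft_inr_zero]
    · have := ih (isRightAt_cons_succ.1 h)
      rcases y with a | b
      · simp [cutLeft_inl_succ, this]; tauto
      · simp [cutLeft_inr_succ, this]

theorem mem_rightPart_of_mem_cutRight {l : List (Graft A v B)} {c : ℕ} {b : B}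
    (h : b ∈ cutRight l c) : b ∈ rightPart l := by
  induction l generalizing c with
  | nil => rcases c with - | c <;> simp [cutRight] at h
  | cons y l ih =>
    rcases c with - | c
    · exact h
    · have := ih h
      rcases y with a | b <;> simp [this]

variable {M : Type*} [AddCommGroup M]

open Classical in
theorem cutSum_congr {l : List (Graft A v B)} {F G : List A → List B → M}
    (h : ∀ c, IsRightAt l c → F (cutLeft l c) (cutRight l c) = G (cutLeft l c) (cutRight l c)) :
    cutSum l F = cutSum l G :=
  Finset.sum_congr rfl fun c hc => by rw [h c (Finset.mem_filter.1 hc).2]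

theorem cutSum_zero (l : List (Graft A v B)) : cutSum l (fun _ _ => (0 : M)) = 0 := by
  simp [cutSum]

theorem cutSum_add (l : List (Graft A v B)) (F G : List A → List B → M) :
    cutSum l (fun x y => F x y + G x y) = cutSum l F + cutSum l G := by
  simp [cutSum, Finset.sum_add_distrib]

theorem cutSum_smul (l : List (Graft A v B)) (n : ℤ) (F : List A → List B → M) :
    cutSum l (fun x y => n • F x y) = n • cutSum l F := by
  simp [cutSum, Finset.smul_sum, smul_comm n]

theorem map_cutSum {N G : Type*} [AddCommGroup N] [FunLike G M N] [AddMonoidHomClass G M N]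
    (f : G) (l : List (Graft A v B))
    (F : List A → List B → M) :
    f (cutSum l F) = cutSum l (fun x y => f (F x y)) := by
  simp [cutSum, map_sum, map_zsmul]

theorem cutSum_eq_zero_of_notMem {l : List (Graft A v B)} {t : Graft A v B} (ht : t ∉ l)
    {F : List A → List B → M} (hA : ∀ x y a, a ∉ x → F x y = 0)
    (hB : ∀ x y b, b ∉ y → F x y = 0) : cutSum l F = 0 := by
  rw [cutSum_congr (G := fun _ _ => 0), cutSum_zero]
  intro c hc
  rcases t with a | b
  · refine hA _ _ a.1 ?_
    rw [mem_cutLeft hc]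
    simp [a.2, mem_leftPart, ht]
  · exact hB _ _ b fun k => ht (mem_rightPart.1 (mem_rightPart_of_mem_cutRight k))

theorem cutSum_eq_zero_of_notMem_right {l : List (Graft A v B)} {b : B} (hb : Sum.inr b ∉ l)
    {F : List A → List B → M} (hB : ∀ x y, b ∉ y → F x y = 0) : cutSum l F = 0 := by
  rw [cutSum_congr (G := fun _ _ => 0), cutSum_zero]
  exact fun c hc => hB _ _ fun k => hb (mem_rightPart.1 (mem_rightPart_of_mem_cutRight k))

theorem leftPart_or_rightPart_not_isChain {l : List (Graft A v B)}
    (hl : ¬ l.IsChain (· ≠ ·)) :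
    ¬ (leftPart l).IsChain (· ≠ ·) ∨ ¬ (rightPart l).IsChain (· ≠ ·) := by
  induction l with
  | nil => simp at hl
  | cons s l ih =>
    by_cases h : l.IsChain (· ≠ ·)
    · rcases l with - | ⟨t, l⟩
      · simp at hl
      · obtain rfl : s = t := by
          by_contra k
          exact hl (List.isChain_cons_cons.2 ⟨k, h⟩)
        rcases s with a | b <;> simp
    · rcases s with a | b
      · exact (ih h).imp_left fun k k' => k (List.IsChain.tail k')
      · exact (ih h).imp_right fun k k' => k (List.IsChain.tail k')

/-- Equal neighbours in `A` stay neighbours on the left. Equal neighbours in `B` become `v, v` on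
the left if the cut is at the second of them or later, and stay neighbours on the right if the cut
is at the first or earlier. -/
theorem cutSum_eq_zero_of_not_isChain {l : List (Graft A v B)} (hl : ¬ l.IsChain (· ≠ ·))
    {F : List A → List B → M} (hA : ∀ x y, ¬ x.IsChain (· ≠ ·) → F x y = 0)
    (hB : ∀ x y, ¬ y.IsChain (· ≠ ·) → F x y = 0) : cutSum l F = 0 := by
  induction l generalizing F with
  | nil => simp
  | cons s l ih =>
    by_cases h : l.IsChain (· ≠ ·)
    · rcases l with - | ⟨t, l⟩
      · simp at hl
      · obtain rfl : s = t := by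
          by_contra k
          exact hl (List.isChain_cons_cons.2 ⟨k, h⟩)
        rcases s with a | b
        · rw [cutSum_inl, cutSum_inl, cutSum_congr (G := fun _ _ => 0), cutSum_zero]
          exact fun c _ => hA _ _ (by simp)
        · rw [cutSum_inr, cutSum_inr, cutSum_congr (G := fun _ _ => 0), cutSum_zero,
            hA _ _ (by simp), hB _ _ (by simp)]
          · simp
          · exact fun c _ => hA _ _ (by simp)
    · have hA' : ∀ (a : A) x y, ¬ x.IsChain (· ≠ ·) → F (a :: x) y = 0 :=
        fun a x y k => hA _ _ fun k' => k (List.IsChain.tail k')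
      rcases s with a | b
      · rw [cutSum_inl, ih h (hA' _) fun x y => hB _ _]
      · rw [cutSum_inr, ih h (hA' _) fun x y => hB _ _, zero_add]
        rcases leftPart_or_rightPart_not_isChain h with k | k
        · rw [hA' _ _ _ k, smul_zero]
        · rw [hB _ _ fun k' => k (by simpa using List.IsChain.tail k'), smul_zero]

theorem cutSum_eq_zero_of_not_nondegenerate {l : List (Graft A v B)} (hl : ¬ Nondegenerate l)
    {F : List A → List B → M} (hA : ∀ x y, ¬ Nondegenerate x → F x y = 0)
    (hB : ∀ x y, ¬ Nondegenerate y → F x y = 0) : cutSum l F = 0 := by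
  by_cases h : ∀ t, t ∈ l
  · exact cutSum_eq_zero_of_not_isChain (fun k => hl ⟨h, k⟩)
      (fun x y k => hA _ _ fun k' => k k'.2) (fun x y k => hB _ _ fun k' => k k'.2)
  · push Not at h
    obtain ⟨t, ht⟩ := h
    exact cutSum_eq_zero_of_notMem ht (fun x y a k => hA _ _ fun k' => k (k'.1 a))
      (fun x y a k => hB _ _ fun k' => k (k'.1 a))

end CutFacts

/-! ### The cocomposition with all entries counted as odd -/

section AltCut

variable {A : Type} {v : A} {B : Type} {M : Type*} [AddCommGroup M]

/-- The sign of the permutation moving the entries in `A` to the front. -/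
def unshuffleSign : List (Graft A v B) → ℤ
  | [] => 1
  | Sum.inl _ :: l => unshuffleSign l
  | Sum.inr _ :: l => (-1) ^ (leftPart l).length * unshuffleSign l

/-- The sign of the cut at an entry in which all entries are counted as odd. -/
def altCutSign : List (Graft A v B) → ℕ → ℤ
  | [], _ => 1
  | _ :: l, 0 => unshuffleSign l
  | _ :: l, c + 1 => altCutSign l c

open Classical in
/-- The sum over all cuts in which all entries are counted as odd. -/
noncomputable def altCut (l : List (Graft A v B)) (F : List A → List B → M) : M :=
  ∑ c ∈ (Finset.range l.length).filter (fun c => IsRightAt l c),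
    altCutSign l c • F (cutLeft l c) (cutRight l c)

@[simp] theorem altCut_nil (F : List A → List B → M) :
    altCut ([] : List (Graft A v B)) F = 0 := by simp [altCut]

open Classical in
@[simp] theorem altCut_inl (a : {a : A // a ≠ v}) (l : List (Graft A v B))
    (F : List A → List B → M) :
    altCut (Sum.inl a :: l) F = altCut l (fun x y => F (a.1 :: x) y) := by
  unfold altCut
  rw [Finset.sum_filter, List.length_cons, Finset.sum_range_succ', if_neg isRightAt_inl, add_zero,
    Finset.sum_filter]
  refine Finset.sum_congr rfl fun i _ => if_congr isRightAt_cons_succ ?_ rfl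
  simp only [altCutSign, cutLeft_inl_succ, cutRight_cons_succ]

open Classical in
@[simp] theorem altCut_inr (b : B) (l : List (Graft A v B)) (F : List A → List B → M) :
    altCut (Sum.inr b :: l) F = altCut l (fun x y => F (v :: x) y) +
      unshuffleSign l • F (v :: leftPart l) (b :: rightPart l) := by
  unfold altCut
  rw [Finset.sum_filter, List.length_cons, Finset.sum_range_succ', if_pos isRightAt_inr,
    Finset.sum_filter]
  congr 1

open Classical in
theorem altCut_congr {l : List (Graft A v B)} {F G : List A → List B → M}
    (h : ∀ c, IsRightAt l c → F (cutLeft l c) (cutRight l c) = G (cutLeft l c) (cutRight l c)) :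
    altCut l F = altCut l G :=
  Finset.sum_congr rfl fun c hc => by rw [h c (Finset.mem_filter.1 hc).2]

theorem altCut_zero (l : List (Graft A v B)) : altCut l (fun _ _ => (0 : M)) = 0 := by
  simp [altCut]

theorem altCut_sub (l : List (Graft A v B)) (F G : List A → List B → M) :
    altCut l (fun x y => F x y - G x y) = altCut l F - altCut l G := by
  simp [altCut, smul_sub]

theorem altCut_smul (l : List (Graft A v B)) (n : ℤ) (F : List A → List B → M) :
    altCut l (fun x y => n • F x y) = n • altCut l F := by
  simp [altCut, Finset.smul_sum, smul_comm n]

theorem altCut_eq_zero_of_notMem {l : List (Graft A v B)} {t : Graft A v B} (ht : t ∉ l)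
    {F : List A → List B → M} (hA : ∀ x y a, a ∉ x → F x y = 0)
    (hB : ∀ x y b, b ∉ y → F x y = 0) : altCut l F = 0 := by
  rw [altCut_congr (G := fun _ _ => 0), altCut_zero]
  intro c hc
  rcases t with a | b
  · refine hA _ _ a.1 ?_
    rw [mem_cutLeft hc]
    simp [a.2, mem_leftPart, ht]
  · exact hB _ _ b fun k => ht (mem_rightPart.1 (mem_rightPart_of_mem_cutRight k))

/-- This is the Leibniz rule for a product of odd symbols in which the entries in `A` have been
moved to the front. -/
theorem altSum_unshuffle (l : List (Graft A v B)) (F : List A → List B → M) :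
    altSum l (fun m => unshuffleSign m • F (leftPart m) (rightPart m)) =
      unshuffleSign l • (altSum (leftPart l) (fun x => F x (rightPart l)) +
        (-1 : ℤ) ^ (leftPart l).length • altSum (rightPart l) (fun y => F (leftPart l) y)) := by
  induction l generalizing F with
  | nil => simp
  | cons s l ih =>
    rcases s with a | b
    · rw [altSum_cons]
      simp only [unshuffleSign, leftPart_inl, rightPart_inl]
      rw [ih fun x y => F (a.1 :: x) y, altSum_cons, List.length_cons, pow_succ]
      module
    · rw [altSum_cons]
      simp only [unshuffleSign, leftPart_inr, rightPart_inr]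
      have key := ih fun x y => (-1 : ℤ) ^ x.length • F x (b :: y)
      have h1 : altSum (leftPart l) (fun x => (-1 : ℤ) ^ x.length • F x (b :: rightPart l)) =
          -((-1 : ℤ) ^ (leftPart l).length • altSum (leftPart l)
            (fun x => F x (b :: rightPart l))) := by
        rw [← altSum_smul, ← neg_one_smul ℤ (altSum _ _), ← altSum_smul]
        refine altSum_congr fun i hi => ?_
        have : (leftPart l).length = ((leftPart l).eraseIdx i).length + 1 := by
          rw [List.length_eraseIdx_of_lt hi]; omega
        rw [this, pow_succ]
        module
      rw [h1, altSum_smul] at key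
      have h2 : altSum l (fun m => ((-1 : ℤ) ^ (leftPart m).length * unshuffleSign m) •
          F (leftPart m) (b :: rightPart m)) = altSum l (fun m => unshuffleSign m •
            (-1 : ℤ) ^ (leftPart m).length • F (leftPart m) (b :: rightPart m)) := by
        congr 1; ext m; module
      rw [h2, key, altSum_cons]
      rcases neg_one_pow_eq_or ℤ (leftPart l).length with h | h <;> simp only [h] <;> module

/-- The Leibniz rule on the right counts too much: the deletion of the `v` at a cut and the deletion
of the first entry of the right factor. The former at one cut and the latter at the preceding cut
give the same pair with opposite signs. What survives is the former at the first cut, where nothing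
has become `v`, and the latter at the last cut, where the right factor is empty; the two correction
terms remove these. -/
theorem altSum_altCut (l : List (Graft A v B)) (F : List A → List B → M) :
    altSum l (fun m => altCut m F) =
      altCut l (fun x y => altSum x (fun x' => F x' y) -
        (-1 : ℤ) ^ x.length • altSum y (fun y' => F x y')) -
      ((-1 : ℤ) ^ (leftPart l).length * unshuffleSign l) • F (leftPart l) (rightPart l) +
      (-1 : ℤ) ^ l.length • F (collapse l) [] := by
  induction l generalizing F with
  | nil => simp [unshuffleSign, collapse]
  | cons s l ih =>
    rcases s with a | b
    · rw [altSum_cons]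
      simp only [altCut_inl]
      rw [ih fun x y => F (a.1 :: x) y]
      simp only [altSum_cons, List.length_cons, pow_succ, leftPart_inl, rightPart_inl, collapse,
        List.map_cons, Sum.elim_inl, unshuffleSign, altCut_sub, mul_neg_one, neg_smul]
      have h : altCut l (fun x y => -((-1 : ℤ) ^ x.length • altSum y (fun y' => F (a.1 :: x) y'))) =
          -altCut l (fun x y => (-1 : ℤ) ^ x.length • altSum y (fun y' => F (a.1 :: x) y')) := by
        rw [← neg_one_smul ℤ (altCut _ _), ← altCut_smul]; simp
      rw [h]
      module
    · rw [altSum_cons]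
      simp only [altCut_inr]
      rw [altSum_add, ih fun x y => F (v :: x) y, altSum_unshuffle l fun x y => F (v :: x) (b :: y)]
      simp only [altSum_cons, List.length_cons, pow_succ, leftPart_inr, rightPart_inr, collapse,
        List.map_cons, Sum.elim_inr, unshuffleSign, altCut_sub, mul_neg_one, neg_smul]
      have h : altCut l (fun x y => -((-1 : ℤ) ^ x.length • altSum y (fun y' => F (v :: x) y'))) =
          -altCut l (fun x y => (-1 : ℤ) ^ x.length • altSum y (fun y' => F (v :: x) y')) := by
        rw [← neg_one_smul ℤ (altCut _ _), ← altCut_smul]; simp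
      rw [h]
      rcases neg_one_pow_eq_or ℤ (leftPart l).length with h | h <;> simp only [h] <;> module

end AltCut

/-! ### Comparison of the two signs of a cut -/

section OrientCut

theorem neg_one_pow_mul_self (n : ℕ) : (-1 : ℤ) ^ n * (-1) ^ n = 1 := by
  rw [← mul_pow]; simp

variable {A : Type} {v : A} {B : Type}

/-- Elements of `A` are below elements of `B`. -/
def graftLT (lt : A → A → Prop) (lt' : B → B → Prop) (s t : Graft A v B) : Prop :=
  match s, t with
  | Sum.inl a, Sum.inl a' => lt a.1 a'.1
  | Sum.inl _, Sum.inr _ => True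
  | Sum.inr _, Sum.inl _ => False
  | Sum.inr b, Sum.inr b' => lt' b b'

variable {lt : A → A → Prop} {lt' : B → B → Prop}

theorem IsTournament.graftLT (h : IsTournament lt) (h' : IsTournament lt') :
    IsTournament (graftLT (v := v) lt lt') := by
  rintro (a | b) (a' | b') k
  · exact h a.1 a'.1 fun e => k (congrArg Sum.inl (Subtype.ext e))
  · simp [Sequence.graftLT]
  · simp [Sequence.graftLT]
  · exact h' b b' fun e => k (congrArg Sum.inr e)

open Classical in
theorem above_inl (a : {a : A // a ≠ v}) (l : List (Graft A v B)) :
    above (graftLT lt lt') (Sum.inl a) l =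
      above lt a.1 (leftPart l) + (rightPart l).toFinset.card := by
  induction l with
  | nil => simp [above]
  | cons s l ih =>
    by_cases h : s ∈ l
    · rw [above_cons_of_mem h, ih]
      rcases s with c | b
      · rw [leftPart_inl, rightPart_inl, above_cons_of_mem (mem_leftPart.2 ⟨c.2, h⟩)]
      · rw [leftPart_inr, rightPart_inr, List.toFinset_cons,
          Finset.insert_eq_of_mem (by simpa [mem_rightPart] using h)]
    · rw [above_cons_of_notMem h, ih]
      rcases s with c | b
      · rw [leftPart_inl, rightPart_inl, above_cons_of_notMem (by simpa [mem_leftPart, c.2] using h)]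
        rw [add_right_comm]
        congr
      · rw [leftPart_inr, rightPart_inr, List.toFinset_cons,
          Finset.card_insert_of_notMem (by simpa [mem_rightPart] using h)]
        simp [graftLT, add_assoc]

theorem above_inr (b : B) (l : List (Graft A v B)) :
    above (graftLT (v := v) lt lt') (Sum.inr b) l = above lt' b (rightPart l) := by
  classical
  induction l with
  | nil => simp [above]
  | cons s l ih =>
    by_cases h : s ∈ l
    · rw [above_cons_of_mem h, ih]
      rcases s with c | b
      · rw [rightPart_inl]
      · rw [rightPart_inr, above_cons_of_mem (mem_rightPart.2 h)]
    · rw [above_cons_of_notMem h, ih]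
      rcases s with c | b
      · simp [graftLT]
      · rw [rightPart_inr, above_cons_of_notMem (mem_rightPart.not.2 h)]
        rfl

open Classical in
-- Both sides reorder the entries to: caesuras in `A`, last occurrences in `A`, caesuras in `B`,
-- last occurrences in `B`. Starting from all caesuras followed by all last occurrences, one sorts
-- the caesuras, with sign `cutSign l 0`, and moves those in `B` past the last occurrences in `A`,
-- which is the explicit power of `-1`.
theorem cutSign_mul_orient (l : List (Graft A v B)) :
    cutSign l 0 * orient lt (leftPart l) * orient lt' (rightPart l) =
      (-1) ^ (caesuras (rightPart l) * (leftPart l).toFinset.card) * unshuffleSign l *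
        orient (graftLT lt lt') l := by
  induction l with
  | nil => simp [cutSign_nil_zero, unshuffleSign]
  | cons s l ih =>
    rcases s with a | b
    · rw [cutSign_inl_zero, leftPart_inl, rightPart_inl, unshuffleSign]
      by_cases h : Sum.inl a ∈ l
      · have h' : a.1 ∈ leftPart l := mem_leftPart.2 ⟨a.2, h⟩
        rw [orient_cons_of_mem h, orient_cons_of_mem h', ih, List.toFinset_cons,
          Finset.insert_eq_of_mem (by simpa using h')]
      · have h' : a.1 ∉ leftPart l := by simpa [mem_leftPart, a.2] using h
        rw [orient_cons_of_notMem h, orient_cons_of_notMem h', List.toFinset_cons,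
          Finset.card_insert_of_notMem (by simpa using h'), above_inl, ← length_leftPart_add,
          ← caesuras_add_card (rightPart l)]
        have e1 := neg_one_pow_mul_self (caesuras (rightPart l))
        have e2 := neg_one_pow_mul_self (rightPart l).toFinset.card
        rw [mul_add, mul_one]
        simp only [pow_add]
        set X : ℤ := (-1) ^ (leftPart l).length * (-1) ^ above lt a.1 (leftPart l)
        set t : ℤ := ((-1) ^ (caesuras (rightPart l) * (leftPart l).toFinset.card) * unshuffleSign l *
            orient (graftLT lt lt') l)
        linear_combination X * ih - X * t * e2 - X * t *
          ((-1) ^ (rightPart l).toFinset.card * (-1) ^ (rightPart l).toFinset.card) * e1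
    · rw [cutSign_inr_zero, leftPart_inr, rightPart_inr, unshuffleSign]
      by_cases h : Sum.inr b ∈ l
      · have h' : b ∈ rightPart l := mem_rightPart.2 h
        rw [orient_cons_of_mem h, orient_cons_of_mem h', caesuras_cons, if_pos h', if_pos h',
          add_mul, one_mul, pow_add, ← caesuras_add_card (leftPart l), pow_add]
        linear_combination (-1) ^ caesuras (leftPart l) * ih - (-1) ^ caesuras (leftPart l) *
          ((-1) ^ (caesuras (rightPart l) * (leftPart l).toFinset.card) * unshuffleSign l *
            orient (graftLT lt lt') l) *
            neg_one_pow_mul_self (leftPart l).toFinset.card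
      · have h' : b ∉ rightPart l := mem_rightPart.not.2 h
        rw [orient_cons_of_notMem h, orient_cons_of_notMem h', caesuras_cons, if_neg h',
          if_neg h', above_inr, ← length_leftPart_add]
        simp only [pow_add, add_zero, one_mul]
        linear_combination (-1) ^ (rightPart l).length * (-1) ^ above lt' b (rightPart l) * ih -
          (-1) ^ (rightPart l).length * (-1) ^ above lt' b (rightPart l) *
          ((-1) ^ (caesuras (rightPart l) * (leftPart l).toFinset.card) * unshuffleSign l *
            orient (graftLT lt lt') l) *
            neg_one_pow_mul_self (leftPart l).length

end OrientCut

end Sequence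

namespace Sequence

/-! ### The cocomposition is a chain map -/

section ChainMap

variable {A : Type} {v : A} {B : Type} {M : Type*} [AddCommGroup M]
variable {lt : A → A → Prop} {lt' : B → B → Prop}

open Classical in
-- The cut at the head follows from `cutSign_mul_orient`; the additional `v` is moved behind all of
-- `leftPart l`, being on top of the order. An entry of `B` before the cut recurs on the right by
-- `hy`, so it is a caesura of `l`, and it becomes a caesura `v` of the left factor; such entries do
-- not change any sign.
theorem cutSign_mul_orient_cut (hv : ¬ lt v v) (hv1 : ∀ a, a ≠ v → lt a v)
    (hv2 : ∀ a, a ≠ v → ¬ lt v a) {l : List (Graft A v B)} {c : ℕ} (hc : IsRightAt l c)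
    (hy : ∀ b, b ∈ cutRight l c) :
    cutSign l c * orient lt (cutLeft l c) * orient lt' (cutRight l c) =
      (-1) ^ (caesuras (cutRight l c) * (leftPart l).toFinset.card) * altCutSign l c *
        orient (graftLT lt lt') l := by
  induction l generalizing c with
  | nil => simp [IsRightAt] at hc
  | cons s l ih =>
    rcases c with - | c
    · obtain ⟨b, rfl⟩ := isRightAt_cons_zero_iff.1 hc
      have key := cutSign_mul_orient (lt := lt) (lt' := lt') (Sum.inr b :: l)
      have h0 : above lt v (leftPart l) = 0 := by
        unfold above
        rw [Finset.card_eq_zero, Finset.filter_eq_empty_iff]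
        intro x _ hx
        by_cases k : x = v
        · exact hv (k ▸ hx)
        · exact hv2 x k hx
      rw [cutRight_zero, cutLeft_inr_zero, orient_cons_of_notMem (notMem_leftPart l), h0, add_zero,
        altCutSign]
      rw [leftPart_inr, unshuffleSign] at key
      rw [leftPart_inr]
      have e := neg_one_pow_mul_self (leftPart l).length
      linear_combination (-1) ^ (leftPart l).length * key +
        (-1) ^ (caesuras (rightPart (Sum.inr b :: l)) * (leftPart l).toFinset.card) *
          unshuffleSign l * orient (graftLT lt lt') (Sum.inr b :: l) * e
    · have hc' := isRightAt_cons_succ.1 hc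
      rw [cutRight_cons_succ] at hy ⊢
      specialize ih hc' hy
      rw [cutSign_cons_succ, altCutSign]
      rcases s with a | b
      · rw [cutLeft_inl_succ, leftPart_inl]
        by_cases h : Sum.inl a ∈ l
        · have h' : a.1 ∈ leftPart l := mem_leftPart.2 ⟨a.2, h⟩
          rw [orient_cons_of_mem h, orient_cons_of_mem ((mem_cutLeft hc').2 (Or.inr h')), ih,
            List.toFinset_cons, Finset.insert_eq_of_mem (by simpa using h')]
        · have h' : a.1 ∉ leftPart l := by simpa [mem_leftPart, a.2] using h
          have h1 : above lt a.1 (cutLeft l c) = above lt a.1 (leftPart l) + 1 := by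
            rw [above_congr (m := v :: leftPart l), above_cons_of_notMem (notMem_leftPart l),
              if_pos (hv1 _ a.2)]
            intro x
            rw [mem_cutLeft hc', List.mem_cons]
          have h2 : (rightPart l).toFinset = (cutRight l c).toFinset := by
            ext b
            simp [hy b, mem_rightPart_of_mem_cutRight (hy b)]
          have h3 := length_cut hc'
          rw [orient_cons_of_notMem h,
            orient_cons_of_notMem (by rw [mem_cutLeft hc']; exact not_or.2 ⟨a.2, h'⟩),
            List.toFinset_cons, Finset.card_insert_of_notMem (by simpa using h'), above_inl, h1, h2,
            mul_add, mul_one]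
          have h4 := caesuras_add_card (cutRight l c)
          -- A parity count: the lengths of the factors add up to `l.length + 1`, and the length of
          -- the right factor is its number of caesuras plus its number of elements.
          have h5 : (-1 : ℤ) ^ ((cutLeft l c).length + (above lt a.1 (leftPart l) + 1)) =
              (-1) ^ caesuras (cutRight l c) * (-1) ^ (l.length +
                (above lt a.1 (leftPart l) + (cutRight l c).toFinset.card)) := by
            rw [← pow_add]
            refine neg_one_pow_congr ?_
            grind
          rw [h5, pow_add (-1 : ℤ) (_ * _)]
          linear_combination (-1) ^ caesuras (cutRight l c) * (-1) ^ (l.length +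
                (above lt a.1 (leftPart l) + (cutRight l c).toFinset.card)) * ih
      · rw [cutLeft_inr_succ, leftPart_inr, orient_cons_of_mem ((mem_cutLeft hc').2 (Or.inl rfl)),
          orient_cons_of_mem (mem_rightPart.1 (mem_rightPart_of_mem_cutRight (hy b))), ih]

open Classical in
theorem card_leftPart [Finite A] {l : List (Graft A v B)} (hl : ∀ t, t ∈ l) :
    (leftPart l).toFinset.card + 1 = Nat.card A := by
  have := Fintype.ofFinite A
  have h : (leftPart l).toFinset = Finset.univ.erase v := by
    ext a
    simp [mem_leftPart, hl]
  rw [h, Finset.card_erase_of_mem (Finset.mem_univ v), Nat.card_eq_fintype_card, Finset.card_univ]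
  have := Fintype.card_pos_iff.2 ⟨v⟩
  omega

/-- As `F` only sees right factors with `q` caesuras, the discrepancy of the signs does not depend
on the cut. Its exponent `q * (Nat.card A - 1)` is written with `+ 1` to avoid subtraction. -/
theorem cutSum_eq_altCut [Finite A] (hv : ¬ lt v v) (hv1 : ∀ a, a ≠ v → lt a v)
    (hv2 : ∀ a, a ≠ v → ¬ lt v a) {l : List (Graft A v B)} (hl : ∀ t, t ∈ l) {q : ℕ}
    {F : List A → List B → M} (hF : ∀ x y b, b ∉ y → F x y = 0)
    (hq : ∀ x y, caesuras y ≠ q → F x y = 0) :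
    cutSum l F = ((-1) ^ (q * (Nat.card A + 1)) * orient (graftLT lt lt') l) •
      altCut l (fun x y => (orient lt x * orient lt' y) • F x y) := by
  classical
  rw [cutSum, altCut, Finset.smul_sum]
  refine Finset.sum_congr rfl fun c hc => ?_
  by_cases hy : ∀ b, b ∈ cutRight l c
  · by_cases hq' : caesuras (cutRight l c) = q
    · have key := cutSign_mul_orient_cut (lt' := lt') hv hv1 hv2 (Finset.mem_filter.1 hc).2 hy
      rw [smul_smul, smul_smul]
      congr 1
      have h1 := orient_mul_self (lt := lt) (cutLeft l c)
      have h2 := orient_mul_self (lt := lt') (cutRight l c)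
      have h3 : (-1 : ℤ) ^ (q * (Nat.card A + 1)) = (-1) ^ (q * (leftPart l).toFinset.card) := by
        rw [← card_leftPart hl, mul_add, mul_add, pow_add, pow_add, mul_assoc, mul_one,
          neg_one_pow_mul_self, mul_one]
      rw [hq'] at key
      rw [h3]
      set s := orient lt (cutLeft l c)
      set t := orient lt' (cutRight l c)
      linear_combination s * t * key - cutSign l c * h1 - cutSign l c * s * s * h2
    · rw [hq _ _ hq', smul_zero, smul_zero, smul_zero, smul_zero]
  · push Not at hy
    obtain ⟨b, hb⟩ := hy
    rw [hF _ _ b hb, smul_zero, smul_zero, smul_zero, smul_zero]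

/-- Compatibility of the cocomposition with the differential. -/
theorem delSum_cutSum [Finite A] [Finite B] [Nonempty B] {l : List (Graft A v B)}
    (hl : ∀ t, t ∈ l) {p q : ℕ}
    {F : List A → List B → M} (hA : ∀ x y a, a ∉ x → F x y = 0)
    (hB : ∀ x y b, b ∉ y → F x y = 0) (hp : ∀ x y, x.length ≠ Nat.card A + p → F x y = 0)
    (hq : ∀ x y, y.length ≠ Nat.card B + q → F x y = 0) :
    delSum l (fun m => cutSum m F) =
      cutSum l (fun x y => delSum x (fun x' => F x' y)) +
        (-1 : ℤ) ^ p • cutSum l (fun x y => delSum y (fun y' => F x y')) := by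
  obtain ⟨lt, hlt, hv, hv1, hv2⟩ := exists_isTournament v
  obtain ⟨lt', hlt', -⟩ := exists_isTournament (Classical.arbitrary B)
  set G : List A → List B → M := fun x y => (orient lt x * orient lt' y) • F x y with hG
  have hGA : ∀ x y a, a ∉ x → G x y = 0 := fun x y a h => by simp [hG, hA x y a h]
  have hGB : ∀ x y b, b ∉ y → G x y = 0 := fun x y a h => by simp [hG, hB x y a h]
  have hq' : ∀ x y, caesuras y ≠ q → F x y = 0 := fun x y h => by
    by_cases hy : ∀ b, b ∈ y
    · exact hq x y fun k => h (by have := caesuras_add_natCard hy; omega)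
    · push Not at hy
      obtain ⟨b, hb⟩ := hy
      exact hB x y b hb
  set K : ℤ := (-1) ^ (q * (Nat.card A + 1)) with hK
  set σ : ℤ := orient (graftLT lt lt') l with hσ
  have e0 : delSum l (fun m => cutSum m F) = (K * σ) • altSum l (fun m => altCut m G) := by
    rw [delSum_eq_altSum (hlt.graftLT hlt') (fun m t h => cutSum_eq_zero_of_notMem h hA hB),
      ← hσ, mul_comm, mul_smul, ← altSum_smul l K]
    congr 2
    ext m
    by_cases hm : ∀ t, t ∈ m
    · rw [cutSum_eq_altCut hv hv1 hv2 hm hB hq', smul_smul, mul_comm, mul_assoc, orient_mul_self,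
        mul_one]
    · push Not at hm
      obtain ⟨t, ht⟩ := hm
      rw [cutSum_eq_zero_of_notMem ht hA hB, altCut_eq_zero_of_notMem ht hGA hGB, smul_zero,
        smul_zero]
  have e1 : cutSum l (fun x y => delSum x (fun x' => F x' y)) =
      (K * σ) • altCut l (fun x y => altSum x (fun x' => G x' y)) := by
    rw [cutSum_eq_altCut (lt' := lt') (q := q) hv hv1 hv2 hl]
    · congr 2
      ext x y
      rw [delSum_eq_altSum hlt (fun x' a h => hA x' y a h), smul_smul, mul_right_comm,
        orient_mul_self, one_mul, ← altSum_smul]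
      congr 1
      ext x'
      rw [smul_smul, mul_comm (orient lt' y)]
    · intro x y b h
      simp [delSum, hB _ y b h]
    · intro x y h
      simp [delSum, hq' _ y h]
  -- Before the differential is applied the right factor has `q + 1` caesuras, which adds the factor
  -- `(-1) ^ (Nat.card A + 1)`. Together with the sign `-(-1) ^ (Nat.card A + p)` from
  -- `altSum_altCut` and `e3` it leaves the Koszul sign `(-1) ^ p`.
  have e2 : cutSum l (fun x y => delSum y (fun y' => F x y')) =
      ((-1) ^ (Nat.card A + 1) * (K * σ)) • altCut l (fun x y => altSum y (fun y' => G x y')) := by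
    rw [cutSum_eq_altCut (lt' := lt') (q := q + 1) hv hv1 hv2 hl, add_mul, one_mul, pow_add,
      mul_comm ((-1) ^ (q * (Nat.card A + 1))), mul_assoc]
    · congr 2
      ext x y
      rw [delSum_eq_altSum hlt' (fun y' a h => hB x y' a h), smul_smul, mul_assoc,
        orient_mul_self, mul_one, ← altSum_smul]
      congr 1
      ext y'
      rw [smul_smul]
    · intro x y b h
      exact delSum_eq_zero_of_notMem h (fun y' => hB x y' b)
    · intro x y h
      by_cases hy : ∀ b, b ∈ y
      · refine Finset.sum_eq_zero fun i hi => ?_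
        refine smul_eq_zero_of_right _ (hq _ _ ?_)
        have h1 := caesuras_add_natCard hy
        have h2 : i < y.length := by simpa using hi
        rw [List.length_eraseIdx_of_lt h2]
        omega
      · push Not at hy
        obtain ⟨b, hb⟩ := hy
        exact delSum_eq_zero_of_notMem hb (fun y' => hB x y' b)
  have e3 : altCut l (fun x y => (-1 : ℤ) ^ x.length • altSum y (fun y' => G x y')) =
      (-1 : ℤ) ^ (Nat.card A + p) • altCut l (fun x y => altSum y (fun y' => G x y')) := by
    rw [← altCut_smul]
    congr 1
    ext x y
    by_cases h : x.length = Nat.card A + p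
    · rw [h]
    · have : ∀ y', G x y' = 0 := fun y' => by simp [hG, hp x y' h]
      simp [this, altSum_zero]
  -- The two correction terms vanish: `v` does not occur in `leftPart l`, and the empty right factor
  -- misses the elements of `B`.
  rw [e0, e1, e2, altSum_altCut, altCut_sub, e3, hGA _ _ v (notMem_leftPart l),
    hGB _ [] (Classical.arbitrary B) (by simp), smul_zero, smul_zero, sub_zero, add_zero, smul_sub,
    smul_smul, smul_smul, sub_eq_add_neg, ← neg_smul]
  congr 2
  ring

end ChainMap

end Sequence

namespace Graft

variable {A B : Type}

@[simp] theorem assoc_inl_inl (v : A) (w : B) (D : Type) (a : {a : A // a ≠ v}) (h) :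
    assoc v w D (Sum.inl ⟨Sum.inl a, h⟩) = Sum.inl a := rfl
@[simp] theorem assoc_inl_inr (v : A) (w : B) (D : Type) (b : B) (h) :
    assoc v w D (Sum.inl ⟨Sum.inr b, h⟩) =
      Sum.inr (Sum.inl ⟨b, fun e => h (congrArg Sum.inr e)⟩) := rfl
@[simp] theorem assoc_inr (v : A) (w : B) (D : Type) (d : D) :
    assoc v w D (Sum.inr d) = Sum.inr (Sum.inr d) := rfl

@[simp] theorem swap_inl_inl {v w : A} (h : v ≠ w) (D : Type) (a : {a : A // a ≠ v}) (k) :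
    swap h B D (Sum.inl ⟨Sum.inl a, k⟩) =
      Sum.inl ⟨Sum.inl ⟨a.1, fun e => k (congrArg Sum.inl (Subtype.ext e))⟩,
        fun e => a.2 (congrArg Subtype.val (Sum.inl_injective e))⟩ := rfl
@[simp] theorem swap_inl_inr {v w : A} (h : v ≠ w) (D : Type) (b : B) (k) :
    swap h B D (Sum.inl ⟨Sum.inr b, k⟩) = Sum.inr b := rfl
@[simp] theorem swap_inr {v w : A} (h : v ≠ w) (D : Type) (d : D) :
    swap h B D (Sum.inr d) = Sum.inl ⟨Sum.inr d, Sum.inr_ne_inl⟩ := rfl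

theorem swap_swap {v w : A} (h : v ≠ w) (D : Type)
    (s : Graft (Graft A v B) (Sum.inl ⟨w, h.symm⟩) D) :
    swap h.symm D B (swap h B D s) = s := by
  rcases s with ⟨a | b, k⟩ | d <;> rfl

end Graft

namespace Sequence

section General

variable {A : Type} {v : A} {B : Type}

theorem caesuras_parts (l : List (Graft A v B)) :
    caesuras l = caesuras (leftPart l) + caesuras (rightPart l) := by
  induction l with
  | nil => rfl
  | cons s l ih =>
    rcases s with a | b
    · have h : a.1 ∈ leftPart l ↔ Sum.inl a ∈ l := by simp [mem_leftPart, a.2]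
      by_cases k : Sum.inl a ∈ l <;>
        simp [leftPart_inl, rightPart_inl, caesuras_cons, ih, h, k] <;> omega
    · by_cases k : Sum.inr b ∈ l <;>
        simp [leftPart_inr, rightPart_inr, caesuras_cons, ih, mem_rightPart, k] <;> omega

end General

/-! ### Sequential coassociativity of cuts -/

section Sequential

variable {A B D : Type} {v : A} {w : B} {M : Type*} [AddCommGroup M]

theorem leftPart_assoc (l : List (Graft (Graft A v B) (Sum.inr w) D)) :
    leftPart (l.map (Graft.assoc v w D)) = leftPart (leftPart l) := by
  induction l with
  | nil => rfl
  | cons s l ih => rcases s with ⟨a | b, h⟩ | d <;> simp [ih]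

theorem leftPart_rightPart_assoc (l : List (Graft (Graft A v B) (Sum.inr w) D)) :
    leftPart (rightPart (l.map (Graft.assoc v w D))) = rightPart (leftPart l) := by
  induction l with
  | nil => rfl
  | cons s l ih => rcases s with ⟨a | b, h⟩ | d <;> simp [ih]

theorem rightPart_rightPart_assoc (l : List (Graft (Graft A v B) (Sum.inr w) D)) :
    rightPart (rightPart (l.map (Graft.assoc v w D))) = rightPart l := by
  induction l with
  | nil => rfl
  | cons s l ih => rcases s with ⟨a | b, h⟩ | d <;> simp [ih]

theorem leftPart_cutLeft_inr {l : List (Graft (Graft A v B) (Sum.inr w) D)} {c : ℕ}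
    (hc : IsRightAt l c) : leftPart (cutLeft l c) = leftPart (leftPart l) := by
  induction l generalizing c with
  | nil => simp [IsRightAt] at hc
  | cons s l ih =>
    rcases c with - | c
    · obtain ⟨b, rfl⟩ := isRightAt_cons_zero_iff.1 hc
      simp [cutLeft_inr_zero]
    · have := ih (isRightAt_cons_succ.1 hc)
      rcases s with ⟨a | b, h⟩ | d
      · simp [cutLeft_inl_succ, this]
      · simp [cutLeft_inl_succ, this]
      · simp [cutLeft_inr_succ, this]

theorem mem_rightPart_rightPart_assoc {l : List (Graft (Graft A v B) (Sum.inr w) D)} {b : B}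
    (h : b ≠ w) : Sum.inl ⟨b, h⟩ ∈ rightPart (l.map (Graft.assoc v w D)) ↔
      b ∈ rightPart (leftPart l) := by
  rw [← leftPart_rightPart_assoc, mem_leftPart]
  simp [h]

/-- Both products count the inversions in sorting the caesuras into those in `A`, in `B` and in `D`,
in this order. -/
theorem cutSign_assoc (l : List (Graft (Graft A v B) (Sum.inr w) D)) :
    cutSign l 0 * cutSign (leftPart l) 0 =
      cutSign (l.map (Graft.assoc v w D)) 0 *
        cutSign (rightPart (l.map (Graft.assoc v w D))) 0 := by
  classical
  induction l with
  | nil => simp [cutSign_nil_zero]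
  | cons s l ih =>
    rcases s with ⟨a | b, h⟩ | d
    · simpa [cutSign_inl_zero] using ih
    · have hb : b ≠ w := fun e => h (congrArg Sum.inr e)
      simp only [cutSign_inl_zero, leftPart_inl, List.map_cons, Graft.assoc_inl_inr,
        rightPart_inr, cutSign_inr_zero, mem_rightPart_rightPart_assoc, leftPart_assoc]
      linear_combination (if b ∈ rightPart (leftPart l) then
        (-1) ^ caesuras (leftPart (leftPart l)) else 1) * ih
    · simp only [leftPart_inr, List.map_cons, Graft.assoc_inr,
        rightPart_inr, cutSign_inr_zero, leftPart_assoc, leftPart_rightPart_assoc,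
        caesuras_parts (leftPart l)]
      have h1 : Sum.inr d ∈ rightPart (l.map (Graft.assoc v w D)) ↔ d ∈ rightPart l := by
        rw [← mem_rightPart, rightPart_rightPart_assoc]
      rw [rightPart_rightPart_assoc]
      simp only [h1]
      split_ifs
      · rw [pow_add]
        linear_combination (-1) ^ caesuras (leftPart (leftPart l)) *
          (-1) ^ caesuras (rightPart (leftPart l)) * ih
      · linear_combination ih

/-- This is the part of coassociativity in which the cut separating `A` from the rest has been made
before all entries of `l`, so that only a cut between `B` and `D` is left to choose. -/
theorem cutSum_unshuffle_assoc (l : List (Graft (Graft A v B) (Sum.inr w) D))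
    {F : List A → List B → List D → M} (hF : ∀ x y z d, d ∉ z → F x y z = 0) :
    cutSum l (fun y z => cutSign y 0 • F (leftPart y) (rightPart y) z) =
      cutSign (l.map (Graft.assoc v w D)) 0 •
        cutSum (rightPart (l.map (Graft.assoc v w D)))
          (fun y z => F (leftPart (leftPart l)) y z) := by
  classical
  induction l generalizing F with
  | nil => simp
  | cons s l ih =>
    rcases s with ⟨a | b, h⟩ | d
    · simp only [cutSum_inl, cutSign_inl_zero, leftPart_inl, rightPart_inl, List.map_cons,
        Graft.assoc_inl_inl]
      exact ih fun x => hF _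
    · have hb : b ≠ w := fun e => h (congrArg Sum.inr e)
      simp only [cutSum_inl, cutSign_inr_zero, leftPart_inl, rightPart_inr, leftPart_inr,
        List.map_cons, Graft.assoc_inl_inr, mem_rightPart_rightPart_assoc, leftPart_assoc]
      rw [mul_smul, ← ih (F := fun x y z => F x (b :: y) z) (fun x y => hF _ _), ← cutSum_smul]
      refine cutSum_congr fun c hc => ?_
      rw [mul_smul, leftPart_cutLeft_inr hc]
      congr 1
      simp [mem_rightPart, mem_cutLeft hc, hb]
    · simp only [cutSum_inr, leftPart_inr, rightPart_inr, List.map_cons, Graft.assoc_inr,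
        rightPart_rightPart_assoc, leftPart_rightPart_assoc]
      rw [smul_add, smul_smul, smul_smul]
      congr 1
      · have h1 : Sum.inr d ∈ rightPart (l.map (Graft.assoc v w D)) ↔ d ∈ rightPart l := by
          rw [← mem_rightPart, rightPart_rightPart_assoc]
        simp only [cutSign_inr_zero, h1, leftPart_assoc]
        rw [mul_smul, ← ih (F := fun x y z => F x (w :: y) z) (fun x y => hF _ _), ← cutSum_smul]
        refine cutSum_congr fun c hc => ?_
        rw [leftPart_cutLeft_inr hc]
        -- If `d` recurs after the cut, it is a caesura, and so is the `w` replacing it; otherwise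
        -- `F` vanishes.
        by_cases hd : d ∈ cutRight l c
        · rw [if_pos (mem_rightPart.2 ((mem_cutLeft hc).2 (Or.inl rfl))),
            if_pos (mem_rightPart_of_mem_cutRight hd), mul_smul]
        · simp [hF _ _ _ d hd]
      · congr 1
        have := cutSign_assoc (Sum.inr d :: l)
        simp only [List.map_cons, Graft.assoc_inr, rightPart_inr, leftPart_inr] at this
        rw [← this, cutSign_inr_zero w]
        simp [mem_rightPart, mem_leftPart]

/-- Sequential coassociativity. -/
theorem cutSum_assoc (l : List (Graft (Graft A v B) (Sum.inr w) D))
    {F : List A → List B → List D → M} (hB : ∀ x y z b, b ∉ y → F x y z = 0)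
    (hD : ∀ x y z d, d ∉ z → F x y z = 0) :
    cutSum l (fun y z => cutSum y (fun x y' => F x y' z)) =
      cutSum (l.map (Graft.assoc v w D)) (fun x y => cutSum y (fun y' z => F x y' z)) := by
  induction l generalizing F with
  | nil => simp
  | cons s l ih =>
    -- For a head in `B` or `D`, `IH` covers the terms in which it becomes `v`, and `key` those in
    -- which the cut separating `A` from the rest is at the head.
    have IH := ih (F := fun x => F (v :: x)) (fun x => hB _) (fun x => hD _)
    have key := cutSum_unshuffle_assoc (s :: l) (F := fun x => F (v :: x)) (fun x => hD _)
    rcases s with ⟨a | b, h⟩ | d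
    · simpa using ih (F := fun x => F (a :: x)) (fun x => hB _) (fun x => hD _)
    · simp only [cutSum_inl, cutSum_inr, List.map_cons, Graft.assoc_inl_inr, leftPart_inr,
        leftPart_inl, rightPart_inr, leftPart_assoc, cutSum_add] at key IH ⊢
      rw [IH, key]
    · simp only [cutSum_inr, List.map_cons, Graft.assoc_inr, leftPart_inr,
        rightPart_inr, leftPart_assoc, cutSum_add] at key IH ⊢
      -- Once the cut for `D` is at the head, `w` occurs at the head only, so a later cut for `B`
      -- loses it and contributes zero.
      rw [IH, ← key, cutSum_eq_zero_of_notMem_right (notMem_leftPart l), zero_add, add_assoc]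
      exact fun x y k => hB _ _ _ _ (by simpa using k)

end Sequential

/-! ### Parallel coassociativity of cuts -/

section Parallel

variable {A B D : Type} {v w : A} {M : Type*} [AddCommGroup M]

theorem leftPart_leftPart_swap (h : v ≠ w) (l : List (Graft (Graft A v B) (Sum.inl ⟨w, h.symm⟩) D)) :
    leftPart (leftPart (l.map (Graft.swap h B D))) = leftPart (leftPart l) := by
  induction l with
  | nil => rfl
  | cons s l ih => rcases s with ⟨a | b, k⟩ | d <;> simp [ih]

theorem rightPart_leftPart_swap (h : v ≠ w)
    (l : List (Graft (Graft A v B) (Sum.inl ⟨w, h.symm⟩) D)) :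
    rightPart (leftPart (l.map (Graft.swap h B D))) = rightPart l := by
  induction l with
  | nil => rfl
  | cons s l ih => rcases s with ⟨a | b, k⟩ | d <;> simp [ih]

theorem rightPart_swap (h : v ≠ w) (l : List (Graft (Graft A v B) (Sum.inl ⟨w, h.symm⟩) D)) :
    rightPart (l.map (Graft.swap h B D)) = rightPart (leftPart l) := by
  induction l with
  | nil => rfl
  | cons s l ih => rcases s with ⟨a | b, k⟩ | d <;> simp [ih]

/-- By `hz` an entry of `D` before the cut recurs after it, so it is a caesura, as is the `w`
replacing it. The cut itself gives the last `w`, which is no caesura, while its original is counted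
on the right. -/
theorem caesuras_cut_swap (h : v ≠ w) {l : List (Graft (Graft A v B) (Sum.inl ⟨w, h.symm⟩) D)}
    {c : ℕ} (hc : IsRightAt l c) (hz : ∀ d, d ∈ cutRight l c) :
    caesuras (leftPart (l.map (Graft.swap h B D))) =
      caesuras (leftPart (cutLeft l c)) + caesuras (cutRight l c) := by
  classical
  induction l generalizing c with
  | nil => simp [IsRightAt] at hc
  | cons s l ih =>
    rcases c with - | c
    · obtain ⟨d, rfl⟩ := isRightAt_cons_zero_iff.1 hc
      have hw : w ∉ leftPart (leftPart l) := by simp [mem_leftPart]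
      rw [caesuras_parts, leftPart_leftPart_swap, rightPart_leftPart_swap, cutLeft_inr_zero,
        cutRight_zero, leftPart_inr, leftPart_inl, caesuras_cons w, if_neg hw, add_zero]
    · have hc' := isRightAt_cons_succ.1 hc
      rw [cutRight_cons_succ] at hz ⊢
      have IH := ih hc' hz
      rcases s with ⟨a | b, k⟩ | d
      · have ha : a.1 ≠ w := fun e => k (congrArg Sum.inl (Subtype.ext e))
        have h1 : a.1 ∈ leftPart (cutLeft l c) ↔ a.1 ∈ leftPart (leftPart l) := by
          simp [mem_leftPart, mem_cutLeft hc', ha, Subtype.ext_iff]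
        have h2 : Sum.inl ⟨a.1, ha⟩ ∈ leftPart (l.map (Graft.swap h B D)) ↔
            a.1 ∈ leftPart (leftPart l) := by
          rw [← leftPart_leftPart_swap h, mem_leftPart (l := leftPart (l.map _))]
          simp [ha]
        simp only [List.map_cons, Graft.swap_inl_inl, leftPart_inl, cutLeft_inl_succ,
          caesuras_cons, h1, h2, IH]
        omega
      · simpa [cutLeft_inl_succ] using IH
      · have h1 : w ∈ leftPart (cutLeft l c) :=
          mem_leftPart.2 ⟨h.symm, (mem_cutLeft hc').2 (Or.inl rfl)⟩
        have h2 : Sum.inr d ∈ leftPart (l.map (Graft.swap h B D)) := by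
          rw [← mem_rightPart, rightPart_leftPart_swap]
          exact mem_rightPart_of_mem_cutRight (hz d)
        simp only [List.map_cons, Graft.swap_inr, leftPart_inl, cutLeft_inr_succ,
          caesuras_cons, if_pos h1, if_pos h2, IH]
        omega

/-- The caesuras are sorted in the order `A`, `B`, `D` on one side and `A`, `D`, `B` on the other;
the two differ by the exchange of all caesuras in `B` with all those in `D`. -/
theorem cutSign_swap (h : v ≠ w) (l : List (Graft (Graft A v B) (Sum.inl ⟨w, h.symm⟩) D)) :
    cutSign l 0 * cutSign (leftPart l) 0 =
      cutSign (l.map (Graft.swap h B D)) 0 * cutSign (leftPart (l.map (Graft.swap h B D))) 0 *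
        (-1) ^ (caesuras (rightPart (leftPart l)) * caesuras (rightPart l)) := by
  classical
  induction l with
  | nil => simp [cutSign_nil_zero, caesuras_nil]
  | cons s l ih =>
    rcases s with ⟨a | b, k⟩ | d
    · simpa [cutSign_inl_zero] using ih
    · simp only [cutSign_inl_zero, leftPart_inl, List.map_cons, Graft.swap_inl_inr, leftPart_inr,
        rightPart_inl, rightPart_inr, cutSign_inr_zero, rightPart_swap, caesuras_cons,
        caesuras_parts (leftPart (l.map (Graft.swap h B D))), leftPart_leftPart_swap,
        rightPart_leftPart_swap]
      split_ifs
      · rw [add_mul, one_mul, pow_add, pow_add]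
        linear_combination (-1) ^ caesuras (leftPart (leftPart l)) * ih -
          (-1) ^ caesuras (leftPart (leftPart l)) * cutSign (l.map (Graft.swap h B D)) 0 *
          cutSign (leftPart (l.map (Graft.swap h B D))) 0 *
          (-1) ^ (caesuras (rightPart (leftPart l)) * caesuras (rightPart l)) *
            neg_one_pow_mul_self (caesuras (rightPart l))
      · simpa using ih
    · simp only [cutSign_inl_zero, leftPart_inl, List.map_cons, Graft.swap_inr, leftPart_inr,
        rightPart_inr, cutSign_inr_zero, caesuras_cons,
        caesuras_parts (leftPart l), leftPart_leftPart_swap, rightPart_leftPart_swap]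
      split_ifs
      · rw [mul_add, mul_one, pow_add, pow_add]
        linear_combination (-1) ^ caesuras (leftPart (leftPart l)) *
          (-1) ^ caesuras (rightPart (leftPart l)) * ih
      · simpa using ih

/-- This is the part in which the cut for `B` has been made before all entries of `l` and only the
cut for `D` is left to choose. -/
theorem cutSum_unshuffle_swap (h : v ≠ w)
    (l : List (Graft (Graft A v B) (Sum.inl ⟨w, h.symm⟩) D))
    {F : List A → List B → List D → M} (hF : ∀ x y z d, d ∉ z → F x y z = 0) :
    cutSum l (fun y z => cutSign y 0 • F (leftPart y) (rightPart y) z) =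
      cutSign (l.map (Graft.swap h B D)) 0 • cutSum (leftPart (l.map (Graft.swap h B D)))
        (fun x z => (-1 : ℤ) ^ (caesuras (rightPart (leftPart l)) * caesuras z) •
          F x (rightPart (leftPart l)) z) := by
  classical
  induction l generalizing F with
  | nil => simp
  | cons s l ih =>
    rcases s with ⟨a | b, k⟩ | d
    · simp only [cutSum_inl, cutSign_inl_zero, leftPart_inl, rightPart_inl, List.map_cons,
        Graft.swap_inl_inl]
      exact ih fun x => hF _
    · simp only [cutSum_inl, leftPart_inl, rightPart_inr, leftPart_inr,
        List.map_cons, Graft.swap_inl_inr]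
      by_cases hb : b ∈ rightPart (leftPart l)
      · have hb' : b ∈ rightPart (l.map (Graft.swap h B D)) := by rwa [rightPart_swap]
        have IH := ih (F := fun x y z => (-1 : ℤ) ^ caesuras z • F x (b :: y) z)
          (fun x y z d hd => by simp [hF _ _ _ d hd])
        rw [cutSign_inr_zero, if_pos hb', mul_smul, caesuras_cons, if_pos hb]
        simp only [add_mul, one_mul, pow_add, mul_smul]
        rw [← IH, ← cutSum_smul]
        refine cutSum_congr fun c hc => ?_
        by_cases hz : ∀ d, d ∈ cutRight l c
        · have hb2 : b ∈ rightPart (cutLeft l c) := by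
            rw [mem_rightPart, mem_cutLeft hc]
            exact Or.inr (mem_rightPart.1 hb)
          rw [cutSign_inr_zero, if_pos hb2, caesuras_cut_swap h hc hz, smul_smul, smul_smul,
            pow_add]
          congr 1
          linear_combination -(-1) ^ caesuras (leftPart (cutLeft l c)) * cutSign (cutLeft l c) 0 *
            neg_one_pow_mul_self (caesuras (cutRight l c))
        · push Not at hz
          obtain ⟨d, hd⟩ := hz
          simp [hF _ _ _ d hd]
      · have hb' : b ∉ rightPart (l.map (Graft.swap h B D)) := by rwa [rightPart_swap]
        rw [cutSign_inr_zero, if_neg hb', one_mul, caesuras_cons, if_neg hb, add_zero,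
          ← ih (F := fun x y z => F x (b :: y) z) (fun x y => hF _ _)]
        refine cutSum_congr fun c hc => ?_
        have hb2 : b ∉ rightPart (cutLeft l c) := by
          rw [mem_rightPart, mem_cutLeft hc]
          simpa [mem_rightPart] using hb
        rw [cutSign_inr_zero, if_neg hb2, one_mul]
    · simp only [cutSum_inr, leftPart_inr, leftPart_inl, rightPart_inl,
        List.map_cons, Graft.swap_inr, rightPart_leftPart_swap, leftPart_leftPart_swap]
      rw [smul_add, smul_smul, smul_smul, smul_smul]
      congr 1
      · simp only [cutSign_inl_zero]
        exact ih (F := fun x y z => F (w :: x) y z) (fun x y => hF _ _)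
      · congr 1
        have := cutSign_swap h (Sum.inr d :: l)
        simp only [List.map_cons, Graft.swap_inr, rightPart_inr, leftPart_inr, leftPart_inl,
          cutSign_inl_zero] at this
        rw [cutSign_inl_zero, this, cutSign_inl_zero, mul_assoc]

/-- Parallel coassociativity. -/
theorem cutSum_swap (h : v ≠ w) (l : List (Graft (Graft A v B) (Sum.inl ⟨w, h.symm⟩) D)) {q t : ℕ}
    {F : List A → List B → List D → M} (hB : ∀ x y z b, b ∉ y → F x y z = 0)
    (hD : ∀ x y z d, d ∉ z → F x y z = 0) (hq : ∀ x y z, caesuras y ≠ q → F x y z = 0)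
    (ht : ∀ x y z, caesuras z ≠ t → F x y z = 0) :
    (-1 : ℤ) ^ (q * t) • cutSum l (fun y z => cutSum y (fun x y' => F x y' z)) =
      cutSum (l.map (Graft.swap h B D)) (fun x y => cutSum x (fun x' z => F x' y z)) := by
  -- Where `F` is not zero the numbers of caesuras are `q` and `t`, so the variable sign of
  -- `cutSum_unshuffle_swap` is the fixed Koszul sign.
  have hqt : ∀ x y z, (-1 : ℤ) ^ (caesuras y * caesuras z) • F x y z =
      (-1 : ℤ) ^ (q * t) • F x y z := fun x y z => by
    by_cases h1 : caesuras y = q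
    · by_cases h2 : caesuras z = t
      · rw [h1, h2]
      · rw [ht _ _ _ h2, smul_zero, smul_zero]
    · rw [hq _ _ _ h1, smul_zero, smul_zero]
  have hs := neg_one_pow_mul_self (q * t)
  induction l generalizing F with
  | nil => simp
  | cons s l ih =>
    have IH := fun a => ih (F := fun x => F (a :: x)) (fun x => hB _) (fun x => hD _)
      (fun x => hq _) (fun x => ht _) (fun x => hqt _)
    rcases s with ⟨a | b, k⟩ | d
    · simpa using IH a.1
    · have key := cutSum_unshuffle_swap h (Sum.inl ⟨Sum.inr b, k⟩ :: l) (F := fun x => F (v :: x))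
        (fun x => hD _)
      simp only [cutSum_inl, cutSum_inr, List.map_cons, Graft.swap_inl_inr, leftPart_inr,
        leftPart_inl, rightPart_inr, cutSum_add, hqt, cutSum_smul, rightPart_swap] at key IH ⊢
      rw [smul_add, IH, key, smul_comm, smul_smul, smul_smul, mul_assoc, hs, mul_one]
    -- Here the head lies in `D`: the same lemma is applied to the swapped sequence, with `B` and
    -- `D` exchanging their roles.
    · have key := cutSum_unshuffle_swap h.symm (Sum.inl ⟨Sum.inr d, Sum.inr_ne_inl⟩ ::
        l.map (Graft.swap h B D)) (F := fun x y z => F (w :: x) z y) (fun x y z => hB _ _ _)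
      have hl : (l.map (Graft.swap h B D)).map (Graft.swap h.symm D B) = l := by
        simp [List.map_map, Function.comp_def, Graft.swap_swap]
      simp only [mul_comm (caesuras (rightPart _))] at key
      simp only [cutSum_inl, cutSum_inr, List.map_cons, Graft.swap_inl_inr, Graft.swap_inr, hl,
        leftPart_inr, leftPart_inl, rightPart_inr, cutSum_add, hqt, cutSum_smul,
        rightPart_leftPart_swap] at key IH ⊢
      rw [smul_add, IH, key, smul_comm]

end Parallel

end Sequence

namespace Sequence

/-! ### Equivariance under renaming -/

section Renaming

variable {A A' : Type}

theorem isCaesura_map (e : A ≃ A') (l : List A) (i : ℕ) :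
    IsCaesura (l.map e) i ↔ IsCaesura l i := by
  simp [IsCaesura, (Option.map_injective e.injective).eq_iff]

open Classical in
theorem sign_map (e : A ≃ A') (l : List A) (i : ℕ) : sign (l.map e) i = sign l i := by
  simp only [sign, caesuraSign, isCaesura_map, List.getElem?_map,
    (Option.map_injective e.injective).eq_iff]

theorem nondegenerate_map (e : A ≃ A') {l : List A} :
    Nondegenerate (l.map e) ↔ Nondegenerate l := by
  unfold Nondegenerate
  rw [List.isChain_map, e.surjective.forall]
  simp [e.injective.ne_iff, List.mem_map_of_injective e.injective]

variable {M : Type*} [AddCommGroup M]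

theorem delSum_map (e : A ≃ A') (l : List A) (F : List A' → M) :
    delSum (l.map e) F = delSum l (fun x => F (x.map e)) := by
  simp [delSum, sign_map, List.eraseIdx_map]

theorem caesuras_map (e : A ≃ A') (l : List A) : caesuras (l.map e) = caesuras l := by
  induction l with
  | nil => rfl
  | cons a l ih =>
    have h := List.mem_map_of_injective e.injective (a := a) (l := l)
    by_cases k : a ∈ l <;> simp only [List.map_cons, caesuras_cons, ih, h, k, if_true, if_false]

variable {v : A} {B B' : Type}

@[simp] theorem _root_.Graft.congr_inl (e : A ≃ A') (f : B ≃ B') (a : {a : A // a ≠ v}) :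
    Graft.congr e f v (Sum.inl a) = Sum.inl ⟨e a.1, fun h => a.2 (e.injective h)⟩ := rfl

@[simp] theorem _root_.Graft.congr_inr (e : A ≃ A') (f : B ≃ B') (b : B) :
    Graft.congr e f v (Sum.inr b) = Sum.inr (f b) := rfl

theorem leftPart_map (e : A ≃ A') (f : B ≃ B') (l : List (Graft A v B)) :
    leftPart (l.map (Graft.congr e f v)) = (leftPart l).map e := by
  induction l with
  | nil => rfl
  | cons s l ih => rcases s with a | b <;> simp [ih]

theorem rightPart_map (e : A ≃ A') (f : B ≃ B') (l : List (Graft A v B)) :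
    rightPart (l.map (Graft.congr e f v)) = (rightPart l).map f := by
  induction l with
  | nil => rfl
  | cons s l ih => rcases s with a | b <;> simp [ih]

theorem cutSign_map (e : A ≃ A') (f : B ≃ B') (l : List (Graft A v B)) :
    cutSign (l.map (Graft.congr e f v)) 0 = cutSign l 0 := by
  induction l with
  | nil => rfl
  | cons s l ih =>
    rcases s with a | b
    · simp [cutSign_inl_zero, ih]
    · have h := List.mem_map_of_injective f.injective (a := b) (l := rightPart l)
      by_cases k : b ∈ rightPart l <;>
        simp only [List.map_cons, Graft.congr_inr, cutSign_inr_zero, ih, rightPart_map,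
          leftPart_map, caesuras_map, h, k, if_true, if_false]

theorem cutSum_map (e : A ≃ A') (f : B ≃ B') (l : List (Graft A v B))
    (F : List A' → List B' → M) :
    cutSum (l.map (Graft.congr e f v)) F = cutSum l (fun x y => F (x.map e) (y.map f)) := by
  induction l generalizing F with
  | nil => simp
  | cons s l ih =>
    rcases s with a | b
    · simp [ih]
    · have := cutSign_map e f (Sum.inr b :: l)
      simp only [List.map_cons, Graft.congr_inr] at this
      simp [ih, rightPart_map, leftPart_map, this]

end Renaming

/-! ### Sequences without caesuras and cardinalities -/

section Signs

variable {A : Type} {v : A} {B : Type}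

theorem cutSign_zero_of_leftPart {l : List (Graft A v B)} (h : caesuras (leftPart l) = 0) :
    cutSign l 0 = 1 := by
  induction l with
  | nil => exact cutSign_nil_zero
  | cons s l ih =>
    rcases s with a | b
    · rw [cutSign_inl_zero]
      refine ih ?_
      rw [leftPart_inl, caesuras_cons] at h
      omega
    · rw [leftPart_inr] at h
      rw [cutSign_inr_zero, ih h, h]
      simp

theorem cutSign_zero_of_rightPart {l : List (Graft A v B)} (h : caesuras (rightPart l) = 0) :
    cutSign l 0 = 1 := by
  induction l with
  | nil => exact cutSign_nil_zero
  | cons s l ih =>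
    rcases s with a | b
    · rw [cutSign_inl_zero]
      exact ih h
    · rw [rightPart_inr, caesuras_cons] at h
      rw [cutSign_inr_zero, ih (by omega), if_neg (fun k => by rw [if_pos k] at h; omega), one_mul]

theorem isChain_of_caesuras_eq_zero {l : List A} (h : caesuras l = 0) : l.IsChain (· ≠ ·) := by
  refine List.Pairwise.isChain ?_
  induction l with
  | nil => simp
  | cons a l ih =>
    rw [caesuras_cons] at h
    split_ifs at h with k
    rw [List.pairwise_cons]
    exact ⟨fun b hb e => k (e ▸ hb), ih (by omega)⟩

theorem nondegenerate_of_length [Finite A] {l : List A} (h : ∀ a, a ∈ l)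
    (hl : l.length = Nat.card A) : Nondegenerate l := by
  have := caesuras_add_natCard h
  exact ⟨h, isChain_of_caesuras_eq_zero (by omega)⟩

theorem Nondegenerate.natCard_le [Finite A] {l : List A} (h : Nondegenerate l) :
    Nat.card A ≤ l.length := by
  have := caesuras_add_natCard h.1
  omega

theorem Nondegenerate.eq_of_subsingleton [Subsingleton A] [Nonempty A] {l : List A}
    (h : Nondegenerate l) (a : A) : l = [a] := by
  rcases l with - | ⟨b, - | ⟨c, l⟩⟩
  · simpa using h.1 a
  · rw [Subsingleton.elim a b]
  · exact absurd (Subsingleton.elim b c) (List.isChain_cons_cons.1 h.2).1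

theorem natCard_graft [Finite A] [Finite B] (v : A) :
    Nat.card (Graft A v B) + 1 = Nat.card A + Nat.card B := by
  have e : Option {a : A // a ≠ v} ≃ A := by classical exact Equiv.optionSubtypeNe v
  have h := Nat.card_congr e
  rw [Finite.card_option] at h
  rw [Nat.card_sum]
  omega

end Signs

/-! ### Counits and augmentation on sequences -/

section Counits

variable {A : Type} {v : A} {B : Type} {M : Type*} [AddCommGroup M]

theorem leftPart_eq_collapse {l : List (Graft A v B)} (h : rightPart l = []) :
    leftPart l = collapse l := by
  induction l with
  | nil => rfl
  | cons s l ih =>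
    rcases s with a | b
    · rw [leftPart_inl, ih h]; rfl
    · simp at h

open Classical in
-- The right factor has one entry only for the cut at the last occurrence of the new element, and
-- then the left factor is the whole sequence renamed.
theorem cutSum_counit_right (l : List (Graft A v Unit)) (F : List A → M) :
    cutSum l (fun x y => if y = [()] then F x else 0) =
      if Sum.inr () ∈ l then F (collapse l) else 0 := by
  induction l generalizing F with
  | nil => simp
  | cons s l ih =>
    rcases s with a | b
    · rw [cutSum_inl, ih fun x => F (a.1 :: x)]
      simp [collapse]
    · rw [cutSum_inr, ih fun x => F (v :: x), if_pos (by simp : Sum.inr () ∈ Sum.inr b :: l)]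
      by_cases h : Sum.inr () ∈ l
      · have h' : rightPart l ≠ [] := List.ne_nil_of_mem (mem_rightPart.2 h)
        rw [if_pos h, if_neg (by simp [h']), smul_zero, add_zero]
        rfl
      · have h' : rightPart l = [] := List.eq_nil_iff_forall_not_mem.2 fun x hx =>
          h (mem_rightPart.1 hx)
        rw [if_neg h, if_pos (by simp [h']), zero_add, cutSign_zero_of_rightPart, one_smul,
          leftPart_eq_collapse h']
        · rfl
        · simp [h', caesuras_cons, caesuras_nil]

theorem leftPart_unit (l : List (Graft Unit () B)) : leftPart l = [] := by
  induction l with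
  | nil => rfl
  | cons s l ih =>
    rcases s with a | b
    · exact absurd rfl a.2
    · exact ih

theorem rightPart_unit (l : List (Graft Unit () B)) :
    rightPart l = l.map (Graft.leftUnit B) := by
  induction l with
  | nil => rfl
  | cons s l ih =>
    rcases s with a | b
    · exact absurd rfl a.2
    · rw [rightPart_inr, ih]; rfl

open Classical in
-- All entries lie in `B`, so the left factor repeats the point once for each entry up to the cut;
-- only the cut at the head leaves a single one.
theorem cutSum_counit_left {l : List (Graft Unit () B)} (hl : l ≠ []) (F : List B → M) :
    cutSum l (fun x y => if x = [()] then F y else 0) = F (l.map (Graft.leftUnit B)) := by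
  rcases l with - | ⟨a | b, l⟩
  · exact absurd rfl hl
  · exact absurd rfl a.2
  · rw [cutSum_inr, cutSum_congr (G := fun _ _ => 0), cutSum_zero, if_pos (by simp [leftPart_unit]),
      zero_add, cutSign_zero_of_leftPart, one_smul, rightPart_unit]
    · rfl
    · simp [leftPart_unit, caesuras_nil]
    · intro c hc
      have h : () ∈ cutLeft l c := (mem_cutLeft hc).2 (Or.inl rfl)
      rw [if_neg]
      simp [List.ne_nil_of_mem h]

open Classical in
-- Each element of `B` occurs once, so the right factor contains all of them only if the cut is at
-- the first entry in `B`.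
theorem cutSum_augmentation [Nonempty B] {l : List (Graft A v B)} (hl : ∀ b, Sum.inr b ∈ l)
    (hc : caesuras l = 0) (g : M) :
    cutSum l (fun _ y => if ∀ b, b ∈ y then g else 0) = g := by
  induction l with
  | nil => simpa using hl (Classical.arbitrary B)
  | cons s l ih =>
    rw [caesuras_cons] at hc
    rcases s with a | b
    · rw [cutSum_inl]
      exact ih (by simpa using hl) (by omega)
    · have hb : Sum.inr b ∉ l := fun h => by rw [if_pos h] at hc; omega
      have hc' : caesuras (Sum.inr b :: l) = 0 := by rw [caesuras_cons]; exact hc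
      rw [cutSum_inr, cutSum_congr (G := fun _ _ => 0), cutSum_zero, zero_add,
        cutSign_zero_of_leftPart (by rw [caesuras_parts] at hc'; omega), one_smul, if_pos]
      · intro b'
        simpa [mem_rightPart] using hl b'
      · intro c _
        rw [if_neg]
        exact fun h => hb (mem_rightPart.1 (mem_rightPart_of_mem_cutRight (h b)))

open Classical in
-- One element occurs twice and the others once. Only deleting one of the two occurrences loses no
-- element; the first has sign `+` as the only caesura, the second the opposite sign.
theorem delSum_augmentation {l : List A} (hl : caesuras l = 1) (g : M) :
    delSum l (fun x => if ∀ a ∈ l, a ∈ x then g else 0) = 0 := by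
  induction l with
  | nil => simp [delSum]
  | cons a l ih =>
    rw [delSum, List.length_cons, Finset.sum_range_succ']
    rw [caesuras_cons] at hl
    by_cases ha : a ∈ l
    · rw [if_pos ha] at hl
      have hl0 : caesuras l = 0 := by omega
      have hnd : l.Nodup := by
        have := caesuras_add_card l
        rw [hl0, zero_add] at this
        exact Multiset.toFinset_card_eq_card_iff_nodup.1 this
      obtain ⟨k, hk, e⟩ := List.mem_iff_getElem.1 ha
      rw [Finset.sum_eq_single k]
      · have h1 : a ∉ l.eraseIdx k := by
          rw [← e]
          exact fun h => by
            obtain ⟨j, hj, h2⟩ := List.mem_eraseIdx_iff_getElem.1 h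
            grind [List.Nodup.getElem_inj_iff]
        have hka : l[k]? = some a := by simp [hk, e]
        rw [sign_cons_succ, if_neg ((isCaesura_or_hasPrevious_iff hka).not.2 h1), if_pos hka,
          sign_cons_zero, if_pos ha, if_pos, if_pos]
        · simp
        · simpa using ha
        · intro x hx
          by_cases hxa : x = a
          · simp [hxa]
          · have : x ∈ l := by simpa [hxa] using hx
            simp [mem_eraseIdx_of_ne hka hxa, this]
      · intro i hi hik
        rw [if_neg, smul_zero]
        have hi' : i < l.length := by simpa using hi
        intro h
        have h1 := h l[i] (by simp)
        rw [List.eraseIdx_cons_succ, List.mem_cons] at h1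
        rcases h1 with h1 | h1
        · grind [List.Nodup.getElem_inj_iff]
        · obtain ⟨j, hj, h2⟩ := List.mem_eraseIdx_iff_getElem.1 h1
          grind [List.Nodup.getElem_inj_iff]
      · simp [hk]
    · rw [if_neg ha, add_zero] at hl
      rw [sign_cons_zero, if_neg ha, zero_smul, add_zero]
      refine Eq.trans (Finset.sum_congr rfl fun i hi => ?_) (ih hl)
      have hi' : i < l.length := by simpa using hi
      have hiff : (∀ x ∈ a :: l, x ∈ (a :: l).eraseIdx (i + 1)) ↔ ∀ x ∈ l, x ∈ l.eraseIdx i := by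
        rw [List.eraseIdx_cons_succ]
        constructor
        · intro h x hx
          rcases List.mem_cons.1 (h x (by simp [hx])) with rfl | k
          · exact absurd hx ha
          · exact k
        · intro h x hx
          rcases List.mem_cons.1 hx with rfl | k
          · simp
          · simp [h x k]
      simp only [hiff]
      by_cases h : ∀ x ∈ l, x ∈ l.eraseIdx i
      · rw [sign_cons_succ, if_pos ((isCaesura_or_hasPrevious_iff
          (List.getElem?_eq_getElem hi')).2 (h _ (by simp))), if_neg ha, one_mul]
      · rw [if_neg h, smul_zero, smul_zero]

end Counits

end Sequence

/-! ### The cooperad axioms for the surjections cooperad -/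

namespace Surj

open Sequence

variable {R : Type u} [CommRing R]

section OfList

variable {A : Type}

theorem ofList_of_not_nondegenerate {n : ℤ} {l : List A} (h : ¬ Nondegenerate l) :
    ofList R n l = 0 := dif_neg fun k => h k.1

theorem ofList_of_length {n : ℤ} {l : List A} (h : (l.length : ℤ) ≠ Nat.card A + n) :
    ofList R n l = 0 := dif_neg fun k => h k.2

theorem ofList_of_notMem {n : ℤ} {l : List A} {a : A} (h : a ∉ l) :
    ofList R n l = 0 := ofList_of_not_nondegenerate fun k => h (k.1 a)

theorem ofList_basis {n : ℤ} (u : Basis A n) : ofList R n u.1 = Finsupp.single u 1 :=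
  dif_pos u.2

theorem ofList_of_neg [Finite A] {n : ℤ} (hn : n < 0) (l : List A) : ofList R n l = 0 := by
  by_cases h : Nondegenerate l
  · have := h.natCard_le
    exact ofList_of_length (by omega)
  · exact ofList_of_not_nondegenerate h

theorem ofList_of_caesuras [Finite A] {n : ℕ} {l : List A} (h : caesuras l ≠ n) :
    ofList R (n : ℤ) l = 0 := by
  by_cases hl : ∀ a, a ∈ l
  · have := caesuras_add_natCard hl
    exact ofList_of_length (by omega)
  · push Not at hl
    obtain ⟨a, ha⟩ := hl
    exact ofList_of_notMem ha

theorem hom_ext {n : ℤ} {M : Type*} [AddCommMonoid M] [Module R M] {f g : Obj R A n →ₗ[R] M}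
    (h : ∀ l, Nondegenerate l → (l.length : ℤ) = Nat.card A + n →
      f (ofList R n l) = g (ofList R n l)) : f = g := by
  refine Finsupp.lhom_ext' fun u => LinearMap.ext_ring ?_
  have := h u.1 u.2.1 u.2.2
  rwa [ofList_basis] at this

theorem linearCombination_ofList {n : ℤ} {M : Type*} [AddCommGroup M] [Module R M]
    (F : List A → M) {l : List A} (h1 : Nondegenerate l)
    (h2 : (l.length : ℤ) = Nat.card A + n) :
    Finsupp.linearCombination R (fun u : Basis A n => F u.1) (ofList R n l) = F l := by
  rw [ofList_basis ⟨l, h1, h2⟩, Finsupp.linearCombination_single, one_smul]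

/-- The formula holds for all lists, including degenerate ones and those of the wrong length, so it
can be applied inside sums over deletions and cuts. -/
theorem d_ofList {n m : ℤ} (h : m + 1 = n) (l : List A) :
    d R A n m (ofList R n l) = delSum l (ofList R m) := by
  by_cases h1 : Nondegenerate l
  · by_cases h2 : (l.length : ℤ) = Nat.card A + n
    · exact linearCombination_ofList (fun l => delSum l (ofList R m)) h1 h2
    · rw [ofList_of_length h2, map_zero, delSum, Finset.sum_eq_zero]
      intro i hi
      have hi' : i < l.length := by simpa using hi
      rw [ofList_of_length, smul_zero]
      rw [List.length_eraseIdx_of_lt hi']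
      omega
  · rw [ofList_of_not_nondegenerate h1, map_zero,
      delSum_eq_zero_of_not_nondegenerate h1 fun x => ofList_of_not_nondegenerate]

theorem d_of_ne {n m : ℤ} (h : m + 1 ≠ n) : d R A n m = 0 := by
  refine hom_ext fun l h1 h2 => ?_
  rw [LinearMap.zero_apply]
  refine (linearCombination_ofList (fun l => delSum l (ofList R m)) h1 h2).trans ?_
  refine Finset.sum_eq_zero fun i hi => ?_
  have hi' : i < l.length := by simpa using hi
  rw [ofList_of_length, smul_zero]
  rw [List.length_eraseIdx_of_lt hi']
  omega

theorem map_ofList {B : Type} (e : A ≃ B) (n : ℤ) (l : List A) :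
    map R e n (ofList R n l) = ofList R n (l.map e) := by
  by_cases h1 : Nondegenerate l
  · by_cases h2 : (l.length : ℤ) = Nat.card A + n
    · exact linearCombination_ofList (fun l => ofList R n (l.map e)) h1 h2
    · rw [ofList_of_length h2, map_zero, ofList_of_length]
      rwa [List.length_map, ← Nat.card_congr e]
  · rw [ofList_of_not_nondegenerate h1, map_zero,
      ofList_of_not_nondegenerate ((nondegenerate_map e).not.2 h1)]

theorem d_comp_d (n m k : ℤ) [Nonempty A] : d R A m k ∘ₗ d R A n m = 0 := by
  by_cases h1 : m + 1 = n
  · by_cases h2 : k + 1 = m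
    · refine hom_ext fun l _ _ => ?_
      obtain ⟨lt, hlt, -⟩ := exists_isTournament (Classical.arbitrary A)
      rw [LinearMap.comp_apply, d_ofList h1, map_delSum, LinearMap.zero_apply]
      simp only [d_ofList h2]
      have e : ∀ x : List A, delSum x (ofList R k) =
          orient lt x • altSum x (fun y => orient lt y • ofList R k y) :=
        fun x => delSum_eq_altSum hlt fun y a => ofList_of_notMem
      rw [delSum_eq_altSum hlt]
      -- The orientations of the intermediate sequences cancel and `altSum` squares to zero.
      · simp only [e, smul_smul, orient_mul_self, one_smul]
        rw [altSum_altSum, smul_zero]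
      · intro x a ha
        exact delSum_eq_zero_of_notMem ha fun y => ofList_of_notMem
    · rw [d_of_ne h2, LinearMap.zero_comp]
  · rw [d_of_ne h1, LinearMap.comp_zero]

theorem map_comp_d {B : Type} (e : A ≃ B) (n m : ℤ) :
    map R e m ∘ₗ d R A n m = d R B n m ∘ₗ map R e n := by
  by_cases h1 : m + 1 = n
  · refine hom_ext fun l _ _ => ?_
    rw [LinearMap.comp_apply, LinearMap.comp_apply, d_ofList h1, map_ofList, d_ofList h1,
      delSum_map, map_delSum]
    simp only [map_ofList]
  · rw [d_of_ne h1, d_of_ne h1, LinearMap.zero_comp, LinearMap.comp_zero]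

end OfList

section Tensor

variable {A : Type} {v : A} {B : Type} {M N : Type*} [AddCommGroup M] [AddCommGroup N] [Module R M]
  [Module R N]

theorem cutSum_tmul  (l : List (Graft A v B)) (F : List A → List B → M) (z : N) :
    cutSum l F ⊗ₜ[R] z = cutSum l (fun x y => F x y ⊗ₜ[R] z) :=
  map_cutSum ((TensorProduct.mk R M N).flip z) l F

theorem tmul_cutSum  (l : List (Graft A v B)) (F : List A → List B → M) (z : N) :
    z ⊗ₜ[R] cutSum l F = cutSum l (fun x y => z ⊗ₜ[R] F x y) :=
  map_cutSum (TensorProduct.mk R N M z) l F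

theorem delSum_tmul  (l : List A) (F : List A → M) (z : N) :
    delSum l F ⊗ₜ[R] z = delSum l (fun x => F x ⊗ₜ[R] z) :=
  map_delSum ((TensorProduct.mk R M N).flip z) l F

theorem tmul_delSum  (l : List A) (F : List A → M) (z : N) :
    z ⊗ₜ[R] delSum l F = delSum l (fun x => z ⊗ₜ[R] F x) :=
  map_delSum (TensorProduct.mk R N M z) l F

end Tensor

section Cocomp

variable {A : Type} [Finite A] {v : A} {B : Type} [Finite B]

theorem cutSum_of_length {p q : ℤ} {l : List (Graft A v B)}
    (h : (l.length : ℤ) ≠ Nat.card (Graft A v B) + (p + q)) :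
    cutSum l (fun x y => ofList R p x ⊗ₜ[R] ofList R q y) = 0 := by
  rw [cutSum_congr (G := fun _ _ => 0), cutSum_zero]
  intro c hc
  have h1 := length_cut hc
  have h2 := natCard_graft (B := B) v
  by_cases hx : ((cutLeft l c).length : ℤ) = Nat.card A + p
  · rw [ofList_of_length (l := cutRight l c), TensorProduct.tmul_zero]
    omega
  · rw [ofList_of_length hx, TensorProduct.zero_tmul]

theorem cocomp_ofList {n p q : ℤ} (h : p + q = n) (l : List (Graft A v B)) :
    cocomp R v B n p q (ofList R n l) =
      cutSum l (fun x y => ofList R p x ⊗ₜ[R] ofList R q y) := by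
  by_cases h1 : Nondegenerate l
  · by_cases h2 : (l.length : ℤ) = Nat.card (Graft A v B) + n
    · exact linearCombination_ofList
        (fun l => cutSum l (fun x y => ofList R p x ⊗ₜ[R] ofList R q y)) h1 h2
    · rw [ofList_of_length h2, map_zero, cutSum_of_length (by rwa [h])]
  · rw [ofList_of_not_nondegenerate h1, map_zero, cutSum_eq_zero_of_not_nondegenerate h1]
    · intro x y hx
      rw [ofList_of_not_nondegenerate hx, TensorProduct.zero_tmul]
    · intro x y hy
      rw [ofList_of_not_nondegenerate hy, TensorProduct.tmul_zero]

theorem cocomp_of_ne {n p q : ℤ} (h : p + q ≠ n) : cocomp R v B n p q = 0 := by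
  refine hom_ext fun l h1 h2 => ?_
  rw [LinearMap.zero_apply]
  refine (linearCombination_ofList
        (fun l => cutSum l (fun x y => ofList R p x ⊗ₜ[R] ofList R q y)) h1 h2).trans ?_
  exact cutSum_of_length (by omega)

theorem cocomp_of_neg {n p q : ℤ} (h : p < 0 ∨ q < 0) : cocomp R v B n p q = 0 := by
  refine hom_ext fun l h1 h2 => ?_
  rw [LinearMap.zero_apply]
  refine (linearCombination_ofList
        (fun l => cutSum l (fun x y => ofList R p x ⊗ₜ[R] ofList R q y)) h1 h2).trans ?_
  rcases h with h | h
  · simp [ofList_of_neg h, cutSum_zero]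
  · simp [ofList_of_neg h, cutSum_zero]

theorem cocomp_finite (n : ℤ) (x : Obj R (Graft A v B) n) :
    {pq : ℤ × ℤ | cocomp R v B n pq.1 pq.2 x ≠ 0}.Finite := by
  refine ((Set.finite_Icc 0 n).prod (Set.finite_Icc 0 n)).subset ?_
  rintro ⟨p, q⟩ h
  by_contra k
  refine h ?_
  by_cases h1 : p + q = n
  · have : p < 0 ∨ q < 0 := by
      simp only [Set.mem_prod, Set.mem_Icc] at k
      omega
    simp [cocomp_of_neg this]
  · simp [cocomp_of_ne h1]

theorem cocomp_d [Nonempty B] (n p q : ℤ) :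
    cocomp R v B n p q ∘ₗ d R (Graft A v B) (n + 1) n =
      (d R A (p + 1) p).rTensor (Obj R B q) ∘ₗ cocomp R v B (n + 1) (p + 1) q +
      p.negOnePow • ((d R B (q + 1) q).lTensor (Obj R A p) ∘ₗ
        cocomp R v B (n + 1) p (q + 1)) := by
  by_cases h : p + q = n
  swap
  · rw [cocomp_of_ne h, cocomp_of_ne (by omega), cocomp_of_ne (by omega)]
    simp
  refine hom_ext fun l h1 _ => ?_
  rw [LinearMap.comp_apply, d_ofList rfl, map_delSum, LinearMap.add_apply, LinearMap.comp_apply,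
    cocomp_ofList (by omega), map_cutSum, Units.smul_def, LinearMap.smul_apply,
    LinearMap.comp_apply, cocomp_ofList (by omega), map_cutSum]
  simp only [cocomp_ofList h, LinearMap.rTensor_tmul, LinearMap.lTensor_tmul, d_ofList rfl,
    delSum_tmul, tmul_delSum]
  -- In negative degrees both sides vanish; otherwise the degrees are natural numbers, as the
  -- statement about lists requires.
  by_cases hp : p < 0
  · simp [ofList_of_neg hp, delSum, cutSum_zero]
  by_cases hq : q < 0
  · simp [ofList_of_neg hq, delSum, cutSum_zero]
  obtain ⟨p, rfl⟩ := Int.eq_ofNat_of_zero_le (not_lt.1 hp)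
  obtain ⟨q, rfl⟩ := Int.eq_ofNat_of_zero_le (not_lt.1 hq)
  rw [Int.coe_negOnePow_natCast]
  refine delSum_cutSum h1.1 ?_ ?_ (q := q) ?_ ?_
  · intro x y a ha
    rw [ofList_of_notMem ha, TensorProduct.zero_tmul]
  · intro x y a ha
    rw [ofList_of_notMem ha, TensorProduct.tmul_zero]
  · intro x y hx
    rw [ofList_of_length (by exact_mod_cast hx), TensorProduct.zero_tmul]
  · intro x y hx
    rw [ofList_of_length (l := y) (by exact_mod_cast hx), TensorProduct.tmul_zero]

theorem cocomp_map {A' B' : Type} [Finite A'] [Finite B'] (e : A ≃ A') (f : B ≃ B')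
    (n p q : ℤ) : cocomp R (e v) B' n p q ∘ₗ map R (Graft.congr e f v) n =
      TensorProduct.map (map R e p) (map R f q) ∘ₗ cocomp R v B n p q := by
  by_cases h : p + q = n
  swap
  · rw [cocomp_of_ne h, cocomp_of_ne h, LinearMap.zero_comp, LinearMap.comp_zero]
  refine hom_ext fun l _ _ => ?_
  rw [LinearMap.comp_apply, LinearMap.comp_apply, map_ofList, cocomp_ofList h, cocomp_ofList h,
    cutSum_map, map_cutSum]
  simp only [TensorProduct.map_tmul, map_ofList]

open Classical in
theorem counit_ofList (l : List Unit) : counit R (ofList R 0 l) = if l = [()] then 1 else 0 := by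
  by_cases h1 : Nondegenerate l
  · have h2 := h1.eq_of_subsingleton ()
    rw [if_pos h2]
    exact linearCombination_ofList (fun _ => 1) h1 (by simp [h2])
  · rw [ofList_of_not_nondegenerate h1, map_zero, if_neg]
    rintro rfl
    exact h1 ⟨by simp, by simp⟩

/-- A one-point set has a single nondegenerate sequence, of length one, so there is nothing in
degree `1`. -/
theorem counit_comp_d : counit R ∘ₗ d R Unit 1 0 = 0 := by
  refine hom_ext fun l h1 h2 => ?_
  rw [h1.eq_of_subsingleton ()] at h2
  simp at h2

theorem counit_right (n : ℤ) :
    (TensorProduct.rid R (Obj R A n)).toLinearMap ∘ₗ (counit R).lTensor (Obj R A n) ∘ₗ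
      cocomp R v Unit n n 0 = map R (Graft.rightUnit v) n := by
  classical
  refine hom_ext fun l h1 _ => ?_
  rw [LinearMap.comp_apply, LinearMap.comp_apply, map_ofList, cocomp_ofList (by omega),
    map_cutSum, map_cutSum]
  simp only [LinearMap.lTensor_tmul, LinearEquiv.coe_coe, TensorProduct.rid_tmul, counit_ofList,
    ite_smul, one_smul, zero_smul]
  rw [cutSum_counit_right, if_pos (h1.1 _)]
  rfl

theorem counit_left [Nonempty B] (n : ℤ) :
    (TensorProduct.lid R (Obj R B n)).toLinearMap ∘ₗ (counit R).rTensor (Obj R B n) ∘ₗ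
      cocomp R () B n 0 n = map R (Graft.leftUnit B) n := by
  classical
  refine hom_ext fun l h1 _ => ?_
  rw [LinearMap.comp_apply, LinearMap.comp_apply, map_ofList, cocomp_ofList (by omega),
    map_cutSum, map_cutSum]
  simp only [LinearMap.rTensor_tmul, LinearEquiv.coe_coe, TensorProduct.lid_tmul, counit_ofList,
    ite_smul, one_smul, zero_smul]
  exact cutSum_counit_left (List.ne_nil_of_mem (h1.1 (Sum.inr (Classical.arbitrary B)))) _

set_option maxSynthPendingDepth 3 in
theorem coassoc_seq {D : Type} [Finite D] (w : B) (n p q t : ℤ) :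
    (TensorProduct.assoc R (Obj R A p) (Obj R B q) (Obj R D t)).toLinearMap ∘ₗ
      (cocomp R v B (p + q) p q).rTensor (Obj R D t) ∘ₗ
      cocomp R (A := Graft A v B) (Sum.inr w) D n (p + q) t =
    (cocomp R w D (q + t) q t).lTensor (Obj R A p) ∘ₗ
      cocomp R v (Graft B w D) n p (q + t) ∘ₗ map R (Graft.assoc v w D) n := by
  by_cases h : p + q + t = n
  swap
  · rw [cocomp_of_ne h, cocomp_of_ne (p := p) (q := q + t) (by omega)]
    simp
  refine hom_ext fun l _ _ => ?_
  simp only [LinearMap.comp_apply, map_ofList]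
  rw [cocomp_ofList h, cocomp_ofList (by omega)]
  simp only [map_cutSum, LinearMap.rTensor_tmul, LinearMap.lTensor_tmul, cocomp_ofList rfl,
    cutSum_tmul, tmul_cutSum, LinearEquiv.coe_coe, TensorProduct.assoc_tmul]
  refine cutSum_assoc l (F := fun x y z => ofList R p x ⊗ₜ[R] (ofList R q y ⊗ₜ[R] ofList R t z))
    ?_ ?_
  · intro x y z b hb
    simp [ofList_of_notMem hb]
  · intro x y z b hb
    simp [ofList_of_notMem hb]

set_option maxSynthPendingDepth 3 in
theorem units_smul_apply {M N P Q : Type u} [AddCommGroup M] [AddCommGroup N] [AddCommGroup P]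
    [AddCommGroup Q] [Module R M] [Module R N] [Module R P] [Module R Q] (a : ℤˣ)
    (f : M →ₗ[R] N ⊗[R] P ⊗[R] Q) (x : M) : (a • f) x = (a : ℤ) • f x := by
  rcases Int.units_eq_one_or a with rfl | rfl <;> simp

set_option maxSynthPendingDepth 3 in
theorem units_smul_zero {M N P Q : Type u} [AddCommGroup M] [AddCommGroup N] [AddCommGroup P]
    [AddCommGroup Q] [Module R M] [Module R N] [Module R P] [Module R Q] (a : ℤˣ) :
    a • (0 : M →ₗ[R] N ⊗[R] P ⊗[R] Q) = 0 :=
  smul_zero a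

set_option maxSynthPendingDepth 3 in
theorem coassoc_par {D : Type} [Finite D] {w : A} (h : v ≠ w) (n p q t : ℤ) :
    (q * t).negOnePow • ((TensorProduct.rightComm R (Obj R A p) (Obj R B q)
        (Obj R D t)).toLinearMap ∘ₗ
      (cocomp R v B (p + q) p q).rTensor (Obj R D t) ∘ₗ
      cocomp R (A := Graft A v B) (Sum.inl ⟨w, h.symm⟩) D n (p + q) t) =
    (cocomp R w D (p + t) p t).rTensor (Obj R B q) ∘ₗ
      cocomp R (A := Graft A w D) (Sum.inl ⟨v, h⟩) B n (p + t) q ∘ₗ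
        map R (Graft.swap h B D) n := by
  by_cases hn : p + q + t = n
  swap
  · rw [cocomp_of_ne hn, cocomp_of_ne (p := p + t) (q := q) (by omega)]
    simp only [LinearMap.comp_zero, LinearMap.zero_comp]
    exact units_smul_zero _
  refine hom_ext fun l _ _ => (units_smul_apply _ _ _).trans ?_
  simp only [LinearMap.comp_apply, map_ofList]
  rw [cocomp_ofList hn, cocomp_ofList (by omega)]
  simp only [map_cutSum, LinearMap.rTensor_tmul, cocomp_ofList rfl,
    cutSum_tmul, LinearEquiv.coe_coe, TensorProduct.rightComm_tmul]
  by_cases hq : q < 0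
  · simp only [ofList_of_neg hq, cutSum_zero, TensorProduct.tmul_zero]
    exact smul_zero _
  by_cases ht : t < 0
  · simp only [ofList_of_neg ht, cutSum_zero, TensorProduct.tmul_zero, TensorProduct.zero_tmul]
    exact smul_zero _
  obtain ⟨q, rfl⟩ := Int.eq_ofNat_of_zero_le (not_lt.1 hq)
  obtain ⟨t, rfl⟩ := Int.eq_ofNat_of_zero_le (not_lt.1 ht)
  rw [← Nat.cast_mul, Int.coe_negOnePow_natCast]
  refine cutSum_swap h l
    (F := fun x y z => ofList R p x ⊗ₜ[R] ofList R t z ⊗ₜ[R] ofList R q y) ?_ ?_ ?_ ?_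
  · intro x y z b hb
    simp [ofList_of_notMem hb]
  · intro x y z b hb
    simp [ofList_of_notMem hb]
  · intro x y z hy
    simp [ofList_of_caesuras hy]
  · intro x y z hz
    simp [ofList_of_caesuras hz]

end Cocomp

theorem isDGCooperad (R : Type u) [CommRing R] : (data R).IsDGCooperad where
  d_shape _ _ _ _ _ h := d_of_ne h
  d_comp_d _ _ _ n m k := d_comp_d n m k
  map_refl _ _ _ n := hom_ext fun l _ _ =>
    (map_ofList (Equiv.refl _) n l).trans (by rw [Equiv.coe_refl, List.map_id]; rfl)
  map_trans e f n := hom_ext fun l _ _ => by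
    refine (map_ofList _ n l).trans ?_
    refine Eq.trans ?_ (LinearMap.comp_apply (map R f n) (map R e n) _).symm
    rw [map_ofList, map_ofList, List.map_map]
    rfl
  map_d e n m := map_comp_d e n m
  counit_d := counit_comp_d
  cocomp_degree _ _ _ _ _ _ _ h := cocomp_of_ne h
  cocomp_finite _ _ _ _ n x := cocomp_finite n x
  cocomp_d _ _ _ _ n p q := cocomp_d n p q
  cocomp_map e f _ n p q := cocomp_map e f n p q
  counit_right _ n := counit_right n
  counit_left _ _ _ n := counit_left n
  coassoc_seq _ w _ _ _ n p q t := coassoc_seq w n p q t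
  coassoc_par h _ _ _ _ _ _ n p q t := coassoc_par h n p q t

/-! ### The augmentation is a morphism of cooperads -/

section Augmentation

variable {R : Type u} [CommRing R]

open Classical in
theorem augmentation_ofList {A : Type} (l : List A) : augmentation R A 0 (ofList R 0 l) =
    if Nondegenerate l ∧ (l.length : ℤ) = Nat.card A + 0 then CoCom.gen R 0 else 0 := by
  by_cases h : Nondegenerate l ∧ (l.length : ℤ) = Nat.card A + 0
  · rw [if_pos h]
    exact linearCombination_ofList (fun _ => CoCom.gen R 0) h.1 h.2
  · rw [if_neg h, ofList, dif_neg h, map_zero]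

theorem augmentation_of_ne {A : Type} {n : ℤ} (h : n ≠ 0) : augmentation R A n = 0 := by
  refine hom_ext fun l h1 h2 => ?_
  refine (linearCombination_ofList (fun _ => CoCom.gen R n) h1 h2).trans ?_
  rw [CoCom.gen_ne h]
  rfl

theorem augmentation_comp_d {A : Type} [Finite A] (n m : ℤ) :
    augmentation R A m ∘ₗ d R A n m = 0 := by
  classical
  by_cases h : m + 1 = n
  swap
  · rw [d_of_ne h, LinearMap.comp_zero]
  by_cases hm : m = 0
  swap
  · rw [augmentation_of_ne hm, LinearMap.zero_comp]
  subst hm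
  refine hom_ext fun l h1 h2 => ?_
  rw [LinearMap.comp_apply, d_ofList h, map_delSum, LinearMap.zero_apply]
  have hl := caesuras_add_natCard h1.1
  refine Eq.trans (Finset.sum_congr rfl fun i hi => ?_)
    (delSum_augmentation (l := l) (by omega) (CoCom.gen R 0))
  refine congrArg _ ((augmentation_ofList _).trans (if_congr ?_ rfl rfl))
  have hi' : i < l.length := by simpa using hi
  have hlen : (l.eraseIdx i).length = Nat.card A := by
    rw [List.length_eraseIdx_of_lt hi']
    omega
  -- For length `Nat.card A` nondegeneracy just says that every element occurs.
  constructor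
  · exact fun k a _ => k.1.1 a
  · exact fun k => ⟨nondegenerate_of_length (fun a => k a (h1.1 a)) hlen, by omega⟩

theorem augmentation_comp_map {A B : Type} (e : A ≃ B) (n : ℤ) :
    augmentation R B n ∘ₗ map R e n = augmentation R A n := by
  refine hom_ext fun l h1 h2 => ?_
  rw [LinearMap.comp_apply, map_ofList]
  refine (linearCombination_ofList (fun _ => CoCom.gen R n) ((nondegenerate_map e).2 h1) ?_).trans
    (linearCombination_ofList (fun _ => CoCom.gen R n) h1 h2).symm
  rwa [List.length_map, ← Nat.card_congr e]

theorem counit_comp_augmentation : CoCom.counit R ∘ₗ augmentation R Unit 0 = counit R := by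
  refine hom_ext fun l h1 h2 => ?_
  rw [LinearMap.comp_apply, augmentation_ofList, if_pos ⟨h1, h2⟩, CoCom.counit_gen,
    counit_ofList, if_pos (h1.eq_of_subsingleton ())]

theorem cocomp_augmentation {A : Type} [Finite A] {v : A} {B : Type} [Finite B] [Nonempty B]
    (n p q : ℤ) : TensorProduct.map (augmentation R A p) (augmentation R B q) ∘ₗ
      cocomp R v B n p q = CoCom.cocomp R n p q ∘ₗ augmentation R (Graft A v B) n := by
  classical
  by_cases hpq : p = 0 ∧ q = 0
  swap
  · rw [CoCom.cocomp_eq_zero n hpq, LinearMap.zero_comp]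
    by_cases hp : p = 0
    · rw [augmentation_of_ne (n := q) fun hq => hpq ⟨hp, hq⟩, TensorProduct.map_zero_right,
        LinearMap.zero_comp]
    · rw [augmentation_of_ne hp, TensorProduct.map_zero_left, LinearMap.zero_comp]
  obtain ⟨rfl, rfl⟩ := hpq
  by_cases hn : n = 0
  swap
  · rw [cocomp_of_ne (by omega), augmentation_of_ne hn, LinearMap.comp_zero, LinearMap.comp_zero]
  subst hn
  refine hom_ext fun l h1 h2 => ?_
  rw [LinearMap.comp_apply, LinearMap.comp_apply, augmentation_ofList, if_pos ⟨h1, h2⟩,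
    CoCom.cocomp_gen rfl, cocomp_ofList (by omega), map_cutSum]
  have hl := caesuras_add_natCard h1.1
  refine Eq.trans (cutSum_congr fun c hc => ?_)
    (cutSum_augmentation (fun b => h1.1 (Sum.inr b)) (by omega) _)
  rw [TensorProduct.map_tmul, augmentation_ofList, augmentation_ofList]
  by_cases hy : ∀ b, b ∈ cutRight l c
  · have hx : ∀ a, a ∈ cutLeft l c := fun a => by
      rw [mem_cutLeft hc, mem_leftPart]
      by_cases k : a = v
      · exact Or.inl k
      · exact Or.inr ⟨k, h1.1 _⟩
    -- The lengths of the factors are at least `Nat.card A` and `Nat.card B` and add up to their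
    -- sum, so both factors have degree zero.
    have e1 := length_cut hc
    have e2 := natCard_graft (B := B) v
    have e3 := caesuras_add_natCard hx
    have e4 := caesuras_add_natCard hy
    rw [if_pos hy, if_pos ⟨nondegenerate_of_length hx (by omega), by omega⟩,
      if_pos ⟨nondegenerate_of_length hy (by omega), by omega⟩]
  · rw [if_neg hy, if_neg (c := Nondegenerate (cutRight l c) ∧ _) fun k => hy k.1.1,
      TensorProduct.tmul_zero]

/-- The augmentation as a morphism of cooperads. -/
noncomputable def augmentationHom (R : Type u) [CommRing R] :
    DGCooperad.Hom ⟨data R, isDGCooperad R⟩ (coComNu R) where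
  app A _ _ n := augmentation R A n
  comm_d _ _ _ n m := (augmentation_comp_d n m).trans (LinearMap.zero_comp _).symm
  comm_map e n := (augmentation_comp_map e n).trans (LinearMap.id_comp _).symm
  comm_counit := counit_comp_augmentation
  comm_cocomp _ _ _ _ n p q := cocomp_augmentation n p q

end Augmentation

end Surj

namespace Sequence

/-! ### The complex of words and its degenerate subcomplex -/

section Words

variable (R : Type*) [CommRing R] {A : Type}

/-- The linear extension of the alternating sum over all deletions of an entry. -/
noncomputable def altD : (List A →₀ R) →ₗ[R] (List A →₀ R) :=
  Finsupp.linearCombination R fun l => altSum l fun x => Finsupp.single x 1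

/-- Putting an entry in front of all sequences. -/
noncomputable def prepend (a : A) : (List A →₀ R) →ₗ[R] (List A →₀ R) :=
  Finsupp.lmapDomain R R (List.cons a)

/-- The sequences that have equal consecutive entries or do not contain all entries of `w`. -/
def degenerate (w : List A) : Set (List A) := {l | ¬ l.IsChain (· ≠ ·) ∨ ∃ a ∈ w, a ∉ l}

/-- The span of the sequences that have equal consecutive entries or do not contain all entries
of `w`. -/
noncomputable def degenerateSpan (w : List A) : Submodule R (List A →₀ R) :=
  Finsupp.supported R R (degenerate w)

variable {R}

@[simp] theorem altD_single (l : List A) :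
    altD R (Finsupp.single l 1) = altSum l fun x => Finsupp.single x 1 := by simp [altD]

@[simp] theorem prepend_single (a : A) (l : List A) :
    prepend R a (Finsupp.single l 1) = Finsupp.single (a :: l) 1 := by
  simp [prepend]

theorem hom_ext_words {M : Type*} [AddCommMonoid M] [Module R M] {f g : (List A →₀ R) →ₗ[R] M}
    (h : ∀ l, f (Finsupp.single l 1) = g (Finsupp.single l 1)) : f = g :=
  Finsupp.lhom_ext' fun l => LinearMap.ext_ring (h l)

theorem altD_altD (z : List A →₀ R) : altD R (altD R z) = 0 := by
  suffices h : altD R ∘ₗ altD R = (0 : (List A →₀ R) →ₗ[R] (List A →₀ R)) from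
    LinearMap.congr_fun h z
  refine hom_ext_words fun l => ?_
  simp only [LinearMap.comp_apply, altD_single, map_altSum, LinearMap.zero_apply]
  exact altSum_altSum l _

/-- Putting `a` in front is a contracting homotopy on all words. Homology appears only modulo
degenerate words, since `a` may complete a word in which it was missing. -/
theorem altD_prepend (a : A) (z : List A →₀ R) :
    altD R (prepend R a z) = z - prepend R a (altD R z) := by
  suffices h : altD R ∘ₗ prepend R a = LinearMap.id - prepend R a ∘ₗ altD R from
    LinearMap.congr_fun h z
  refine hom_ext_words fun l => ?_
  simp only [LinearMap.comp_apply, altD_single, prepend_single, LinearMap.sub_apply, map_altSum,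
    LinearMap.id_apply]
  rfl

theorem single_mem_degenerateSpan {w l : List A} (h : l ∈ degenerate w) :
    Finsupp.single l (1 : R) ∈ degenerateSpan R w :=
  Finsupp.single_mem_supported R 1 h

theorem map_supported_le {s : Set (List A)} {p : Submodule R (List A →₀ R)}
    (f : (List A →₀ R) →ₗ[R] (List A →₀ R)) (h : ∀ l ∈ s, f (Finsupp.single l 1) ∈ p)
    {z : List A →₀ R} (hz : z ∈ Finsupp.supported R R s) : f z ∈ p := by
  rw [Finsupp.supported_eq_span_single] at hz
  have : Submodule.span R ((fun i => Finsupp.single i (1 : R)) '' s) ≤ p.comap f :=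
    Submodule.span_le.2 <| by
      rintro - ⟨l, hl, rfl⟩
      exact h l hl
  exact this hz

theorem altD_mem_degenerateSpan {w : List A} {z : List A →₀ R} (hz : z ∈ degenerateSpan R w) :
    altD R z ∈ degenerateSpan R w := by
  refine map_supported_le (altD R) (fun l hl => ?_) hz
  rw [altD_single, ← Submodule.Quotient.mk_eq_zero, ← Submodule.mkQ_apply, map_altSum]
  rcases hl with hl | ⟨a, ha, hl⟩
  · refine altSum_eq_zero_of_not_isChain hl fun x hx => ?_
    exact (Submodule.Quotient.mk_eq_zero _).2 (single_mem_degenerateSpan (Or.inl hx))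
  · refine altSum_eq_zero_of_notMem hl fun x hx => ?_
    exact (Submodule.Quotient.mk_eq_zero _).2 (single_mem_degenerateSpan (Or.inr ⟨a, ha, hx⟩))

theorem not_isChain_cons {a : A} {l : List A} (h : ¬ l.IsChain (· ≠ ·)) :
    ¬ (a :: l).IsChain (· ≠ ·) := fun k => h k.tail

/-- As `a ∉ w`, the new letter cannot supply a missing letter of `w`. The assumption on `z` concerns
`w` and not `a :: w`, because a word missing only `a` would become complete. -/
theorem prepend_mem_degenerateSpan {a : A} {w : List A} (ha : a ∉ w) {z : List A →₀ R}
    (hz : z ∈ degenerateSpan R w) : prepend R a z ∈ degenerateSpan R (a :: w) := by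
  refine map_supported_le (prepend R a) (fun l hl => ?_) hz
  rw [prepend_single]
  refine single_mem_degenerateSpan ?_
  rcases hl with hl | ⟨b, hb, hl⟩
  · exact Or.inl (not_isChain_cons hl)
  · refine Or.inr ⟨b, List.mem_cons_of_mem a hb, ?_⟩
    rw [List.mem_cons, not_or]
    exact ⟨fun e => ha (e ▸ hb), hl⟩

/-- The span of the sequences with entries in `w`. -/
noncomputable def lettersSpan (R : Type*) [CommRing R] (w : List A) :
    Submodule R (List A →₀ R) :=
  Finsupp.supported R R {l | l ⊆ w}

theorem altD_mem_lettersSpan {w : List A} {z : List A →₀ R} (hz : z ∈ lettersSpan R w) :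
    altD R z ∈ lettersSpan R w := by
  refine map_supported_le (altD R) (fun l hl => ?_) hz
  rw [altD_single, altSum_eq_sum]
  refine Submodule.sum_mem _ fun i _ => zsmul_mem (Finsupp.single_mem_supported R 1 ?_) _
  exact fun a ha => hl (List.mem_of_mem_eraseIdx ha)

theorem prepend_mem_lettersSpan (a : A) {w : List A} {z : List A →₀ R}
    (hz : z ∈ lettersSpan R (a :: w)) : prepend R a z ∈ lettersSpan R (a :: w) := by
  refine map_supported_le (prepend R a) (fun l hl => ?_) hz
  rw [prepend_single]
  exact Finsupp.single_mem_supported R 1 (List.cons_subset.2 ⟨List.mem_cons_self, hl⟩)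

theorem lettersSpan_le {w : List A} {a : A} : lettersSpan R w ≤ lettersSpan R (a :: w) :=
  Finsupp.supported_mono fun _ hl => List.Subset.trans hl (List.subset_cons_self a w)

theorem lettersSpan_le_degenerateSpan {w : List A} {a : A} (ha : a ∉ w) :
    lettersSpan R w ≤ degenerateSpan R (a :: w) :=
  Finsupp.supported_mono fun _ hl => Or.inr ⟨a, List.mem_cons_self, fun k => ha (hl k)⟩

/-- Modulo degenerate sequences, every cycle on the entries of `w` is a boundary up to a multiple
of `w`. -/
theorem exists_altD_sub_mem {w : List A} (hw : w.Nodup) {z : List A →₀ R}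
    (hz : z ∈ lettersSpan R w) (hd : altD R z ∈ degenerateSpan R w) :
    ∃ x ∈ lettersSpan R w, ∃ c : R,
      altD R x - z - Finsupp.single w c ∈ degenerateSpan R w := by
  classical
  induction w generalizing z with
  | nil =>
    -- The only word without letters is the empty one, so `z` is itself a multiple of `w`.
    refine ⟨0, Submodule.zero_mem _, - z [], ?_⟩
    have : z = Finsupp.single [] (z []) := by
      ext l
      by_cases h : l = []
      · subst h; simp
      · rw [Finsupp.single_eq_of_ne h]
        by_contra k
        exact h (List.subset_nil.1 (hz (Finsupp.mem_support_iff.2 k)))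
    rw [this]
    simp
  | cons a w ih =>
    rw [List.nodup_cons] at hw
    -- The boundary is split into the words without `a`, which use only the letters of `w`, and
    -- those with `a`, which are degenerate for `a :: w` without missing `a`, hence degenerate for
    -- `w`.
    obtain ⟨y, r, hy, hr, hyr⟩ : ∃ y r : List A →₀ R, y ∈ lettersSpan R w ∧
        r ∈ degenerateSpan R w ∧ altD R z = y + r := by
      refine ⟨(altD R z).filter (a ∉ ·), (altD R z).filter (fun l => ¬ a ∉ l), fun l hl => ?_,
        fun l hl => ?_, (Finsupp.filter_add_filter_not _ _).symm⟩
      · rw [Finset.mem_coe, Finsupp.support_filter, Finset.mem_filter] at hl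
        have := altD_mem_lettersSpan hz (Finset.mem_coe.2 hl.1)
        intro b hb
        rcases List.mem_cons.1 (this hb) with rfl | h
        · exact absurd hb hl.2
        · exact h
      · rw [Finset.mem_coe, Finsupp.support_filter, Finset.mem_filter, not_not] at hl
        rcases hd (Finset.mem_coe.2 hl.1) with h | ⟨b, hb, h⟩
        · exact Or.inl h
        · rcases List.mem_cons.1 hb with rfl | hb
          · exact absurd hl.2 h
          · exact Or.inr ⟨b, hb, h⟩
    have hdy : altD R y ∈ degenerateSpan R w := by
      have h := altD_altD z
      rw [hyr, map_add] at h
      rw [eq_neg_of_add_eq_zero_left h]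
      exact neg_mem (altD_mem_degenerateSpan hr)
    obtain ⟨x, hx, c, hc⟩ := ih hw.2 hy hdy
    -- Modulo degenerate words `∂(a(z - x)) = z - x - a(y + r - ∂x)` is `z + c • (a :: w)`: the
    -- chain `x` misses `a`, `a r` is degenerate, and `∂x - y` is `c • w` by induction.
    refine ⟨prepend R a (z - x), prepend_mem_lettersSpan a (sub_mem hz (lettersSpan_le hx)), c, ?_⟩
    have h1 := prepend_mem_degenerateSpan hw.1 hc
    have h2 := prepend_mem_degenerateSpan hw.1 hr
    have h3 := lettersSpan_le_degenerateSpan hw.1 hx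
    have h4 : prepend R a (Finsupp.single w c) = Finsupp.single (a :: w) c := by simp [prepend]
    rw [map_sub, map_sub, h4] at h1
    rw [altD_prepend, map_sub, hyr, map_sub, map_add]
    convert sub_mem (sub_mem h1 h2) h3 using 1
    abel

end Words

end Sequence

namespace Surj

open Sequence

/-! ### Homology of the surjections cooperad -/

section Homology

variable {R : Type u} [CommRing R] {A : Type}

/-- The linear combination of sequences given by an element of the surjections cooperad, with
reoriented basis elements. -/
noncomputable def toWords (R : Type u) [CommRing R] (lt : A → A → Prop) (n : ℤ) :
    Obj R A n →ₗ[R] (List A →₀ R) :=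
  Finsupp.linearCombination R fun u => orient lt u.1 • Finsupp.single u.1 1

/-- The element of the surjections cooperad given by a linear combination of sequences, with
reoriented basis elements. -/
noncomputable def ofWords (R : Type u) [CommRing R] (lt : A → A → Prop) (n : ℤ) :
    (List A →₀ R) →ₗ[R] Obj R A n :=
  Finsupp.linearCombination R fun l => orient lt l • ofList R n l

variable {lt : A → A → Prop}

theorem ofWords_single (n : ℤ) (l : List A) :
    ofWords R lt n (Finsupp.single l 1) = orient lt l • ofList R n l := by simp [ofWords]

theorem toWords_ofList {n : ℤ} {l : List A} (h1 : Nondegenerate l)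
    (h2 : (l.length : ℤ) = Nat.card A + n) :
    toWords R lt n (ofList R n l) = orient lt l • Finsupp.single l 1 :=
  linearCombination_ofList (fun l => orient lt l • Finsupp.single l (1 : R)) h1 h2

theorem ofWords_toWords (n : ℤ) (z : Obj R A n) : ofWords R lt n (toWords R lt n z) = z := by
  suffices h : ofWords R lt n ∘ₗ toWords R lt n = LinearMap.id from LinearMap.congr_fun h z
  refine hom_ext fun l h1 h2 => ?_
  rw [LinearMap.comp_apply, toWords_ofList h1 h2, map_zsmul, ofWords_single, smul_smul, orient_mul_self, one_smul, LinearMap.id_apply]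

/-- This is `delSum_eq_altSum` in linear form; `ofWords` exhibits the surjections complex as a
quotient of the complex of words. -/
theorem ofWords_altD (hlt : IsTournament lt) {n m : ℤ} (h : m + 1 = n) (z : List A →₀ R) :
    ofWords R lt m (altD R z) = d R A n m (ofWords R lt n z) := by
  suffices h : ofWords R lt m ∘ₗ altD R = d R A n m ∘ₗ ofWords R lt n from
    LinearMap.congr_fun h z
  refine hom_ext_words fun l => ?_
  rw [LinearMap.comp_apply, LinearMap.comp_apply, altD_single, map_altSum, ofWords_single,
    map_zsmul, d_ofList h, delSum_eq_altSum hlt fun x a hx => ofList_of_notMem hx, smul_smul,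
    orient_mul_self, one_smul]
  simp only [ofWords_single]

theorem ofWords_eq_zero (n : ℤ) {w : List A} {z : List A →₀ R}
    (hz : z ∈ degenerateSpan R w) : ofWords R lt n z = 0 := by
  suffices h : degenerateSpan R w ≤ LinearMap.ker (ofWords R lt n) from h hz
  rw [degenerateSpan, Finsupp.supported_eq_span_single, Submodule.span_le]
  rintro - ⟨l, hl, rfl⟩
  rw [SetLike.mem_coe, LinearMap.mem_ker]
  refine (ofWords_single n l).trans ?_
  rcases hl with hl | ⟨a, -, hl⟩
  · rw [ofList_of_not_nondegenerate fun k => hl k.2, smul_zero]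
  · rw [ofList_of_notMem hl, smul_zero]

/-- The section `toWords` is a chain map only modulo degenerate words, as the boundary of a
nondegenerate word may contain degenerate ones and `d` discards them. -/
theorem altD_toWords_sub_mem (hlt : IsTournament lt) {n m : ℤ} (h : m + 1 = n) {w : List A}
    (hw : ∀ a, a ∈ w) (z : Obj R A n) :
    altD R (toWords R lt n z) - toWords R lt m (d R A n m z) ∈ degenerateSpan R w := by
  rw [← Submodule.Quotient.mk_eq_zero, ← Submodule.mkQ_apply]
  set q := (degenerateSpan R w).mkQ
  have hq : ∀ l, ¬ Nondegenerate l → q (Finsupp.single l 1) = 0 := fun l hl => by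
    refine (Submodule.Quotient.mk_eq_zero _).2 (single_mem_degenerateSpan ?_)
    rw [Nondegenerate, not_and_or, not_forall] at hl
    exact hl.symm.imp_right fun ⟨a, ha⟩ => ⟨a, hw a, ha⟩
  suffices k : q ∘ₗ altD R ∘ₗ toWords R lt n = q ∘ₗ toWords R lt m ∘ₗ d R A n m by
    rw [map_sub, sub_eq_zero]
    exact LinearMap.congr_fun k z
  refine hom_ext fun l h1 h2 => ?_
  simp only [LinearMap.comp_apply]
  rw [d_ofList h, toWords_ofList h1 h2, map_zsmul, altD_single, map_zsmul, map_altSum, map_delSum, map_delSum]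
  have key : delSum l (fun x => q (toWords R lt m (ofList R m x))) =
      delSum l (fun x => orient lt x • q (Finsupp.single x 1)) := by
    refine Finset.sum_congr rfl fun i hi => congrArg _ ?_
    have hi' : i < l.length := by simpa using hi
    beta_reduce
    by_cases k : Nondegenerate (l.eraseIdx i)
    · have hl : ((l.eraseIdx i).length : ℤ) = Nat.card A + m := by
        rw [List.length_eraseIdx_of_lt hi']
        omega
      rw [toWords_ofList k hl, map_zsmul]
    · rw [ofList_of_not_nondegenerate k, map_zero, map_zero, hq _ k, smul_zero]
  rw [key, delSum_eq_altSum hlt]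
  · simp only [smul_smul, orient_mul_self, one_smul]
  · intro x a hx
    rw [hq x fun k => hx (k.1 a), smul_zero]

theorem exists_eq_d_add {w : List A} (hw : w.Nodup) (hw' : ∀ a, a ∈ w) {n : ℤ}
    {z : Obj R A n} (hz : d R A n (n - 1) z = 0) :
    ∃ x : Obj R A (n + 1), ∃ c : R, z = d R A (n + 1) n x + c • ofList R n w := by
  obtain ⟨lt, hlt⟩ : ∃ lt : A → A → Prop, IsTournament lt := by
    rcases isEmpty_or_nonempty A with hA | ⟨⟨v⟩⟩
    · exact ⟨fun _ _ => False, fun a => isEmptyElim a⟩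
    · exact (exists_isTournament v).imp fun _ h => h.1
  have h := altD_toWords_sub_mem (R := R) hlt (sub_add_cancel n 1) hw' z
  rw [hz, map_zero, sub_zero] at h
  obtain ⟨x, -, c, hx⟩ := exists_altD_sub_mem hw (fun l _ a _ => hw' a) h
  have := ofWords_eq_zero (lt := lt) n hx
  rw [map_sub, map_sub, ofWords_altD hlt rfl, ofWords_toWords, ← mul_one c,
    ← smul_eq_mul, ← Finsupp.smul_single, map_smul, ofWords_single] at this
  -- The sign and the factor `orient lt w` come from solving `d x - z - c • (orient lt w • w) = 0`
  -- for `z`.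
  refine ⟨ofWords R lt (n + 1) x, - c * (orient lt w : ℤ), ?_⟩
  rw [sub_sub, sub_eq_zero] at this
  rw [this, mul_smul, Int.cast_smul_eq_zsmul, neg_smul]
  abel

theorem exists_nodup [Finite A] : ∃ w : List A, w.Nodup ∧ ∀ a, a ∈ w := by
  have := Fintype.ofFinite A
  exact ⟨Finset.univ.toList, Finset.nodup_toList _, by simp⟩

theorem length_eq_natCard {w : List A} (hw : w.Nodup) (hw' : ∀ a, a ∈ w) :
    w.length = Nat.card A := by
  classical
  rw [← Nat.card_congr (Equiv.subtypeUnivEquiv hw'), Nat.card_eq_fintype_card,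
    ← List.toFinset_card_of_nodup hw, ← Fintype.card_coe]
  exact Fintype.card_congr (Equiv.subtypeEquivRight fun a => List.mem_toFinset)

/-- By `exists_eq_d_add` only a multiple of `w` is in the way. It is zero outside degree zero for
reasons of length, and in degree zero its coefficient is the value of the augmentation, which kills
boundaries. -/
theorem exists_eq_d [Finite A] {n : ℤ} {z : Obj R A n} (hz : d R A n (n - 1) z = 0)
    (hz' : augmentation R A n z = 0) : ∃ x : Obj R A (n + 1), d R A (n + 1) n x = z := by
  obtain ⟨w, hw, hw'⟩ := exists_nodup (A := A)
  obtain ⟨x, c, rfl⟩ := exists_eq_d_add hw hw' hz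
  refine ⟨x, ?_⟩
  have hl := length_eq_natCard hw hw'
  by_cases hn : n = 0
  · subst hn
    have h := LinearMap.congr_fun (augmentation_comp_d (R := R) (A := A) (0 + 1) 0) x
    rw [LinearMap.comp_apply, LinearMap.zero_apply] at h
    rw [map_add, h, zero_add, map_smul, augmentation_ofList,
      if_pos ⟨nondegenerate_of_length hw' hl, by omega⟩] at hz'
    have := congrArg (CoCom.counit R) hz'
    rw [map_smul, CoCom.counit_gen, map_zero, smul_eq_mul, mul_one] at this
    rw [this, zero_smul, add_zero]
  · rw [ofList_of_length (l := w) (by omega), smul_zero, add_zero]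

theorem subsingleton_obj [Finite A] {n : ℤ} (hn : n < 0) : Subsingleton (Obj R A n) := by
  have : IsEmpty (Basis A n) := ⟨fun u => by
    have := u.2.1.natCard_le
    have := u.2.2
    omega⟩
  infer_instance

end Homology

theorem isNonneg (R : Type u) [CommRing R] : DGCooperad.IsNonneg ⟨data R, isDGCooperad R⟩ :=
  fun _ _ _ _ hn => subsingleton_obj hn

/-- An enumeration of `A` is a sequence of degree zero, a cycle because nothing lives in negative
degrees, and its augmentation is the generator. -/
theorem exists_section (R : Type u) [CommRing R] (A : Type) [Finite A] (n : ℤ) :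
    ∃ s : CoCom.Obj R n →ₗ[R] Obj R A n, augmentation R A n ∘ₗ s = LinearMap.id ∧
      ∀ m, d R A n m ∘ₗ s = 0 := by
  obtain ⟨w, hw, hw'⟩ := exists_nodup (A := A)
  have hl := length_eq_natCard hw hw'
  have hs : ∀ h : n = 0, Finsupp.linearCombination R (fun _ : PLift (n = 0) => ofList R n w)
    (CoCom.gen R n) = ofList R n w := fun h => by simp [CoCom.gen, h]
  refine ⟨Finsupp.linearCombination R fun _ => ofList R n w, CoCom.hom_ext fun h => ?_,
    fun m => CoCom.hom_ext fun h => ?_⟩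
  · rw [LinearMap.comp_apply, hs h, LinearMap.id_apply]
    subst h
    rw [augmentation_ofList, if_pos ⟨nondegenerate_of_length hw' hl, by omega⟩]
  · by_cases hm : m + 1 = n
    · have := subsingleton_obj (R := R) (A := A) (n := m) (by omega)
      exact Subsingleton.elim _ _
    · rw [d_of_ne hm, LinearMap.zero_comp]

theorem augmentationHom_isQuasiIso (R : Type u) [CommRing R] :
    (augmentationHom R).IsQuasiIso := by
  intro A _ _
  rw [quasiIso_iff]
  intro n
  rw [quasiIsoAt_iff_isIso_homologyMap]
  have hp : (ComplexShape.down ℤ).prev n = n + 1 := ComplexShape.prev_eq' _ (by simp)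
  have hn : (ComplexShape.down ℤ).next n = n - 1 := ComplexShape.next_eq' _ (by simp)
  have h1 : Mono (HomologicalComplex.homologyMap ((augmentationHom R).chainMap A) n) := by
    rw [HomologicalComplex.mono_homologyMap_iff_up_to_refinements _ _ _ _ hp hn]
    intro M x hx y hxy
    -- `P` is the pullback of the family of cycles `x` along the differential; it maps onto `M` by
    -- `exists_eq_d`.
    let P := LinearMap.eqLocus (x.hom ∘ₗ LinearMap.fst R M (Obj R A (n + 1)))
      (d R A (n + 1) n ∘ₗ LinearMap.snd R M (Obj R A (n + 1)))
    refine ⟨ModuleCat.of R P, ModuleCat.ofHom (LinearMap.fst R _ _ ∘ₗ P.subtype), ?_,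
      ModuleCat.ofHom (LinearMap.snd R _ _ ∘ₗ P.subtype), ?_⟩
    · rw [ModuleCat.epi_iff_surjective]
      intro a
      obtain ⟨b, hb⟩ := exists_eq_d (R := R) (A := A) (n := n) (z := x.hom a)
        (ConcreteCategory.congr_hom hx a) (ConcreteCategory.congr_hom hxy a)
      exact ⟨⟨(a, b), hb.symm⟩, rfl⟩
    · ext a
      exact a.2
  have h2 : Epi (HomologicalComplex.homologyMap ((augmentationHom R).chainMap A) n) := by
    rw [HomologicalComplex.epi_homologyMap_iff_up_to_refinements _ _ _ _ hp hn]
    intro M y _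
    obtain ⟨s, hs, hs'⟩ := exists_section R A n
    refine ⟨M, 𝟙 M, inferInstance, y ≫ ModuleCat.ofHom s, ?_, 0, ?_⟩
    · ext a
      exact LinearMap.congr_fun (hs' (n - 1)) (y.hom a)
    · rw [Limits.zero_comp, add_zero]
      ext a
      exact (LinearMap.congr_fun hs (y.hom a)).symm
  exact isIso_of_mono_of_epi _

end Surj

/-! ### Lifting for bounded below complexes of projectives -/

section Lifting

open Limits

variable {C : Type*} [Category* C] [Abelian C] {K Y Z : ChainComplex C ℤ} {p : Y ⟶ Z}

/-- The kernel of `p` is acyclic. Any lift `h` of `f.f n` fails to commute with the differentials by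
a cycle `e` in this kernel; by projectivity `e` is the boundary of some `b`, and `h + b` is the lift
wanted. -/
theorem exists_lift_step (hp : QuasiIso p) (hp' : ∀ n, Epi (p.f n)) (f : K ⟶ Z) (n m k : ℤ)
    (hm : m + 1 = n) (hk : k + 1 = m) [Projective (K.X n)] (g : K.X m ⟶ Y.X m)
    (hg : g ≫ p.f m = f.f m) (hd : K.d n m ≫ g ≫ Y.d m k = 0) :
    ∃ g' : K.X n ⟶ Y.X n, g' ≫ p.f n = f.f n ∧ g' ≫ Y.d n m = K.d n m ≫ g := by
  have : Epi p := HomologicalComplex.epi_of_epi_f p hp'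
  have hS : (ShortComplex.mk (kernel.ι p) p (kernel.condition p)).ShortExact :=
    { exact := ShortComplex.exact_kernel p }
  have hex : ∀ i, ((ShortComplex.mk (kernel.ι p) p (kernel.condition p)).map
      (HomologicalComplex.eval C _ i)).ShortExact := fun i => hS.map_of_exact _
  have hac : (kernel p).Acyclic := hS.acyclic_X₁ hp
  have hac' := (HomologicalComplex.exactAt_iff' _ n m k (by simp [← hm]) (by simp [← hk])).1 (hac m)
  let h := Projective.factorThru (f.f n) (p.f n)
  have hh : h ≫ p.f n = f.f n := Projective.factorThru_comp _ _
  let e := K.d n m ≫ g - h ≫ Y.d n m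
  have he : e ≫ p.f m = 0 := by
    rw [Preadditive.sub_comp, Category.assoc, Category.assoc, hg, ← f.comm, ← p.comm,
      reassoc_of% hh, sub_self]
  have he' : e ≫ Y.d m k = 0 := by
    simp [e, hd]
  obtain ⟨l, hl⟩ : ∃ l : K.X n ⟶ (kernel p).X m, l ≫ (kernel.ι p).f m = e :=
    ⟨_, (hex m).exact.liftFromProjective_comp e he⟩
  have hl' : l ≫ (kernel p).d m k = 0 := by
    have : Mono ((kernel.ι p).f k) := (hex k).mono_f
    rw [← cancel_mono ((kernel.ι p).f k), Category.assoc, ← HomologicalComplex.Hom.comm,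
      reassoc_of% hl, he', zero_comp]
  obtain ⟨b, hb⟩ : ∃ b : K.X n ⟶ (kernel p).X n, b ≫ (kernel p).d n m = l :=
    ⟨_, hac'.liftFromProjective_comp l hl'⟩
  have hz : (kernel.ι p).f n ≫ p.f n = 0 := by
    rw [← HomologicalComplex.comp_f, kernel.condition, HomologicalComplex.zero_f]
  refine ⟨h + b ≫ (kernel.ι p).f n, ?_, ?_⟩
  · rw [Preadditive.add_comp, Category.assoc, hz, comp_zero, add_zero, hh]
  · rw [Preadditive.add_comp, Category.assoc, HomologicalComplex.Hom.comm, reassoc_of% hb, hl]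
    simp [e]

/-- Bounded below complexes of projective objects have the left lifting property with respect to
epimorphic quasi-isomorphisms. -/
theorem exists_lift_of_projective (hK : ∀ n < 0, IsZero (K.X n)) (hK' : ∀ n, Projective (K.X n))
    (hp : QuasiIso p) (hp' : ∀ n, Epi (p.f n)) (f : K ⟶ Z) : ∃ g : K ⟶ Y, g ≫ p = f := by
  -- The second condition is all that the next step needs to know about the previous ones.
  let T (k : ℕ) := {g : K.X k ⟶ Y.X k // g ≫ p.f k = f.f k ∧
    K.d (k + 1 : ℕ) k ≫ g ≫ Y.d k (k - 1) = 0}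
  -- The start is an ordinary step from degree `-1`, where `K` is zero and the lift is the zero map.
  have h0 : ∃ g : T 0, g.1 ≫ Y.d (0 : ℕ) (-1) = 0 := by
    obtain ⟨g, h1, h2⟩ := exists_lift_step hp hp' f (0 : ℕ) (-1) (-2) (by simp) (by simp) 0
      ((hK _ (by simp)).eq_of_src _ _) (by simp)
    rw [comp_zero] at h2
    exact ⟨⟨g, h1, (congrArg _ h2).trans comp_zero⟩, h2⟩
  have hs : ∀ k (g : T k), ∃ g' : T (k + 1), g'.1 ≫ Y.d (k + 1 : ℕ) k = K.d (k + 1 : ℕ) k ≫ g.1 := by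
    intro k g
    obtain ⟨g', h1, h2⟩ := exists_lift_step hp hp' f (k + 1 : ℕ) k (k - 1) (by simp) (by simp)
      g.1 g.2.1 g.2.2
    refine ⟨⟨g', h1, ?_⟩, h2⟩
    have : ((k + 1 : ℕ) : ℤ) - 1 = k := by simp
    rw [this, h2, HomologicalComplex.d_comp_d_assoc, zero_comp]
  choose s hs using hs
  obtain ⟨t0, ht0⟩ := h0
  let t : ∀ k, T k := fun k => Nat.rec t0 s k
  let g : ∀ n, K.X n ⟶ Y.X n
    | Int.ofNat k => (t k).1
    | Int.negSucc _ => 0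
  refine ⟨⟨g, ?_⟩, ?_⟩
  · rintro n m hnm
    obtain rfl : m + 1 = n := hnm
    rcases m with k | k
    · exact hs k (t k)
    · rcases k with - | k
      · exact ht0.trans comp_zero.symm
      · exact (hK _ (by omega)).eq_of_src _ _
  · ext n
    rcases n with k | k
    · exact (t k).2.1
    · exact (hK _ (by omega)).eq_of_src _ _

end Lifting

/-! ### Freeness of the symmetric group actions and cofibrancy -/

namespace Sequence

/-- The renaming action of the permutations on the sequences that contain all elements is free:
there is an equivariant map to the group of permutations. -/
theorem exists_equivariant (A : Type) : ∃ t : List A → Equiv.Perm A,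
    ∀ (σ : Equiv.Perm A) (l : List A), (∀ a, a ∈ l) → t (l.map σ) = σ * t l := by
  let S : Setoid (List A) :=
    { r := fun l m => ∃ σ : Equiv.Perm A, l.map σ = m
      iseqv :=
        { refl := fun l => ⟨1, by simp⟩
          symm := by
            rintro l - ⟨σ, rfl⟩
            exact ⟨σ.symm, by simp⟩
          trans := by
            rintro l - - ⟨σ, rfl⟩ ⟨τ, rfl⟩
            exact ⟨τ * σ, by simp [List.map_map]⟩ } }
  have h : ∀ l : List A, ∃ σ : Equiv.Perm A, (Quotient.mk S l).out.map σ = l :=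
    fun l => Quotient.mk_out (s := S) l
  -- The permutation `t l` carries the chosen representative of the orbit of `l` to `l`.
  choose t ht using h
  refine ⟨t, fun σ l hl => Equiv.ext fun a => ?_⟩
  have h1 : Quotient.mk S (l.map σ) = Quotient.mk S l :=
    (Quotient.sound (s := S) (show S.r l (l.map σ) from ⟨σ, rfl⟩)).symm
  have h2 : (Quotient.mk S l).out.map (t (l.map σ)) = (Quotient.mk S l).out.map (σ ∘ t l) := by
    rw [← List.map_map, ht l, ← h1, ht]
  -- Two permutations with the same effect on the representative agree on its entries, and every `a`
  -- is among them since every element occurs in `l`.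
  refine List.map_inj_left.1 h2 a ?_
  have h3 := hl (t l a)
  rw [← ht l] at h3
  obtain ⟨b, hb, hb'⟩ := List.mem_map.1 h3
  rw [ht l] at hb'
  rwa [← (t l).injective hb']

end Sequence

namespace Surj

open Sequence

/-- The action on the basis is free. A set-theoretic section `c` of the epimorphism lifts the values
at the orbit representatives, and `exists_equivariant` spreads these lifts equivariantly. -/
theorem projective_repComplex (R : Type u) [CommRing R] (A : Type) [Finite A] [Nonempty A]
    (n : ℤ) : Projective ((DGCooperad.repComplex ⟨data R, isDGCooperad R⟩ A).X n) where
  factors {E X} f e he := by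
    rw [Rep.epi_iff_surjective] at he
    obtain ⟨c, hc⟩ := he.hasRightInverse
    obtain ⟨t, ht⟩ := exists_equivariant A
    have hf : ∀ (σ : Equiv.Perm A) (l : List A), f.hom (ofList R n (l.map σ)) =
        X.ρ σ (f.hom (ofList R n l)) := fun σ l => by
      rw [← map_ofList]
      exact Rep.hom_comm_apply f σ _
    have he : ∀ (σ : Equiv.Perm A) (x : E), e.hom (E.ρ σ x) = X.ρ σ (e.hom x) :=
      fun σ x => Rep.hom_comm_apply e σ x
    let φ : List A → E := fun l => E.ρ (t l) (c (f.hom (ofList R n (l.map (t l).symm))))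
    let g : Obj R A n →ₗ[R] E := Finsupp.linearCombination R fun u => φ u.1
    have hg : ∀ l, Nondegenerate l → (l.length : ℤ) = Nat.card A + n →
        g (ofList R n l) = φ l := fun l h1 h2 => linearCombination_ofList φ h1 h2
    refine ⟨Rep.ofHom ⟨g, fun σ => hom_ext fun l h1 h2 => ?_⟩, ?_⟩
    -- The representative `(t l)⁻¹ l` depends only on the orbit, so `φ` is equivariant.
    · have h3 : (l.map σ).map (t (l.map σ)).symm = l.map (t l).symm := by
        rw [List.map_map, ht σ l h1.1]
        congr 1
        ext a
        simp [Equiv.Perm.mul_def]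
      refine (congrArg g (map_ofList σ n l)).trans ?_
      refine (hg _ ((nondegenerate_map σ).2 h1) (by simpa using h2)).trans ?_
      refine Eq.trans ?_ (congrArg (E.ρ σ) (hg l h1 h2)).symm
      simp only [φ]
      rw [h3, ht σ l h1.1, map_mul]
      rfl
    · refine Rep.hom_ext (Representation.IntertwiningMap.ext (hom_ext fun l h1 h2 => ?_))
      refine (congrArg e.hom (hg l h1 h2)).trans ?_
      simp only [φ]
      rw [he, hc, ← hf]
      simp
      rfl

theorem isSigmaCofibrant (R : Type u) [CommRing R] :
    DGCooperad.IsSigmaCofibrant ⟨data R, isDGCooperad R⟩ := by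
  intro A _ _ Y Z p hp hp' f
  refine exists_lift_of_projective (fun n hn => ?_) (projective_repComplex R A) hp
    (fun n => (Rep.epi_iff_surjective _).2 (hp' n)) f
  have := subsingleton_obj (R := R) (A := A) hn
  rw [Limits.IsZero.iff_id_eq_zero]
  refine Rep.hom_ext (Representation.IntertwiningMap.ext (LinearMap.ext fun x => ?_))
  exact Subsingleton.elim (α := Obj R A n) _ _

end Surj

theorem theoremA1 (R : Type u) [CommRing R] :
    ∃ h : (Surj.data R).IsDGCooperad,
      DGCooperad.IsNonneg ⟨Surj.data R, h⟩ ∧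
      DGCooperad.IsSigmaCofibrant ⟨Surj.data R, h⟩ ∧
      ∃ f : DGCooperad.Hom ⟨Surj.data R, h⟩ (coComNu R),
        (∀ (A : Type) [Finite A] [Nonempty A] (n : ℤ), f.app A n = Surj.augmentation R A n) ∧
        f.IsQuasiIso :=
  ⟨Surj.isDGCooperad R, Surj.isNonneg R, Surj.isSigmaCofibrant R, Surj.augmentationHom R,
    fun _ _ _ _ => rfl, Surj.augmentationHom_isQuasiIso R⟩
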